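/- Let $p$ be a prime, $\beta$ a primitive $p$-th root of unity, $r$ a primitive root of $\mathbb{Z}/p$, $\sigma$ the automorphism of $\mathbb{Q}(\beta)$ with $\sigma(\beta)=\beta^r$, and $v_i=\beta^{r^{i-1}}$, so that $v_1,\dots,v_{p-1}$ is a normal basis of $\mathbb{Q}(\beta)/\mathbb{Q}$. An element $f=\sum_{i=0}^{p-2}a_ix^i$ of the skew polynomial ring $R=\mathbb{Q}(\beta)[x;\sigma]/(x^{p-1}-1)$ (with $xc=\sigma(c)x$ for $c\in\mathbb{Q}(\beta)$, and product denoted $\ast_\sigma$) acts on $\mathbb{Q}(\beta)$ by $f(b)=\sum_i a_i\sigma^i(b)$. Let $\varphi:R\to\mathbb{Q}^{(p-1)\times(p-1)}$ be the map $\varphi(f)=(a_{ij})$, where $f(v_i)=\sum_j a_{ij}v_j$. Then $\varphi$ is bijective, and $\varphi^{-1}(C)=\sum_{j=0}^{p-2}\mu_{j+1}x^j$ with $$\mu_i=\frac1p\sum_{j=1}^{p-1}\Bigl(\frac1{v_{i+j-1}}-1\Bigr)\sum_{k=1}^{p-1}c_{jk}v_k .$$ Consider the following algorithm with input $A,B\in\mathbb{Q}^{(p-1)\times(p-1)}$,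 elements of $\mathbb{Q}(\beta)$ being represented by their coordinates in the normal basis. 1. Find $\beta$ and $r$. 2. Compute $f=\varphi^{-1}(A)$ and $g=\varphi^{-1}(B)$ by the formula above. 3. Compute the sumset $S=\{e_1,\dots,e_t\}=\mathrm{supp}(f)+\mathrm{supp}(g)\subseteq\mathbb{Z}/(p-1)$, where $0\le e_j\le p-2$ and $t=\#S$. 4. Compute the values $(g\ast_\sigma f)(v_1^i)$ for $0\le i<t$. 5. Solve the Vandermonde system $\sum_{j=1}^t v_{e_j+1}^i\,c_j=(g\ast_\sigma f)(v_1^i)$, $0\le i<t$, and set $h=\sum_j c_jx^{e_j}$. 6. Return $\varphi(h)$. Then $\beta$ and $r$ exist, and for every choice of them the algorithm, however its steps are implemented, returns $AB$. Moreover, let $M_n$ be the least number of operations of a straight-line program over $\mathbb{Q}$ (constants, $+$, $-$, $\times$) that multiplies two $n\times n$ matrices, and let $\omega=\liminf_{n\to\infty}\log_nM_n$. Let $w$ be a real number such that $w>\omega$ or $M_n=\tilde O(n^w)$. Then, with constants that depend only on $w$, for every $p$, $\beta$ and $r$ the steps can be implemented by algebraic computation trees over $\mathbb{Q}$ so that,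 for all $A$ and $B$, the total number of operations in $\mathbb{Q}$ (loads of constants, arithmetic operations and zero tests) is $$\tilde O\bigl(\max(t,1)^{\,w-2}\,p^2\bigr),$$ where $\tilde O$ hides a fixed power of $1+\log p$ (respectively of $1+\log n$ in the hypothesis on $M_n$). In particular, the cost is $\tilde O(t^{\omega-2}p^2)$ for $A,B\neq0$ whenever $M_n=\tilde O(n^{\omega})$. -/

import Mathlib

namespace SkewMM

/-! ## Computations with a bounded number of operations in the field of rationals

A program is an algebraic computation tree over `ℚ`. Rational numbers live in registers. An
arithmetic node appends its result to the memory, and the continuation only receives the address of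
the new register, never its value. The only information about values which can influence the control
flow is the outcome of a zero test. Every load of a constant, every arithmetic operation and every
zero test costs one unit. Division by zero aborts the computation. -/

/-- The four arithmetic operations of `ℚ`. -/
inductive ArithOp : Type
  | add
  | sub
  | mul
  | div

/-- Partial evaluation of an arithmetic operation. -/
def ArithOp.eval : ArithOp → ℚ → ℚ → Option ℚ
  | .add, x, y => some (x + y)
  | .sub, x, y => some (x - y)
  | .mul, x, y => some (x * y)
  | .div, x, y => if y = 0 then none else some (x / y)

/-- Algebraic computation trees over `ℚ` whose leaves carry a result of type `α` (addresses of
registers, or combinatorial data obtained from zero tests). -/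
inductive Prog (α : Type) : Type
  | ret (a : α) : Prog α
  | const (c : ℚ) (k : ℕ → Prog α) : Prog α
  | arith (o : ArithOp) (i j : ℕ) (k : ℕ → Prog α) : Prog α
  | isZero (i : ℕ) (k : Bool → Prog α) : Prog α

namespace Prog

variable {α γ : Type}

/-- Execution on a memory: the result, the final memory and the number of operations, or `none` if
a non-existing register is read or a division by zero occurs. -/
def run : Prog α → List ℚ → Option (α × List ℚ × ℕ)
  | ret a, m => some (a, m, 0)
  | const c k, m =>
      (run (k m.length) (m ++ [c])).map fun s => (s.1, s.2.1, s.2.2 + 1)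
  | arith o i j k, m =>
      (m[i]?).bind fun x => (m[j]?).bind fun y => (o.eval x y).bind fun z =>
        (run (k m.length) (m ++ [z])).map fun s => (s.1, s.2.1, s.2.2 + 1)
  | isZero i k, m =>
      (m[i]?).bind fun x =>
        (run (k (decide (x = 0))) m).map fun s => (s.1, s.2.1, s.2.2 + 1)

/-- Sequential composition. -/
def bind : Prog α → (α → Prog γ) → Prog γ
  | ret a, f => f a
  | const c k, f => const c fun a => bind (k a) f
  | arith o i j k, f => arith o i j fun a => bind (k a) f
  | isZero i k, f => isZero i fun b => bind (k b) f

/-- The program terminates successfully on memory `m`, and result, final memory and number of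
operations satisfy `Q`. -/
def Yields (P : Prog α) (m : List ℚ) (Q : α → List ℚ → ℕ → Prop) : Prop :=
  ∃ a m' c, P.run m = some (a, m', c) ∧ Q a m' c

/-- Straight-line programs over the ring operations: neither zero tests nor divisions. -/
def IsStraightLine : Prog α → Prop
  | ret _ => True
  | const _ k => ∀ a, IsStraightLine (k a)
  | arith o _ _ k => o ≠ ArithOp.div ∧ ∀ a, IsStraightLine (k a)
  | isZero _ _ => False

end Prog

/-- A table of register addresses with `k` rows and `n` columns. -/
abbrev Addr (k n : ℕ) : Type := Fin k → Fin n → ℕ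

/-- The matrix `A` is stored in memory `m` at the addresses `a`. -/
def StoresMatrix {k n : ℕ} (m : List ℚ) (a : Addr k n) (A : Matrix (Fin k) (Fin n) ℚ) : Prop :=
  ∀ i j, m[a i j]? = some (A i j)

/-! ## The exponent of matrix multiplication -/

/-- The total cost `M_n` of multiplying two `n × n` matrices over `ℚ`: the least number of
operations of a straight-line program computing the product. -/
noncomputable def matMulCost (n : ℕ) : ℕ :=
  sInf {L : ℕ | ∃ P : Addr n n → Addr n n → Prog (Addr n n),
    (∀ a b, (P a b).IsStraightLine) ∧
    ∀ (A B : Matrix (Fin n) (Fin n) ℚ) (m : List ℚ) (a b : Addr n n),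
      StoresMatrix m a A → StoresMatrix m b B →
        (P a b).Yields m fun out m' cost => StoresMatrix m' out (A * B) ∧ cost ≤ L}

/-- The asymptotic exponent of matrix multiplication, `liminf log_n M_n`. -/
noncomputable def omega : ℝ :=
  Filter.liminf (fun n : ℕ => Real.logb (n : ℝ) (matMulCost n : ℝ)) Filter.atTop

/-- `M_n` is `O(n ^ w)` up to a power of `log n`. -/
def MatMulSoftO (w : ℝ) : Prop :=
  ∃ (C : ℝ) (k : ℕ), ∀ n : ℕ, 1 ≤ n →
    (matMulCost n : ℝ) ≤ C * (n : ℝ) ^ w * (1 + Real.log n) ^ k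

/-! ## The cyclotomic field, its normal basis and skew polynomials -/

/-- The data found in the first two steps of the algorithm: a primitive `p`-th root of unity `β` and
a primitive root of `ℤ/p`, given by the generator `u` of the unit group. -/
structure Choice (p : ℕ) (K : Type*) [Field K] where
  β : K
  isPrimitiveRoot : IsPrimitiveRoot β p
  u : (ZMod p)ˣ
  generates : ∀ x : (ZMod p)ˣ, x ∈ Subgroup.zpowers u

namespace Choice

variable {p : ℕ} [Fact p.Prime] {K : Type*} [Field K] [Algebra ℚ K]
  [IsCyclotomicExtension {p} ℚ K]

/-- The primitive root of `ℤ/p` as an integer between `0` and `p - 1`. -/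
def r (c : Choice p K) : ℕ := (c.u : ZMod p).val

/-- The automorphism of `ℚ(β)` with `β ↦ β ^ r`, see `sigma_beta`. -/
noncomputable def σ (c : Choice p K) : K ≃ₐ[ℚ] K :=
  (IsCyclotomicExtension.autEquivPow K
    (Polynomial.cyclotomic.irreducible_rat (Fact.out : p.Prime).pos)).symm c.u

theorem sigma_beta (c : Choice p K) : c.σ c.β = c.β ^ c.r := by
  have hz := IsCyclotomicExtension.zeta_spec p ℚ K
  have h1 : hz.autToPow ℚ c.σ = c.u :=
    (IsCyclotomicExtension.autEquivPow K
      (Polynomial.cyclotomic.irreducible_rat (Fact.out : p.Prime).pos)).apply_symm_apply c.u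
  have h2 := hz.autToPow_spec ℚ c.σ
  rw [h1] at h2
  obtain ⟨k, -, hk⟩ := hz.eq_pow_of_pow_eq_one c.isPrimitiveRoot.pow_eq_one
  rw [← hk, map_pow, ← h2, r, ← pow_mul, ← pow_mul, mul_comm]

/-- `c.v i = β ^ (r ^ i)` for `0 ≤ i`; the normal basis is `v 0, …, v (p - 2)`. -/
noncomputable def v (c : Choice p K) (i : ℕ) : K := c.β ^ (c.r ^ i)

theorem linearIndependent_v (c : Choice p K) :
    LinearIndependent ℚ (fun i : Fin (p - 1) => c.v i) := by
  have hp : p.Prime := Fact.out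
  have hβ := c.isPrimitiveRoot
  have hβ0 : c.β ≠ 0 := hβ.ne_zero hp.ne_zero
  have hcoe : ((c.r : ℕ) : ZMod p) = (c.u : ZMod p) := by simp [r]
  have hord : orderOf c.u = p - 1 := by
    rw [orderOf_eq_card_of_forall_mem_zpowers c.generates, Nat.card_eq_fintype_card,
      ZMod.card_units_eq_totient, Nat.totient_prime hp]
  have hdim : (hβ.powerBasis ℚ).dim = p - 1 := by
    rw [← PowerBasis.finrank, IsCyclotomicExtension.finrank (n := p) K
      (Polynomial.cyclotomic.irreducible_rat hp.pos), Nat.totient_prime hp]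
  -- the exponents `r ^ i` modulo `p`, lowered by one, are distinct elements of `0, …, p - 2`
  have hval : ∀ i : ℕ, ((c.u ^ i : (ZMod p)ˣ) : ZMod p).val ≠ 0 := fun i h =>
    (c.u ^ i).ne_zero ((ZMod.val_eq_zero _).1 h)
  have hlt : ∀ i : ℕ, ((c.u ^ i : (ZMod p)ˣ) : ZMod p).val - 1 < (hβ.powerBasis ℚ).dim := by
    intro i
    have h1 := ZMod.val_lt ((c.u ^ i : (ZMod p)ˣ) : ZMod p)
    have h2 := hval i
    omega
  let e : Fin (p - 1) → Fin (hβ.powerBasis ℚ).dim := fun i => ⟨_, hlt i⟩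
  have he : Function.Injective e := by
    intro i j hij
    have h1 : ((c.u ^ i.val : (ZMod p)ˣ) : ZMod p).val - 1
        = ((c.u ^ j.val : (ZMod p)ˣ) : ZMod p).val - 1 := congrArg Fin.val hij
    have h2 := hval i
    have h3 := hval j
    have h4 : ((c.u ^ i.val : (ZMod p)ˣ) : ZMod p).val
        = ((c.u ^ j.val : (ZMod p)ˣ) : ZMod p).val := by omega
    have h5 : c.u ^ i.val = c.u ^ j.val := Units.ext (ZMod.val_injective p h4)
    have h6 := pow_injOn_Iio_orderOf (x := c.u) (by simp [hord]) (by simp [hord]) h5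
    exact Fin.ext h6
  have hli := ((hβ.powerBasis ℚ).basis.linearIndependent.comp e he).map'
    (LinearMap.mulLeft ℚ c.β) (LinearMap.ker_eq_bot.2 (mul_right_injective₀ hβ0))
  convert! hli using 1
  funext i
  have hmod : c.r ^ i.val % p = ((c.u ^ i.val : (ZMod p)ˣ) : ZMod p).val := by
    rw [← ZMod.val_natCast, Nat.cast_pow, hcoe, Units.val_pow_eq_pow_val]
  have h1 : c.v i = c.β ^ ((c.u ^ i.val : (ZMod p)ˣ) : ZMod p).val := by
    rw [v, ← hmod, ← pow_mod_orderOf, ← hβ.eq_orderOf]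
  have hgen : (hβ.powerBasis ℚ).gen = c.β := hβ.powerBasis_gen ℚ
  simp only [Function.comp_apply, PowerBasis.coe_basis, LinearMap.mulLeft_apply, e]
  rw [h1, hgen, ← pow_succ', Nat.sub_add_cancel (Nat.one_le_iff_ne_zero.2 (hval i))]

theorem card_eq_finrank (p : ℕ) [Fact p.Prime] (K : Type*) [Field K] [Algebra ℚ K]
    [IsCyclotomicExtension {p} ℚ K] :
    Fintype.card (Fin (p - 1)) = Module.finrank ℚ K := by
  rw [IsCyclotomicExtension.finrank (n := p) K
    (Polynomial.cyclotomic.irreducible_rat (Fact.out : p.Prime).pos), Nat.totient_prime Fact.out,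
    Fintype.card_fin]

/-- The normal basis `v 0, …, v (p - 2)` of `ℚ(β)` over `ℚ`. -/
noncomputable def normalBasis (c : Choice p K) :
    Module.Basis (Fin (p - 1)) ℚ K :=
  haveI : Nonempty (Fin (p - 1)) :=
    ⟨⟨0, Nat.sub_pos_of_lt (Fact.out : p.Prime).one_lt⟩⟩
  basisOfLinearIndependentOfCardEqFinrank c.linearIndependent_v (card_eq_finrank p K)

theorem normalBasis_apply (c : Choice p K) (i : Fin (p - 1)) : c.normalBasis i = c.v i := by
  simp [normalBasis]

end Choice

/-- Elements of `ℚ(β)[x;σ] / (x ^ (p - 1) - 1)`, written as skew polynomials of degree at most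
`p - 2`: the family of coefficients of `x ^ 0, …, x ^ (p - 2)`. -/
abbrev Skew (p : ℕ) (K : Type*) : Type _ := Fin (p - 1) → K

/-- The support of a skew polynomial. -/
noncomputable def supp {p : ℕ} {K : Type*} [Field K] (f : Skew p K) : Finset (Fin (p - 1)) :=
  letI := Classical.decEq K
  Finset.univ.filter fun i => f i ≠ 0

/-- The sumset of the supports of two skew polynomials, modulo `p - 1`. -/
noncomputable def sumset {p : ℕ} {K : Type*} [Field K] (f g : Skew p K) : Finset (Fin (p - 1)) :=
  letI := Classical.propDecidable
  Finset.univ.filter fun l => ∃ i ∈ supp f, ∃ j ∈ supp g, (i.val + j.val) % (p - 1) = l.val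

namespace Choice

variable {p : ℕ} [Fact p.Prime] {K : Type*} [Field K] [Algebra ℚ K]
  [IsCyclotomicExtension {p} ℚ K] (c : Choice p K)

/-- The product in `ℚ(β)[x;σ] / (x ^ (p - 1) - 1)`, determined by
`(a x ^ i) (b x ^ j) = a σ ^ i (b) x ^ (i + j)` and `x ^ (p - 1) = 1`. -/
noncomputable def mul (f g : Skew p K) : Skew p K := fun l =>
  ∑ i, ∑ j, if (i.val + j.val) % (p - 1) = l.val then f i * (c.σ ^ i.val) (g j) else 0

/-- Evaluation `f(b) = ∑ f_i σ ^ i (b)`. -/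
noncomputable def eval (f : Skew p K) (b : K) : K :=
  ∑ i, f i * (c.σ ^ i.val) b

/-- The map `φ`: the `i`-th row of `φ(f)` holds the coordinates of `f(v_i)` in the normal basis. -/
noncomputable def phi (f : Skew p K) : Matrix (Fin (p - 1)) (Fin (p - 1)) ℚ :=
  Matrix.of fun i j => c.normalBasis.repr (c.eval f (c.v i)) j

/-- The explicit formula for `φ⁻¹`: the coefficient vector of `φ⁻¹(A)` is `p⁻¹ W A v`, where
`W` has the entries `1 / v_(i+j) - 1`. -/
noncomputable def phiInv (A : Matrix (Fin (p - 1)) (Fin (p - 1)) ℚ) : Skew p K := fun i =>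
  (p : K)⁻¹ * ∑ j, ((c.v (i.val + j.val))⁻¹ - 1) *
    ∑ k : Fin (p - 1), algebraMap ℚ K (A j k) * c.v k

/-- The elements `z 0, …, z (k - 1)` of `ℚ(β)` are stored in memory `m` at the addresses `a`, each
through its coordinates in the normal basis. For `k = p - 1` these are the coefficients of a skew
polynomial. -/
def Stores {k : ℕ} (m : List ℚ) (a : Addr k (p - 1)) (z : Fin k → K) : Prop :=
  ∀ i j, m[a i j]? = some (c.normalBasis.repr (z i) j)

/-- The interpolation problem: `h` has its exponents in `S = {e_1, …, e_t}`, and its coefficients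
solve the Vandermonde system `∑_{e ∈ S} v_e ^ i h_e = z_i`, `0 ≤ i < t`. -/
def Interpolates (S : Finset (Fin (p - 1))) (z : Fin S.card → K)
    (h : Skew p K) : Prop :=
  (∀ e, e ∉ S → h e = 0) ∧ ∀ i : Fin S.card, ∑ e ∈ S, c.v e ^ i.val * h e = z i

end Choice

/-! ## The algorithm -/

/-- An implementation of matrix multiplication via skew polynomials, for a given choice of `β` and
`r`: one program for each of the steps of the algorithm. A step works on its input wherever this is
stored. -/
structure Implementation {p : ℕ} [Fact p.Prime] {K : Type*} [Field K] [Algebra ℚ K]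
    [IsCyclotomicExtension {p} ℚ K] (c : Choice p K) where
  /-- Computes `φ⁻¹` of a matrix. -/
  toSkew : Addr (p - 1) (p - 1) → Prog (Addr (p - 1) (p - 1))
  toSkew_spec : ∀ A m a, StoresMatrix m a A →
    (toSkew a).Yields m fun out m' _ => c.Stores m' out (c.phiInv A)
  /-- Computes the sumset of two skew polynomials. -/
  findSumset : Addr (p - 1) (p - 1) → Addr (p - 1) (p - 1) → Prog (Finset (Fin (p - 1)))
  findSumset_spec : ∀ f g m a b, c.Stores m a f → c.Stores m b g →
    (findSumset a b).Yields m fun S _ _ => S = sumset f g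
  /-- Computes the values of the product `g * f` at the first `t` powers of `v 0 = β`. -/
  evaluate : Addr (p - 1) (p - 1) → Addr (p - 1) (p - 1) → (t : ℕ) → Prog (Addr t (p - 1))
  evaluate_spec : ∀ f g m a b t, c.Stores m a f → c.Stores m b g →
    (evaluate a b t).Yields m fun out m' _ =>
      c.Stores m' out fun i => c.eval (c.mul g f) (c.v 0 ^ i.val)
  /-- Solves the Vandermonde system for the coefficients of a skew polynomial. -/
  interpolate : (S : Finset (Fin (p - 1))) → Addr S.card (p - 1) → Prog (Addr (p - 1) (p - 1))
  interpolate_spec : ∀ S z m a, c.Stores m a z →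
    (interpolate S a).Yields m fun out m' _ => ∃ h, c.Stores m' out h ∧ c.Interpolates S z h
  /-- Computes `φ` of a skew polynomial. -/
  toMatrix : Addr (p - 1) (p - 1) → Prog (Addr (p - 1) (p - 1))
  toMatrix_spec : ∀ f m a, c.Stores m a f →
    (toMatrix a).Yields m fun out m' _ => StoresMatrix m' out (c.phi f)

/-- The whole algorithm: the steps are executed one after the other. -/
def Implementation.prog {p : ℕ} [Fact p.Prime] {K : Type*} [Field K] [Algebra ℚ K]
    [IsCyclotomicExtension {p} ℚ K] {c : Choice p K} (I : Implementation c)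
    (a b : Addr (p - 1) (p - 1)) : Prog (Addr (p - 1) (p - 1)) :=
  (I.toSkew a).bind fun f =>
  (I.toSkew b).bind fun g =>
  (I.findSumset f g).bind fun S =>
  (I.evaluate f g S.card).bind fun z =>
  (I.interpolate S z).bind fun h =>
  I.toMatrix h

end SkewMM

/-! Correctness. Acting on `ℚ(β)` turns the product of `g` and `f` into the composite `b ↦ g(f(b))`
(`eval_mul`). Since `φ` stores images of basis vectors as rows, `phi_mul` reverses the order and
yields `A * B` for `f = φ⁻¹(A)`, `g = φ⁻¹(B)`. The formula for `φ⁻¹` is the duality `sum_dual`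
between the normal basis and the elements `(1/v - 1)/p`, that is, orthogonality of the additive
characters of `ℤ/p`. The product of `g` and `f` is supported in the sumset, and the Vandermonde
nodes `v_e` are distinct, so by `Interpolates.unique` every implementation of the fifth step must
return this product.

Cost of the linear steps. Up to logarithms, a convolution with constants over `ℚ(β)` takes `p ^ 2`
operations (`computes_conv`). Elements of `ℚ(β)` become polynomials in `β` of degree below `p`,
lifted to `ℚ[y]/(y ^ m + 1)` with `m` a power of two of size about `p`. There `y` is a root of unity
for a Fourier transform whose twiddle factors are mere shifts, and multiplication by a constant in
this ring is done recursively in the manner of Schönhage and Strassen (`computes_aeval`). Both `φ`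
and `φ⁻¹` are Hankel matrices, hence convolutions. Interpolation is three convolutions, because the
generating function of the values is rational with the known denominator `∏ (1 - v_e T)`
(`computes_interpolation`).

Cost of evaluation. Each `β ^ i` is a basis vector or `1 = -∑ v_j`, so the coordinates of `f(β ^ i)`
come from rows of `φ(f)`. Applying `g` is then the product of a `t × (p - 1)` and a `(p - 1) × (p -
1)` matrix. Cut into `t × t` blocks it costs about `(p / t) ^ 2 * t ^ w` operations
(`computes_evaluation`).

The exponent. If `w > ω`, a single size `n` with small `M_n` is enough: the bilinear part of a
straight-line program is a bilinear algorithm of rank at most `2 M_n`, and applying it recursively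
to blocks handles every size (`fastMul_of_omega_lt`). The bound `M_n ≥ n ^ 2` gives `w ≥ 2`, so that
the terms of size `p ^ 2` are absorbed.

Costs are counted by `Computes`, where rational scalars are free, over an arbitrary commutative
`ℚ`-algebra. Over functions on the space of inputs, `Computes.compile` turns such counts into
programs; over polynomials, the same notion expresses what a straight-line program does to generic
matrices. -/

set_option linter.unusedSectionVars false

namespace SkewMM

/-! ## Straight-line computations in commutative `ℚ`-algebras -/

section Calculus

variable {R : Type} [CommRing R] [Algebra ℚ R]

/-- Rational multiples of `1` and of elements of `H`. -/
def scalings (H : Set R) : Set R := {z | ∃ (s : ℚ) (x : R), (x ∈ H ∨ x = 1) ∧ z = s • x}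

/-- `Steps F n H`: the set `H` arises from `F` by `n` sums and products of rational multiples of
elements which are already present. -/
inductive Steps (F : Set R) : ℕ → Set R → Prop
  | nil : Steps F 0 F
  | add {n : ℕ} {H : Set R} {x y : R} : Steps F n H → x ∈ scalings H → y ∈ scalings H →
      Steps F (n + 1) (insert (x + y) H)
  | mul {n : ℕ} {H : Set R} {x y : R} : Steps F n H → x ∈ scalings H → y ∈ scalings H →
      Steps F (n + 1) (insert (x * y) H)

/-- The elements of `G` can be computed from those of `F` by `n` additions and multiplications;
multiplications by rational numbers are not counted. -/
def Computes (F : Set R) (n : ℕ) (G : Set R) : Prop :=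
  ∃ k H, k ≤ n ∧ Steps F k H ∧ G ⊆ scalings H

theorem subset_scalings (H : Set R) : H ⊆ scalings H :=
  fun x hx => ⟨1, x, Or.inl hx, (one_smul _ _).symm⟩

theorem smul_mem_scalings {H : Set R} (s : ℚ) {x : R} (hx : x ∈ scalings H) :
    s • x ∈ scalings H := by
  obtain ⟨t, y, hy, rfl⟩ := hx
  exact ⟨s * t, y, hy, smul_smul _ _ _⟩

theorem neg_mem_scalings {H : Set R} {x : R} (hx : x ∈ scalings H) : -x ∈ scalings H := by
  simpa using smul_mem_scalings (-1) hx

theorem zero_mem_scalings (H : Set R) : (0 : R) ∈ scalings H :=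
  ⟨0, 1, Or.inr rfl, (zero_smul _ _).symm⟩

theorem algebraMap_mem_scalings (H : Set R) (s : ℚ) : algebraMap ℚ R s ∈ scalings H :=
  ⟨s, 1, Or.inr rfl, Algebra.algebraMap_eq_smul_one s⟩

theorem scalings_subset {H G : Set R} (h : H ⊆ scalings G) : scalings H ⊆ scalings G := by
  rintro _ ⟨s, x, hx | rfl, rfl⟩
  · exact smul_mem_scalings s (h hx)
  · exact ⟨s, 1, Or.inr rfl, rfl⟩

theorem scalings_mono {H G : Set R} (h : H ⊆ G) : scalings H ⊆ scalings G :=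
  scalings_subset (h.trans (subset_scalings G))

/-- A rational multiple of a rational multiple is again one, so the second computation can be
replayed on scaled inputs at no extra cost. -/
theorem Steps.trans {F G H E : Set R} {n k : ℕ} (h : Steps F n H) (hG : G ⊆ scalings H)
    (h2 : Steps G k E) : ∃ H', Steps F (n + k) H' ∧ H ⊆ H' ∧ E ⊆ scalings H' := by
  induction h2 with
  | nil => exact ⟨H, h, subset_rfl, hG⟩
  | @add j E x y _ hx hy ih =>
    obtain ⟨H', h1, h2, h3⟩ := ih
    refine ⟨insert (x + y) H', h1.add (scalings_subset h3 hx) (scalings_subset h3 hy),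
      h2.trans (Set.subset_insert _ _), Set.insert_subset ?_ ?_⟩
    · exact subset_scalings _ (Set.mem_insert _ _)
    · exact h3.trans (scalings_mono (Set.subset_insert _ _))
  | @mul j E x y _ hx hy ih =>
    obtain ⟨H', h1, h2, h3⟩ := ih
    refine ⟨insert (x * y) H', h1.mul (scalings_subset h3 hx) (scalings_subset h3 hy),
      h2.trans (Set.subset_insert _ _), Set.insert_subset ?_ ?_⟩
    · exact subset_scalings _ (Set.mem_insert _ _)
    · exact h3.trans (scalings_mono (Set.subset_insert _ _))

theorem Steps.subset {F H : Set R} {n : ℕ} (h : Steps F n H) : F ⊆ H := by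
  induction h with
  | nil => exact subset_rfl
  | add _ _ _ ih => exact ih.trans (Set.subset_insert _ _)
  | mul _ _ _ ih => exact ih.trans (Set.subset_insert _ _)

namespace Computes

variable {F G E : Set R} {n k : ℕ}

theorem of_subset (h : G ⊆ scalings F) : Computes F 0 G := ⟨0, F, le_rfl, .nil, h⟩

/-- Sequential composition which keeps the input. -/
theorem trans_union (h : Computes F n G) (h2 : Computes (F ∪ G) k E) :
    Computes F (n + k) (F ∪ G ∪ E) := by
  obtain ⟨n', H, hn, hH, hG⟩ := h
  obtain ⟨k', H2, hk, hH2, hE⟩ := h2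
  have hFG : F ∪ G ⊆ scalings H :=
    Set.union_subset (hH.subset.trans (subset_scalings _)) hG
  obtain ⟨H', h1, h3, h4⟩ := hH.trans hFG hH2
  exact ⟨_, H', add_le_add hn hk, h1, Set.union_subset (hFG.trans (scalings_mono h3))
    (hE.trans (scalings_subset h4))⟩

theorem mono {F' G' : Set R} {n' : ℕ} (h : Computes F n G) (hF : F ⊆ scalings F')
    (hn : n ≤ n') (hG : G' ⊆ scalings G) : Computes F' n' G' := by
  obtain ⟨k, H, hk, hH, hGH⟩ := h
  obtain ⟨H', h1, -, h3⟩ := (Steps.nil (F := F')).trans hF hH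
  refine ⟨0 + k, H', by omega, h1, (hG.trans (scalings_subset hGH)).trans (scalings_subset h3)⟩

theorem mono_left {F' : Set R} (h : Computes F n G) (hF : F ⊆ F') : Computes F' n G :=
  h.mono (hF.trans (subset_scalings _)) le_rfl (subset_scalings _)

theorem mono_right {G' : Set R} (h : Computes F n G) (hG : G' ⊆ G) : Computes F n G' :=
  h.mono (subset_scalings _) le_rfl (hG.trans (subset_scalings _))

theorem mono_cost (h : Computes F n G) {n' : ℕ} (hn : n ≤ n') : Computes F n' G :=
  h.mono (subset_scalings _) hn (subset_scalings _)

theorem trans' (h : Computes F n G) (h2 : Computes (F ∪ G) k E) : Computes F (n + k) E :=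
  (h.trans_union h2).mono_right Set.subset_union_right

theorem trans (h : Computes F n G) (h2 : Computes G k E) : Computes F (n + k) E :=
  h.trans' (h2.mono_left Set.subset_union_right)

theorem union (h : Computes F n G) (h2 : Computes F k E) : Computes F (n + k) (G ∪ E) :=
  (h.trans_union (h2.mono_left Set.subset_union_left)).mono_right
    (Set.union_subset_union_left _ Set.subset_union_right)

theorem biUnion {ι : Type*} (s : Finset ι) (c : ι → ℕ) (T : ι → Set R)
    (h : ∀ i ∈ s, Computes F (c i) (T i)) : Computes F (∑ i ∈ s, c i) (⋃ i ∈ s, T i) := by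
  classical
  induction s using Finset.induction_on with
  | empty => exact of_subset (by simp)
  | insert a s ha ih =>
    rw [Finset.sum_insert ha, Finset.set_biUnion_insert]
    exact (h a (Finset.mem_insert_self _ _)).union
      (ih fun i hi => h i (Finset.mem_insert_of_mem hi))

theorem biUnion_const {ι : Type*} (s : Finset ι) (c : ℕ) (T : ι → Set R)
    (h : ∀ i ∈ s, Computes F c (T i)) : Computes F (s.card * c) (⋃ i ∈ s, T i) := by
  simpa using biUnion s (fun _ => c) T h

theorem add {x y : R} (hx : x ∈ scalings F) (hy : y ∈ scalings F) : Computes F 1 {x + y} :=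
  ⟨1, _, le_rfl, Steps.nil.add hx hy,
    Set.singleton_subset_iff.2 (subset_scalings _ (Set.mem_insert _ _))⟩

theorem mul {x y : R} (hx : x ∈ scalings F) (hy : y ∈ scalings F) : Computes F 1 {x * y} :=
  ⟨1, _, le_rfl, Steps.nil.mul hx hy,
    Set.singleton_subset_iff.2 (subset_scalings _ (Set.mem_insert _ _))⟩

theorem sum {ι : Type*} (s : Finset ι) (x : ι → R) (h : ∀ i ∈ s, x i ∈ scalings F) :
    Computes F s.card {∑ i ∈ s, x i} := by
  classical
  induction s using Finset.induction_on with
  | empty => exact of_subset (by simp [zero_mem_scalings])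
  | insert a s ha ih =>
    rw [Finset.card_insert_of_notMem ha, Finset.sum_insert ha]
    refine (ih fun i hi => h i (Finset.mem_insert_of_mem hi)).trans' (add ?_ ?_)
    · exact scalings_mono Set.subset_union_left (h a (Finset.mem_insert_self _ _))
    · exact subset_scalings _ (Or.inr rfl)

/-- Allows a computation with indeterminates to be specialised to any algebra. -/
theorem map {R' : Type} [CommRing R'] [Algebra ℚ R'] (f : R →ₐ[ℚ] R') (h : Computes F n G) :
    Computes (f '' F) n (f '' G) := by
  have key : ∀ H : Set R, f '' scalings H ⊆ scalings (f '' H) := by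
    rintro H _ ⟨_, ⟨s, x, hx | rfl, rfl⟩, rfl⟩
    · exact ⟨s, f x, Or.inl ⟨x, hx, rfl⟩, map_smul f s x⟩
    · exact ⟨s, 1, Or.inr rfl, by simp⟩
  obtain ⟨k, H, hk, hH, hG⟩ := h
  refine ⟨k, f '' H, hk, ?_, (Set.image_mono hG).trans (key H)⟩
  clear hG hk
  induction hH with
  | nil => exact .nil
  | add _ hx hy ih =>
    rw [Set.image_insert_eq, map_add]
    exact ih.add (key _ ⟨_, hx, rfl⟩) (key _ ⟨_, hy, rfl⟩)
  | mul _ hx hy ih =>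
    rw [Set.image_insert_eq, map_mul]
    exact ih.mul (key _ ⟨_, hx, rfl⟩) (key _ ⟨_, hy, rfl⟩)

end Computes

end Calculus

/-! ## Compilation to programs -/

namespace Prog

variable {α γ : Type}

theorem run_bind (P : Prog α) (f : α → Prog γ) (m : List ℚ) :
    (P.bind f).run m = (P.run m).bind fun s =>
      ((f s.1).run s.2.1).map fun s' => (s'.1, s'.2.1, s.2.2 + s'.2.2) := by
  induction P generalizing m with
  | ret a => simp [bind, run]
  | const c k ih =>
    simp only [bind, run, ih]
    cases (k m.length).run (m ++ [c]) <;> simp [Function.comp_def, add_right_comm]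
  | arith o i j k ih =>
    simp only [bind, run, ih]
    cases m[i]? <;> simp
    cases m[j]? <;> simp
    rename_i x y
    cases o.eval x y <;> simp
    rename_i z
    cases (k m.length).run (m ++ [z]) <;> simp [Function.comp_def, add_right_comm]
  | isZero i k ih =>
    simp only [bind, run, ih]
    cases m[i]? <;> simp
    rename_i x
    cases (k (decide (x = 0))).run m <;> simp [Function.comp_def, add_right_comm]

theorem Yields.bind {P : Prog α} {f : α → Prog γ} {m : List ℚ} {Q : γ → List ℚ → ℕ → Prop}
    (h : P.Yields m fun a m' n => (f a).Yields m' fun b m'' n' => Q b m'' (n + n')) :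
    (P.bind f).Yields m Q := by
  obtain ⟨a, m', n, h1, b, m'', n', h2, hQ⟩ := h
  exact ⟨b, m'', n + n', by simp [run_bind, h1, h2], hQ⟩

theorem Yields.mono {P : Prog α} {m : List ℚ} {Q Q' : α → List ℚ → ℕ → Prop}
    (h : P.Yields m Q) (hQ : ∀ a m' n, Q a m' n → Q' a m' n) : P.Yields m Q' := by
  obtain ⟨a, m', n, h1, h2⟩ := h
  exact ⟨a, m', n, h1, hQ _ _ _ h2⟩

theorem Yields.and {P : Prog α} {m : List ℚ} {Q Q' : α → List ℚ → ℕ → Prop}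
    (h : P.Yields m Q) (h' : P.Yields m Q') : P.Yields m fun a m' n => Q a m' n ∧ Q' a m' n := by
  obtain ⟨a, m', n, h1, h2⟩ := h
  obtain ⟨b, m'', n', h1', h2'⟩ := h'
  rw [h1, Option.some_inj, Prod.mk.injEq, Prod.mk.injEq] at h1'
  obtain ⟨rfl, rfl, rfl⟩ := h1'
  exact ⟨a, m', n, h1, h2, h2'⟩

/-- Registers are only appended, never overwritten; hence whatever is stored stays readable at its
address throughout later steps. -/
theorem run_prefix {P : Prog α} {m m' : List ℚ} {a : α} {n : ℕ}
    (h : P.run m = some (a, m', n)) : m <+: m' := by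
  induction P generalizing m n with
  | ret b =>
    simp only [run, Option.some_inj, Prod.mk.injEq] at h
    exact h.2.1 ▸ List.prefix_rfl
  | const c k ih =>
    simp only [run, Option.map_eq_some_iff] at h
    obtain ⟨⟨_, _, _⟩, h1, h2⟩ := h
    simp only [Prod.mk.injEq] at h2
    obtain ⟨rfl, rfl, -⟩ := h2
    exact (List.prefix_append _ _).trans (ih _ h1)
  | arith o i j k ih =>
    simp only [run, Option.map_eq_some_iff, Option.bind_eq_some_iff] at h
    obtain ⟨_, _, _, _, _, _, ⟨_, _, _⟩, h1, h2⟩ := h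
    simp only [Prod.mk.injEq] at h2
    obtain ⟨rfl, rfl, -⟩ := h2
    exact (List.prefix_append _ _).trans (ih _ h1)
  | isZero i k ih =>
    simp only [run, Option.map_eq_some_iff, Option.bind_eq_some_iff] at h
    obtain ⟨_, _, ⟨_, _, _⟩, h1, h2⟩ := h
    simp only [Prod.mk.injEq] at h2
    obtain ⟨rfl, rfl, -⟩ := h2
    exact ih _ h1

theorem Yields.prefix {P : Prog α} {m : List ℚ} {Q : α → List ℚ → ℕ → Prop}
    (h : P.Yields m Q) : P.Yields m fun a m' n => m <+: m' ∧ Q a m' n := by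
  obtain ⟨a, m', n, h1, h2⟩ := h
  exact ⟨a, m', n, h1, run_prefix h1, h2⟩

theorem IsStraightLine.bind {P : Prog α} {f : α → Prog γ} (hP : P.IsStraightLine)
    (hf : ∀ a, (f a).IsStraightLine) : (P.bind f).IsStraightLine := by
  induction P with
  | ret a => exact hf a
  | const c k ih => exact fun a => ih a (hP a)
  | arith o i j k ih => exact ⟨hP.1, fun a => ih a (hP.2 a)⟩
  | isZero i k ih => exact hP.elim

end Prog

theorem getElem?_of_prefix {m m' : List ℚ} (h : m <+: m') {i : ℕ} {x : ℚ} (hx : m[i]? = some x) :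
    m'[i]? = some x := by
  obtain ⟨l, rfl⟩ := h
  rw [List.getElem?_append_left (List.getElem?_eq_some_iff.1 hx).1, hx]

/-- Loads `s • x`, where `x` lives at the given address or is `1`. -/
def loadScaled (s : ℚ) : Option ℕ → Prog ℕ
  | some i => .const s fun a => .arith .mul a i .ret
  | none => .const s .ret

theorem loadScaled_isStraightLine (s : ℚ) (i : Option ℕ) : (loadScaled s i).IsStraightLine := by
  cases i <;> simp [loadScaled, Prog.IsStraightLine]

theorem loadScaled_yields (s : ℚ) {i : Option ℕ} {x : ℚ} {m : List ℚ}
    (h : ∀ j, i = some j → m[j]? = some x) (h' : i = none → x = 1) :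
    (loadScaled s i).Yields m fun d m' n => m'[d]? = some (s * x) ∧ n ≤ 2 := by
  cases i with
  | none => simp [loadScaled, Prog.Yields, Prog.run, h' rfl]
  | some i =>
    have hi := h i rfl
    have hi' : (m ++ [s])[i]? = some x := getElem?_of_prefix (List.prefix_append _ _) hi
    simp [loadScaled, Prog.Yields, Prog.run, hi', ArithOp.eval]

/-- One arithmetic operation on scaled operands. -/
def scaledOp (o : ArithOp) (s t : ℚ) (i j : Option ℕ) : Prog ℕ :=
  (loadScaled s i).bind fun a => (loadScaled t j).bind fun b => .arith o a b .ret

theorem scaledOp_isStraightLine {o : ArithOp} (ho : o ≠ .div) (s t : ℚ) (i j : Option ℕ) :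
    (scaledOp o s t i j).IsStraightLine :=
  (loadScaled_isStraightLine s i).bind fun _ => (loadScaled_isStraightLine t j).bind fun _ =>
    ⟨ho, fun _ => trivial⟩

theorem scaledOp_yields {o : ArithOp} {s t x y z : ℚ} (ho : o.eval (s * x) (t * y) = some z)
    {i j : Option ℕ} {m : List ℚ}
    (hi : ∀ k, i = some k → m[k]? = some x) (hi' : i = none → x = 1)
    (hj : ∀ k, j = some k → m[k]? = some y) (hj' : j = none → y = 1) :
    (scaledOp o s t i j).Yields m fun d m' n => m'[d]? = some z ∧ n ≤ 5 := by
  refine Prog.Yields.bind ((loadScaled_yields s hi hi').prefix.mono ?_)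
  rintro a m1 n1 ⟨hm1, ha, hn1⟩
  refine Prog.Yields.bind ((loadScaled_yields t
    (fun k hk => getElem?_of_prefix hm1 (hj k hk)) hj').prefix.mono ?_)
  rintro b m2 n2 ⟨hm2, hb, hn2⟩
  refine ⟨m2.length, m2 ++ [z], 1, ?_, ?_, by omega⟩
  · simp [Prog.run, getElem?_of_prefix hm2 ha, hb, ho]
  · simp

section Compile

variable {X ι κ : Type}

/-- Each function in `H` has its value at `ξ` in memory, at the address given by `out`. -/
def Located (m : List ℚ) (ξ : X) (out : (X → ℚ) → ℕ) (H : Set (X → ℚ)) : Prop :=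
  ∀ h ∈ H, m[out h]? = some (h ξ)

/-- A program which finds the functions in `H` from those of a family `x`. -/
def Compiled (x : ι → X → ℚ) (n : ℕ) (H : Set (X → ℚ))
    (P : (ι → ℕ) → Prog ((X → ℚ) → ℕ)) : Prop :=
  ∀ a, (P a).IsStraightLine ∧ ∀ m ξ, (∀ i, m[a i]? = some (x i ξ)) →
    (P a).Yields m fun out m' k => Located m' ξ out H ∧ k ≤ n

/-- Each of the two scaled operands takes at most two instructions and the operation itself one,
whence the 5. -/
theorem Compiled.op {x : ι → X → ℚ} {n : ℕ} {H : Set (X → ℚ)}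
    {P : (ι → ℕ) → Prog ((X → ℚ) → ℕ)} (hP : Compiled x n H P) {o : ArithOp} (ho : o ≠ .div)
    {y z w : X → ℚ} (hy : y ∈ scalings H) (hz : z ∈ scalings H)
    (hw : ∀ ξ, o.eval (y ξ) (z ξ) = some (w ξ)) :
    ∃ P', Compiled x (n + 5) (insert w H) P' := by
  classical
  obtain ⟨s, y', hy', rfl⟩ := hy
  obtain ⟨t, z', hz', rfl⟩ := hz
  let loc (out : (X → ℚ) → ℕ) (u : X → ℚ) : Option ℕ := if u ∈ H then some (out u) else none
  have hloc : ∀ (m : List ℚ) ξ out, Located m ξ out H → ∀ u, u ∈ H ∨ u = 1 →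
      (∀ k, loc out u = some k → m[k]? = some (u ξ)) ∧ (loc out u = none → u ξ = 1) := by
    intro m ξ out h u hu
    by_cases huH : u ∈ H
    · refine ⟨fun k hk => ?_, fun hk => ?_⟩
      · simp only [loc, huH, if_true, Option.some_inj] at hk
        exact hk ▸ h u huH
      · simp [loc, huH] at hk
    · refine ⟨fun k hk => ?_, fun hk => ?_⟩
      · simp [loc, huH] at hk
      · simp [hu.resolve_left huH]
  refine ⟨fun a => (P a).bind fun out =>
    (scaledOp o s t (loc out y') (loc out z')).bind fun d => .ret (Function.update out w d),
    fun a => ⟨(hP a).1.bind fun _ => (scaledOp_isStraightLine ho _ _ _ _).bind fun _ => trivial,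
      fun m ξ hm => ?_⟩⟩
  refine Prog.Yields.bind (((hP a).2 m ξ hm).mono ?_)
  rintro out m1 n1 ⟨hout, hn1⟩
  obtain ⟨h1, h2⟩ := hloc m1 ξ out hout y' hy'
  obtain ⟨h3, h4⟩ := hloc m1 ξ out hout z' hz'
  refine Prog.Yields.bind ((scaledOp_yields (hw ξ) h1 h2 h3 h4).prefix.mono ?_)
  rintro d m2 n2 ⟨hm2, hd, hn2⟩
  refine ⟨_, m2, 0, rfl, fun h hh => ?_, by omega⟩
  by_cases hhw : h = w
  · subst hhw
    simpa using hd
  · rw [Function.update_of_ne hhw]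
    exact getElem?_of_prefix hm2 (hout h (hh.resolve_left hhw))

theorem Steps.compile {x : ι → X → ℚ} {n : ℕ} {H : Set (X → ℚ)} (h : Steps (Set.range x) n H) :
    ∃ P, Compiled x (5 * n) H P := by
  classical
  induction h with
  | nil =>
    -- Several inputs may be the same function; the address of any one of them will do.
    refine ⟨fun a => .ret fun h => if hh : ∃ i, x i = h then a hh.choose else 0,
      fun a => ⟨trivial, fun m ξ hm => ⟨_, m, 0, rfl, ?_, by omega⟩⟩⟩
    intro h hh
    have hh' : ∃ i, x i = h := hh
    simp only [dif_pos hh', hm]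
    exact congrArg some (congrFun hh'.choose_spec ξ)
  | add _ hx hy ih =>
    obtain ⟨P, hP⟩ := ih
    exact hP.op (o := .add) (by simp) hx hy fun ξ => rfl
  | mul _ hx hy ih =>
    obtain ⟨P, hP⟩ := ih
    exact hP.op (o := .mul) (by simp) hx hy fun ξ => rfl

/-- Outputs need only be rational multiples of computed elements. Adding `0` to each, at one
operation apiece, gives them registers of their own. -/
theorem Computes.exists_steps [Fintype κ] {F : Set (X → ℚ)} {y : κ → X → ℚ} {n : ℕ}
    (h : Computes F n (Set.range y)) :
    ∃ k H, k ≤ n + Fintype.card κ ∧ Steps F k H ∧ Set.range y ⊆ H := by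
  classical
  obtain ⟨k, H, hk, hH, hy⟩ := h
  have key : ∀ s : Finset κ, ∃ H', Steps F (k + s.card) H' ∧ H ⊆ H' ∧ ∀ i ∈ s, y i ∈ H' := by
    intro s
    induction s using Finset.induction_on with
    | empty => exact ⟨H, hH, subset_rfl, by simp⟩
    | insert i s hi ih =>
      obtain ⟨H', h1, h2, h3⟩ := ih
      refine ⟨insert (y i + 0) H', ?_, h2.trans (Set.subset_insert _ _), ?_⟩
      · rw [Finset.card_insert_of_notMem hi]
        exact h1.add (scalings_mono h2 (hy ⟨i, rfl⟩)) (zero_mem_scalings _)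
      · intro j hj
        rcases Finset.mem_insert.1 hj with rfl | hj
        · simp
        · exact Set.mem_insert_of_mem _ (h3 j hj)
  obtain ⟨H', h1, -, h3⟩ := key Finset.univ
  refine ⟨_, H', by rw [Finset.card_univ]; omega, h1, ?_⟩
  rintro _ ⟨i, rfl⟩
  exact h3 i (Finset.mem_univ i)

/-- Every computation is performed by a straight-line program, uniformly in the place where the
input is stored. -/
theorem Computes.compile [Fintype κ] {x : ι → X → ℚ} {y : κ → X → ℚ} {n : ℕ}
    (h : Computes (Set.range x) n (Set.range y)) :
    ∃ P : (ι → ℕ) → Prog (κ → ℕ), ∀ a, (P a).IsStraightLine ∧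
      ∀ m ξ, (∀ i, m[a i]? = some (x i ξ)) →
        (P a).Yields m fun out m' k =>
          (∀ j, m'[out j]? = some (y j ξ)) ∧ k ≤ 5 * (n + Fintype.card κ) := by
  obtain ⟨k, H, hk, hH, hy⟩ := h.exists_steps
  obtain ⟨P, hP⟩ := hH.compile
  refine ⟨fun a => (P a).bind fun out => .ret fun j => out (y j),
    fun a => ⟨(hP a).1.bind fun _ => trivial, fun m ξ hm => ?_⟩⟩
  refine Prog.Yields.bind (((hP a).2 m ξ hm).mono ?_)
  rintro out m1 n1 ⟨hout, hn1⟩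
  refine ⟨_, m1, 0, rfl, fun j => hout _ (hy ⟨j, rfl⟩), ?_⟩
  calc n1 + 0 ≤ 5 * k := hn1
    _ ≤ _ := Nat.mul_le_mul_left 5 hk

end Compile

/-! ## Multiplication of polynomials by the fast Fourier transform -/

section FFT

variable {R : Type} [CommRing R] [Algebra ℚ R]

open Polynomial Finset

/-- Translation of sequences. -/
def sh (k : ℤ) : (ℤ → R) →ₗ[ℚ] (ℤ → R) := LinearMap.funLeft ℚ R fun i => i - k

theorem sh_apply (k : ℤ) (a : ℤ → R) (i : ℤ) : sh k a i = a (i - k) := rfl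

theorem sh_sh (k l : ℤ) (a : ℤ → R) : sh k (sh l a) = sh (k + l) a := by
  ext i; simp [sh_apply, sub_sub]

@[simp] theorem sh_zero (a : ℤ → R) : sh 0 a = a := by
  ext i; simp [sh_apply]

theorem aeval_sh_X_pow (n : ℕ) : aeval (sh 1 : Module.End ℚ (ℤ → R)) (X ^ n : ℚ[X]) = sh n := by
  rw [aeval_X_pow]
  induction n with
  | zero => ext a : 1; simp
  | succ n ih =>
    ext a : 1
    rw [pow_succ, Module.End.mul_apply, ih, sh_sh]
    push_cast
    rfl

/-- Sequences with `a (i + m) = - a i`, the elements of `R[y] / (y ^ m + 1)`. -/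
def Anti (R : Type) [CommRing R] [Algebra ℚ R] (m : ℕ) : Submodule ℚ (ℤ → R) where
  carrier := {a | ∀ i, a (i + m) = -a i}
  add_mem' ha hb i := by simp [ha i, hb i, add_comm]
  zero_mem' i := by simp
  smul_mem' c a ha i := by simp [ha i]

variable {m : ℕ} {a b : ℤ → R}

theorem sh_mem_Anti (k : ℤ) (ha : a ∈ Anti R m) : sh k a ∈ Anti R m := fun i => by
  rw [sh_apply, sh_apply, ← ha (i - k)]
  congr 1; ring

theorem aeval_sh_mem_Anti (P : ℚ[X]) (ha : a ∈ Anti R m) :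
    aeval (sh 1 : Module.End ℚ (ℤ → R)) P a ∈ Anti R m := by
  induction P using Polynomial.induction_on' with
  | add P Q hP hQ => rw [map_add]; exact add_mem hP hQ
  | monomial n c =>
    rw [← C_mul_X_pow_eq_monomial, map_mul, aeval_C, aeval_sh_X_pow, ← Algebra.smul_def]
    exact Submodule.smul_mem _ _ (sh_mem_Anti _ ha)

theorem sh_period (ha : a ∈ Anti R m) : sh m a = -a := by
  ext i
  have := ha (i - m)
  rw [sub_add_cancel] at this
  rw [sh_apply, Pi.neg_apply, this, neg_neg]

/-- The shift is multiplication by `y`, and `y ^ m = -1` makes it a root of unity of order dividing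
`2 * m`. -/
theorem sh_two_period (ha : a ∈ Anti R m) (q : ℕ) : sh (2 * m * q) a = a := by
  induction q with
  | zero => simp
  | succ q ih =>
    have : (2 * m * (q + 1 : ℕ) : ℤ) = m + (m + 2 * m * q) := by push_cast; ring
    rw [this, ← sh_sh, ← sh_sh, ih, sh_period ha, map_neg, sh_period ha, neg_neg]

theorem anti_apply_add_mul (ha : a ∈ Anti R m) (x q : ℤ) :
    a (x + m * q) = a x ∨ a (x + m * q) = -a x := by
  induction q with
  | zero => simp
  | succ q ih =>
    have : x + m * ((q : ℤ) + 1) = (x + m * q) + m := by ring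
    rw [this, ha]
    rcases ih with h | h <;> simp [h]
  | pred q ih =>
    have h1 := ha (x + m * (-(q : ℤ) - 1))
    have : x + m * (-(q : ℤ) - 1) + m = x + m * -(q : ℤ) := by ring
    rw [this] at h1
    rw [← neg_eq_iff_eq_neg] at h1
    rw [← h1]
    rcases ih with h | h <;> rw [h] <;> simp

/-- Signs are free, so an antiperiodic sequence counts as only `m` elements. -/
theorem range_anti_subset (hm : 0 < m) (ha : a ∈ Anti R m) :
    Set.range a ⊆ scalings (⋃ i ∈ range m, {a (i : ℤ)}) := by
  rintro _ ⟨i, rfl⟩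
  have hm' : (0 : ℤ) < m := by exact_mod_cast hm
  have h1 := Int.emod_nonneg i hm'.ne'
  have h2 := Int.emod_lt_of_pos i hm'
  have h3 : a (i % m) ∈ scalings (⋃ i ∈ range m, {a (i : ℤ)}) := by
    apply subset_scalings
    simp only [Set.mem_iUnion, Set.mem_singleton_iff, Finset.mem_range]
    exact ⟨(i % m).toNat, by omega, by congr 1; omega⟩
  have h4 := anti_apply_add_mul ha (i % m) (i / m)
  rw [Int.emod_add_mul_ediv] at h4
  rcases h4 with h | h <;> rw [h]
  · exact h3
  · exact neg_mem_scalings h3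

theorem computes_anti {F : Set R} {c : ℕ} (hm : 0 < m) (ha : a ∈ Anti R m)
    (h : ∀ i < m, Computes F c {a (i : ℤ)}) : Computes F (m * c) (Set.range a) := by
  have := Computes.biUnion_const (range m) c (fun i => {a (i : ℤ)})
    fun i hi => h i (Finset.mem_range.1 hi)
  rw [card_range] at this
  exact this.mono (subset_scalings _) le_rfl (range_anti_subset hm ha)

/-- The twiddle factor `y ^ k` merely permutes entries up to sign and costs nothing; only the `m`
additions count. -/
theorem computes_butterfly (hm : 0 < m) (ha : a ∈ Anti R m) (hb : b ∈ Anti R m) (s t : ℚ) (k : ℤ) :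
    Computes (Set.range a ∪ Set.range b) m (Set.range (s • a + t • sh k b)) := by
  have hc : s • a + t • sh k b ∈ Anti R m :=
    add_mem (Submodule.smul_mem _ _ ha) (Submodule.smul_mem _ _ (sh_mem_Anti k hb))
  have := computes_anti (F := Set.range a ∪ Set.range b) (c := 1) hm hc fun i _ =>
    Computes.add (x := s • a i) (y := t • b (i - k))
      (smul_mem_scalings s (subset_scalings _ (Or.inl ⟨_, rfl⟩)))
      (smul_mem_scalings t (subset_scalings _ (Or.inr ⟨_, rfl⟩)))
  rwa [mul_one] at this

/-- All entries of the first `n` sequences of a family. -/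
def entries (n : ℕ) (a : ℕ → ℤ → R) : Set R := ⋃ i ∈ range n, Set.range (a i)

theorem range_subset_entries {n i : ℕ} (hi : i < n) (a : ℕ → ℤ → R) :
    Set.range (a i) ⊆ entries n a :=
  Set.subset_biUnion_of_mem (u := fun i => Set.range (a i)) (Finset.mem_coe.2 (mem_range.2 hi))

theorem entries_subset {n : ℕ} {a : ℕ → ℤ → R} {F : Set R} (h : ∀ i < n, Set.range (a i) ⊆ F) :
    entries n a ⊆ F := by
  simpa [entries] using h

theorem computes_entries {n c : ℕ} {a : ℕ → ℤ → R} {F : Set R}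
    (h : ∀ i < n, Computes F c (Set.range (a i))) : Computes F (n * c) (entries n a) := by
  have := Computes.biUnion_const (range n) c (fun i => Set.range (a i))
    fun i hi => h i (Finset.mem_range.1 hi)
  rwa [card_range] at this

/-- The value at `y ^ (k * e)` of the polynomial with coefficients `a 0, …, a (n - 1)`. -/
def dft (k n : ℕ) (a : ℕ → ℤ → R) (e : ℕ) : ℤ → R := ∑ i ∈ range n, sh (k * e * i) (a i)

theorem dft_mem_Anti {k n e : ℕ} {a : ℕ → ℤ → R} (ha : ∀ i, a i ∈ Anti R m) :
    dft k n a e ∈ Anti R m :=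
  sum_mem fun i _ => sh_mem_Anti _ (ha i)

/-- Cooley–Tukey splitting into even and odd coefficients; the root `y ^ k` is replaced by its
square. -/
theorem dft_two_mul (k n : ℕ) (a : ℕ → ℤ → R) (e : ℕ) :
    dft k (2 * n) a e = dft (2 * k) n (fun i => a (2 * i)) e
      + sh (k * e) (dft (2 * k) n (fun i => a (2 * i + 1)) e) := by
  induction n with
  | zero => simp [dft]
  | succ n ih =>
    unfold dft at ih ⊢
    rw [Nat.mul_succ, sum_range_succ, sum_range_succ, ih, sum_range_succ, sum_range_succ, map_add,
      sh_sh]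
    have h1 : (k * e * (2 * n : ℕ) : ℤ) = (2 * k : ℕ) * e * n := by push_cast; ring
    have h2 : (k * e * (2 * n + 1 : ℕ) : ℤ) = k * e + (2 * k : ℕ) * e * n := by push_cast; ring
    rw [h1, h2]
    abel

theorem dft_add_period {k n : ℕ} (hk : 2 * m = k * n) {a : ℕ → ℤ → R} (ha : ∀ i, a i ∈ Anti R m)
    (e : ℕ) : dft k n a (e + n) = dft k n a e := by
  refine sum_congr rfl fun i _ => ?_
  have hk' : (2 * m : ℤ) = k * n := by exact_mod_cast hk
  have h : (k * (e + n : ℕ) * i : ℤ) = k * e * i + 2 * m * i := by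
    rw [hk']; push_cast; ring
  rw [h, ← sh_sh, sh_two_period (ha i)]

theorem range_dft_subset {k n : ℕ} (hn : 0 < n) (hk : 2 * m = k * n) {a : ℕ → ℤ → R}
    (ha : ∀ i, a i ∈ Anti R m) (e : ℕ) : Set.range (dft k n a e) ⊆ entries n (dft k n a) := by
  have h : ∀ q, dft k n a (e % n + n * q) = dft k n a (e % n) := by
    intro q
    induction q with
    | zero => simp
    | succ q ih => rw [Nat.mul_succ, ← add_assoc, dft_add_period hk ha, ih]
  have h2 := h (e / n)
  rw [Nat.mod_add_div] at h2
  rw [h2]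
  exact range_subset_entries (Nat.mod_lt _ hn) _

theorem entries_even_subset (n : ℕ) (a : ℕ → ℤ → R) :
    entries n (fun i => a (2 * i)) ⊆ entries (2 * n) a :=
  entries_subset fun i hi => range_subset_entries (i := 2 * i) (by omega) a

theorem entries_odd_subset (n : ℕ) (a : ℕ → ℤ → R) :
    entries n (fun i => a (2 * i + 1)) ⊆ entries (2 * n) a :=
  entries_subset fun i hi => range_subset_entries (i := 2 * i + 1) (by omega) a

theorem computes_dft (hm : 0 < m) : ∀ (j k : ℕ) (_ : 2 * m = k * 2 ^ j) (a : ℕ → ℤ → R)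
    (_ : ∀ i, a i ∈ Anti R m),
    Computes (entries (2 ^ j) a) (j * 2 ^ j * m) (entries (2 ^ j) (dft k (2 ^ j) a)) := by
  intro j
  induction j with
  | zero =>
    intro k hk a ha
    simpa [entries, dft] using Computes.of_subset (subset_scalings _)
  | succ j ih =>
    intro k hk a ha
    have hk' : 2 * m = 2 * k * 2 ^ j := by rw [hk]; ring
    have he := (ih (2 * k) hk' (fun i => a (2 * i)) fun i => ha _).mono_left
      (entries_even_subset _ a)
    have ho := (ih (2 * k) hk' (fun i => a (2 * i + 1)) fun i => ha _).mono_left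
      (entries_odd_subset _ a)
    have h2 : 2 ^ (j + 1) = 2 * 2 ^ j := pow_succ' _ _
    rw [h2]
    refine ((he.union ho).trans (k := 2 * 2 ^ j * m) (computes_entries fun e _ => ?_)).mono_cost
      (le_of_eq (by ring))
    rw [dft_two_mul]
    have := computes_butterfly hm (dft_mem_Anti (k := 2 * k) (n := 2 ^ j) (e := e)
      (a := fun i => a (2 * i)) fun i => ha _) (dft_mem_Anti (k := 2 * k) (n := 2 ^ j) (e := e)
      (a := fun i => a (2 * i + 1)) fun i => ha _) 1 1 (k * e)
    rw [one_smul, one_smul] at this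
    exact this.mono_left (Set.union_subset_union
      (range_dft_subset (by positivity) hk' (fun i => ha _) e)
      (range_dft_subset (by positivity) hk' (fun i => ha _) e))

/-- Each butterfly is undone separately: since `y ^ (k * n) = -1` for the half length `n`, the
values at `e` and `e + n` are `E ± y ^ (k * e) O`. Half their sum and half their difference recover
the two smaller transforms. -/
theorem computes_inverse_dft (hm : 0 < m) : ∀ (j k : ℕ) (_ : 2 * m = k * 2 ^ j) (a : ℕ → ℤ → R)
    (_ : ∀ i, a i ∈ Anti R m),
    Computes (entries (2 ^ j) (dft k (2 ^ j) a)) (j * 2 ^ j * m) (entries (2 ^ j) a) := by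
  intro j
  induction j with
  | zero =>
    intro k hk a ha
    simpa [entries, dft] using Computes.of_subset (subset_scalings _)
  | succ j ih =>
    intro k hk a ha
    have hk' : 2 * m = 2 * k * 2 ^ j := by rw [hk]; ring
    have hkm : (k * 2 ^ j : ℤ) = m := by
      have : m = k * 2 ^ j := by rw [pow_succ'] at hk; linarith
      exact_mod_cast this.symm
    have he := ih (2 * k) hk' (fun i => a (2 * i)) fun i => ha _
    have ho := ih (2 * k) hk' (fun i => a (2 * i + 1)) fun i => ha _
    have h2 : 2 ^ (j + 1) = 2 * 2 ^ j := pow_succ' _ _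
    rw [h2]
    set n := 2 ^ j with hn
    set E := dft (2 * k) n fun i => a (2 * i) with hE
    set O := dft (2 * k) n fun i => a (2 * i + 1) with hO
    have hEm : ∀ e, E e ∈ Anti R m := fun e => dft_mem_Anti fun i => ha _
    have hOm : ∀ e, O e ∈ Anti R m := fun e => dft_mem_Anti fun i => ha _
    have hv : ∀ e, dft k (2 * n) a e ∈ Anti R m := fun e => dft_mem_Anti ha
    have h3 : ∀ e, dft k (2 * n) a e = E e + sh (k * e) (O e) := fun e => dft_two_mul k n a e
    have h4 : ∀ e, dft k (2 * n) a (e + n) = E e - sh (k * e) (O e) := by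
      intro e
      rw [h3, hE, hO, dft_add_period hk' (fun i => ha _), dft_add_period hk' (fun i => ha _)]
      have : (k * (e + n : ℕ) : ℤ) = k * e + m := by
        rw [← hkm, hn]; push_cast; ring
      rw [this, ← sh_sh, ← hE, ← hO, sh_period (hOm e), map_neg, sub_eq_add_neg]
    have hsub : ∀ e < n, Set.range (dft k (2 * n) a e) ∪ Set.range (dft k (2 * n) a (e + n))
        ⊆ entries (2 * n) (dft k (2 * n) a) := fun e he =>
      Set.union_subset (range_subset_entries (by omega) _) (range_subset_entries (by omega) _)
    have hEc : Computes (entries (2 * n) (dft k (2 * n) a)) (n * m) (entries n E) := by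
      refine computes_entries fun e he => ?_
      have := (computes_butterfly hm (hv e) (hv (e + n)) 2⁻¹ 2⁻¹ 0).mono_left (hsub e he)
      rw [sh_zero, h3, h4, ← smul_add, add_add_sub_cancel, ← two_smul ℚ, smul_smul] at this
      simpa using this
    have hOc : Computes (entries (2 * n) (dft k (2 * n) a)) (n * m) (entries n O) := by
      refine computes_entries fun e he => ?_
      have := (computes_butterfly hm (sh_mem_Anti (-(k * e)) (hv e)) (hv (e + n)) 2⁻¹ (-2⁻¹)
        (-(k * e))).mono_left (F' := entries (2 * n) (dft k (2 * n) a)) ?_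
      · rw [h3, h4, neg_smul, ← sub_eq_add_neg, ← smul_sub, ← map_sub, add_sub_sub_cancel,
          ← two_smul ℚ, map_smul, sh_sh, smul_smul] at this
        simpa using this
      · refine subset_trans (Set.union_subset_union_left _ ?_) (hsub e he)
        rintro _ ⟨i, rfl⟩
        exact ⟨i - -(k * e), rfl⟩
    refine ((hEc.trans he).union (hOc.trans ho)).mono (subset_scalings _) (le_of_eq (by ring))
      (subset_trans (entries_subset fun i hi => ?_) (subset_scalings _))
    rcases Nat.even_or_odd' i with ⟨c, rfl | rfl⟩
    · exact subset_trans (range_subset_entries (i := c) (by omega) fun i => a (2 * i))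
        Set.subset_union_left
    · exact subset_trans (range_subset_entries (i := c) (by omega) fun i => a (2 * i + 1))
        Set.subset_union_right

/-- The coefficients of the product of a polynomial with coefficients `P 0, …, P (n' - 1)` and
one with coefficients `a 0, …, a (n - 1)`. -/
noncomputable def polyMul (n' : ℕ) (P : ℕ → ℚ[X]) (n : ℕ) (a : ℕ → ℤ → R) (l : ℕ) : ℤ → R :=
  ∑ k ∈ range n', ∑ i ∈ range n,
    if k + i = l then aeval (sh 1 : Module.End ℚ (ℤ → R)) (P k) (a i) else 0

theorem polyMul_mem_Anti {n' n l : ℕ} {P : ℕ → ℚ[X]} {a : ℕ → ℤ → R} (ha : ∀ i, a i ∈ Anti R m) :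
    polyMul n' P n a l ∈ Anti R m := by
  refine sum_mem fun k _ => sum_mem fun i _ => ?_
  split_ifs
  · exact aeval_sh_mem_Anti _ (ha i)
  · exact zero_mem _

/-- The transform is evaluation at `y ^ (k * e)`, hence multiplicative; the length `N` is large
enough to hold every coefficient of the product. -/
theorem dft_polyMul {n' n N : ℕ} (hN : n' + n ≤ N) (P : ℕ → ℚ[X]) (a : ℕ → ℤ → R) (k e : ℕ) :
    dft k N (polyMul n' P n a) e = aeval (sh 1 : Module.End ℚ (ℤ → R))
      (∑ i ∈ range n', X ^ (k * e * i) * P i) (dft k n a e) := by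
  simp only [dft, polyMul, map_sum, LinearMap.sum_apply]
  rw [sum_comm]
  refine (sum_congr rfl fun k' hk' => ?_).trans sum_comm
  rw [sum_comm]
  refine sum_congr rfl fun i hi => ?_
  rw [mem_range] at hi hk'
  rw [sum_eq_single_of_mem (k' + i) (mem_range.2 (by omega))]
  · have h1 : sh (k * e * i : ℤ) (a i)
        = aeval (sh 1 : Module.End ℚ (ℤ → R)) (X ^ (k * e * i) : ℚ[X]) (a i) := by
      rw [aeval_sh_X_pow]; push_cast; rfl
    have h2 : ∀ x : ℤ → R, sh (k * e * (k' + i : ℕ) : ℤ) x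
        = aeval (sh 1 : Module.End ℚ (ℤ → R)) (X ^ (k * e * (k' + i)) : ℚ[X]) x := by
      intro x; rw [aeval_sh_X_pow]; push_cast; rfl
    rw [if_pos rfl, h1, h2, ← Module.End.mul_apply, ← Module.End.mul_apply, ← map_mul, ← map_mul]
    congr 2
    ring
  · intro l _ hl
    rw [if_neg (Ne.symm hl), map_zero]

/-- Transform, multiply each of the `2 ^ j` values by a constant of `ℚ[y]` at cost `T`, and
transform back. Transforming the constants is free, as they do not depend on the input. -/
theorem computes_polyMul (hm : 0 < m) {T : ℕ}
    (hT : ∀ (P : ℚ[X]) (a : ℤ → R), a ∈ Anti R m →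
      Computes (Set.range a) T (Set.range (aeval (sh 1 : Module.End ℚ (ℤ → R)) P a)))
    {j k : ℕ} (hk : 2 * m = k * 2 ^ j) {n' n : ℕ} (hn : n' + n ≤ 2 ^ j) (P : ℕ → ℚ[X])
    {a : ℕ → ℤ → R} (ha : ∀ i, a i ∈ Anti R m) :
    Computes (entries n a) (2 * (j * 2 ^ j * m) + 2 ^ j * T)
      (entries (2 ^ j) (polyMul n' P n a)) := by
  let a' : ℕ → ℤ → R := fun i => if i < n then a i else 0
  have ha' : ∀ i, a' i ∈ Anti R m := by
    intro i
    by_cases h : i < n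
    · simpa [a', h] using ha i
    · simp [a', h]
  have hd : ∀ e, dft k (2 ^ j) a' e = dft k n a e := by
    intro e
    unfold dft
    rw [← sum_subset (range_mono (show n ≤ 2 ^ j by omega))]
    · exact sum_congr rfl fun i hi => by simp [a', mem_range.1 hi]
    · intro i _ hi
      simp [a', mt mem_range.2 hi]
  have h0 : entries (2 ^ j) a' ⊆ scalings (entries n a) := by
    refine entries_subset fun i _ => ?_
    by_cases h : i < n
    · simpa [a', h] using (range_subset_entries h a).trans (subset_scalings _)
    · rintro _ ⟨x, rfl⟩
      simpa [a', h] using zero_mem_scalings _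
  have h1 := (computes_dft hm j k hk a' ha').mono h0 le_rfl (subset_scalings _)
  have h2 : Computes (entries (2 ^ j) (dft k (2 ^ j) a')) (2 ^ j * T)
      (entries (2 ^ j) (dft k (2 ^ j) (polyMul n' P n a))) := by
    refine computes_entries fun e he => ?_
    rw [dft_polyMul hn, ← hd]
    exact (hT _ _ (dft_mem_Anti ha')).mono_left (range_subset_entries he _)
  have h3 := computes_inverse_dft hm j k hk (polyMul n' P n a) fun i => polyMul_mem_Anti ha
  exact ((h1.trans h2).trans h3).mono_cost (le_of_eq (by ring))

end FFT

/-! ### Recursive multiplication by constants modulo `y ^ m + 1` -/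

section NegacyclicConvolution

variable {R : Type} [CommRing R] [Algebra ℚ R]

open Polynomial Finset

/-- The entries of a sequence at the places congruent to `j` modulo `d`. -/
def slice (d : ℕ) (j : ℤ) : (ℤ → R) →ₗ[ℚ] (ℤ → R) := LinearMap.funLeft ℚ R fun q => j + d * q

theorem slice_apply (d : ℕ) (j : ℤ) (a : ℤ → R) (q : ℤ) : slice d j a q = a (j + d * q) := rfl

theorem slice_sh (d : ℕ) (j k : ℤ) (a : ℤ → R) : slice d j (sh k a) = slice d (j - k) a := by
  ext q
  simp only [slice_apply, sh_apply]
  congr 1; ring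

theorem sh_slice (d : ℕ) (j k : ℤ) (a : ℤ → R) : sh k (slice d j a) = slice d (j - d * k) a := by
  ext q
  simp only [slice_apply, sh_apply]
  congr 1; ring

theorem slice_aeval_expand (d : ℕ) (j : ℤ) (Q : ℚ[X]) (a : ℤ → R) :
    slice d j (aeval (sh 1 : Module.End ℚ (ℤ → R)) (expand ℚ d Q) a)
      = aeval (sh 1 : Module.End ℚ (ℤ → R)) Q (slice d j a) := by
  induction Q using Polynomial.induction_on' with
  | add P Q hP hQ => simp only [map_add, LinearMap.add_apply, hP, hQ]
  | monomial n c =>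
    rw [expand_monomial, ← C_mul_X_pow_eq_monomial, ← C_mul_X_pow_eq_monomial, map_mul, map_mul,
      aeval_C, aeval_sh_X_pow, aeval_sh_X_pow, ← Algebra.smul_def, ← Algebra.smul_def,
      LinearMap.smul_apply, LinearMap.smul_apply, map_smul, slice_sh, sh_slice]
    congr 3
    push_cast
    ring

theorem exists_eq_sum_expand {d : ℕ} (hd : 0 < d) (P : ℚ[X]) :
    ∃ Q : ℕ → ℚ[X], P = ∑ k ∈ range d, X ^ k * expand ℚ d (Q k) := by
  induction P using Polynomial.induction_on' with
  | add P P' hP hP' =>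
    obtain ⟨Q, hQ⟩ := hP
    obtain ⟨Q', hQ'⟩ := hP'
    refine ⟨fun k => Q k + Q' k, ?_⟩
    simp only [map_add, mul_add, sum_add_distrib]
    rw [← hQ, ← hQ']
  | monomial n c =>
    refine ⟨fun k => if k = n % d then monomial (n / d) c else 0, ?_⟩
    rw [sum_eq_single_of_mem (n % d) (mem_range.2 (Nat.mod_lt _ hd))]
    · beta_reduce
      rw [if_pos rfl, expand_monomial, X_pow_mul_monomial, mul_comm (n / d), Nat.div_add_mod]
    · intro k _ hk
      simp [hk]

/-- With `z = y ^ d`, the slices are the coefficients of `1, y, …, y ^ (d - 1)` over polynomials in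
`z`. A product of two such expressions has degree below `2 * d` in `y`, and its coefficient of `y ^
(j + d)` folds onto `y ^ j` with a factor `z`, a shift by one. -/
theorem slice_aeval {d : ℕ} {P : ℚ[X]} {Q : ℕ → ℚ[X]}
    (hQ : P = ∑ k ∈ range d, X ^ k * expand ℚ d (Q k)) (a : ℤ → R) {j : ℕ} (hj : j < d) :
    slice d j (aeval (sh 1 : Module.End ℚ (ℤ → R)) P a)
      = polyMul d Q d (fun i => slice d i a) j
        + sh 1 (polyMul d Q d (fun i => slice d i a) (j + d)) := by
  rw [hQ]
  simp only [map_sum, LinearMap.sum_apply, polyMul]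
  rw [← sum_add_distrib]
  refine sum_congr rfl fun k hk => ?_
  rw [mem_range] at hk
  rw [map_mul, Module.End.mul_apply, aeval_sh_X_pow, slice_sh, slice_aeval_expand]
  by_cases hkj : k ≤ j
  · rw [sum_eq_single_of_mem (j - k) (mem_range.2 (by omega)), if_pos (by omega),
      sum_eq_zero, add_zero]
    · push_cast [hkj]; rfl
    · intro i hi
      rw [mem_range] at hi
      rw [if_neg (by omega), map_zero]
    · intro i _ hi
      rw [if_neg (by omega)]
  · rw [sum_eq_zero, zero_add, sum_eq_single_of_mem (j + d - k) (mem_range.2 (by omega)),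
      if_pos (by omega)]
    · have h1 : ∀ x : ℤ → R, sh 1 x = aeval (sh 1 : Module.End ℚ (ℤ → R)) (X : ℚ[X]) x := by
        intro x; rw [aeval_X]
      rw [h1, ← Module.End.mul_apply (aeval (sh 1) X), ← map_mul, mul_comm, map_mul,
        Module.End.mul_apply, ← h1, sh_slice,
        show ((j + d - k : ℕ) : ℤ) - d * 1 = j - k by omega]
    · intro i _ hi
      rw [if_neg (by omega), map_zero]
    · intro i hi
      rw [if_neg (by omega)]

theorem slice_mem_Anti {d n : ℕ} {a : ℤ → R} (ha : a ∈ Anti R (d * n)) (j : ℤ) :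
    slice d j a ∈ Anti R n := fun q => by
  have := ha (j + d * q)
  rw [slice_apply, slice_apply, ← this]
  congr 1
  push_cast
  ring

theorem aeval_sh_apply_mem_span (P : ℚ[X]) (a : ℤ → R) (i : ℤ) :
    aeval (sh 1 : Module.End ℚ (ℤ → R)) P a i ∈ Submodule.span ℚ (Set.range a) := by
  induction P using Polynomial.induction_on' with
  | add P Q hP hQ => rw [map_add]; exact add_mem hP hQ
  | monomial n c =>
    rw [← C_mul_X_pow_eq_monomial, map_mul, aeval_C, aeval_sh_X_pow, ← Algebra.smul_def]
    exact Submodule.smul_mem _ _ (Submodule.subset_span ⟨_, rfl⟩)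

theorem computes_aeval_naive {m : ℕ} (hm : 0 < m) (P : ℚ[X]) {a : ℤ → R} (ha : a ∈ Anti R m) :
    Computes (Set.range a) (m * m)
      (Set.range (aeval (sh 1 : Module.End ℚ (ℤ → R)) P a)) := by
  refine computes_anti hm (aeval_sh_mem_Anti P ha) fun i _ => ?_
  have h1 := aeval_sh_apply_mem_span P a i
  have h2 : Submodule.span ℚ (Set.range a)
      ≤ Submodule.span ℚ (Set.range fun i : Fin m => a (i : ℕ)) := by
    refine Submodule.span_le.2 fun x hx => ?_
    obtain ⟨i, rfl⟩ := hx
    have hm' : (0 : ℤ) < m := by exact_mod_cast hm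
    have h3 := Int.emod_nonneg i hm'.ne'
    have h4 := Int.emod_lt_of_pos i hm'
    have h5 : a (i % m) ∈ Submodule.span ℚ (Set.range fun i : Fin m => a (i : ℕ)) :=
      Submodule.subset_span ⟨⟨(i % m).toNat, by omega⟩, congrArg a (Int.toNat_of_nonneg h3)⟩
    have h6 := anti_apply_add_mul ha (i % m) (i / m)
    rw [Int.emod_add_mul_ediv] at h6
    rcases h6 with h | h <;> rw [h]
    · exact h5
    · exact neg_mem h5
  obtain ⟨c, hc⟩ := (Submodule.mem_span_range_iff_exists_fun ℚ).1 (h2 h1)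
  rw [← hc]
  have := Computes.sum (F := Set.range a) univ (fun j : Fin m => c j • a (j : ℕ)) fun j _ =>
    smul_mem_scalings _ (subset_scalings _ ⟨_, rfl⟩)
  rwa [card_univ, Fintype.card_fin] at this

/-- Multiplication by a fixed polynomial in `R[y] / (y ^ m + 1)`, where `m = 2 ^ s`. -/
theorem computes_aeval (s : ℕ) : ∀ (P : ℚ[X]) (a : ℤ → R), a ∈ Anti R (2 ^ s) →
    Computes (Set.range a) (26 * 2 ^ s * (s + 1) ^ 2)
      (Set.range (aeval (sh 1 : Module.End ℚ (ℤ → R)) P a)) := by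
  induction s using Nat.strong_induction_on with
  | _ s ih =>
  intro P a ha
  -- Below 4 the schoolbook bound `4 ^ s` is good enough; from 4 on both parts of `s` are at least
  -- 2, which the final estimates use.
  by_cases hs : s < 4
  · refine (computes_aeval_naive (by positivity) P ha).mono_cost ?_
    interval_cases s <;> norm_num
  obtain ⟨s1, s2, rfl, h12, h21⟩ : ∃ s1 s2, s = s1 + s2 ∧ s1 ≤ s2 ∧ s2 ≤ s1 + 1 :=
    ⟨s / 2, s - s / 2, by omega, by omega, by omega⟩
  have ih2 := ih s2 (by omega)
  obtain ⟨Q, hQ⟩ := exists_eq_sum_expand (show 0 < 2 ^ s1 by positivity) P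
  have hd : ∀ i : ℤ, slice (2 ^ s1) i a ∈ Anti R (2 ^ s2) := fun i =>
    slice_mem_Anti (by rwa [← pow_add]) i
  -- The transform has length `2 ^ (s1 + 1)`, twice the number of slices. The ring of the slices has
  -- a root of unity of that order because `s1 ≤ s2`.
  have hk : 2 * 2 ^ s2 = 2 ^ (s2 - s1) * 2 ^ (s1 + 1) := by
    rw [← pow_succ', ← pow_add]; congr 1; omega
  have h1 := computes_polyMul (m := 2 ^ s2) (by positivity) ih2 hk (n' := 2 ^ s1) (n := 2 ^ s1)
    (le_of_eq (by ring)) Q (a := fun i => slice (2 ^ s1) i a) fun i => hd i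
  set q := polyMul (2 ^ s1) Q (2 ^ s1) (fun i => slice (2 ^ s1) i a) with hq
  have hqm : ∀ l, q l ∈ Anti R (2 ^ s2) := fun l => polyMul_mem_Anti fun i => hd i
  have h2 : Computes (entries (2 ^ (s1 + 1)) q) (2 ^ s1 * 2 ^ s2)
      (entries (2 ^ s1) fun j => slice (2 ^ s1) j
        (aeval (sh 1 : Module.End ℚ (ℤ → R)) P a)) := by
    refine computes_entries fun j hj => ?_
    rw [slice_aeval hQ a hj, ← hq]
    have := computes_butterfly (by positivity) (hqm j) (hqm (j + 2 ^ s1)) 1 1 1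
    rw [one_smul, one_smul] at this
    exact this.mono_left (Set.union_subset (range_subset_entries (by rw [pow_succ]; omega) _)
      (range_subset_entries (by rw [pow_succ]; omega) _))
  refine (h1.trans h2).mono ?_ ?_ ?_
  · refine subset_trans (entries_subset fun i _ => ?_) (subset_scalings _)
    rintro _ ⟨x, rfl⟩
    exact ⟨_, rfl⟩
  · have e1 : (2 * ((s1 + 1) * 2 ^ (s1 + 1) * 2 ^ s2)
        + 2 ^ (s1 + 1) * (26 * 2 ^ s2 * (s2 + 1) ^ 2) + 2 ^ s1 * 2 ^ s2)
        = 2 ^ (s1 + s2) * (4 * (s1 + 1) + 52 * (s2 + 1) ^ 2 + 1) := by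
      rw [pow_add, pow_succ]; ring
    rw [e1, mul_comm 26, mul_assoc]
    refine Nat.mul_le_mul_left _ ?_
    obtain rfl | rfl : s2 = s1 ∨ s2 = s1 + 1 := by omega
    · nlinarith [show 2 ≤ s2 by omega]
    · nlinarith [show 2 ≤ s1 by omega]
  · refine subset_trans ?_ (subset_scalings _)
    rintro _ ⟨x, rfl⟩
    have h3 : (0 : ℤ) < (2 ^ s1 : ℕ) := by positivity
    have h4 := Int.emod_nonneg x h3.ne'
    have h5 := Int.emod_lt_of_pos x h3
    refine range_subset_entries (i := (x % (2 ^ s1 : ℕ)).toNat) (by omega) _ ⟨x / (2 ^ s1 : ℕ), ?_⟩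
    rw [slice_apply, Int.toNat_of_nonneg h4, Int.emod_add_mul_ediv]

end NegacyclicConvolution

/-! ## The normal basis and skew polynomials -/

namespace Choice

variable {p : ℕ} [Fact p.Prime] {K : Type*} [Field K] [Algebra ℚ K]
  [IsCyclotomicExtension {p} ℚ K] (c : Choice p K)

open Finset

/-- The additive character `x ↦ β ^ x` of `ℤ/p`. -/
noncomputable def χ {p : ℕ} [Fact p.Prime] {K : Type*} [Field K] (c : Choice p K) :
    AddChar (ZMod p) K :=
  AddChar.zmodChar p c.isPrimitiveRoot.pow_eq_one

theorem χ_natCast (n : ℕ) : c.χ n = c.β ^ n := AddChar.zmodChar_apply' _ n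

theorem v_eq (i : ℕ) : c.v i = c.χ ((c.u ^ i : (ZMod p)ˣ) : ZMod p) := by
  have : ((c.u ^ i : (ZMod p)ˣ) : ZMod p) = ((c.r ^ i : ℕ) : ZMod p) := by simp [r]
  rw [this, χ_natCast, v]

theorem v_zero : c.v 0 = c.β := by simp [v]

theorem orderOf_u : orderOf c.u = p - 1 := by
  rw [orderOf_eq_card_of_forall_mem_zpowers c.generates, Nat.card_eq_fintype_card,
    ZMod.card_units_eq_totient, Nat.totient_prime Fact.out]

theorem u_pow_injective : Function.Injective fun i : Fin (p - 1) => c.u ^ (i : ℕ) :=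
  fun i j h => Fin.ext (pow_injOn_Iio_orderOf (by simp [c.orderOf_u]) (by simp [c.orderOf_u]) h)

theorem u_pow_bijective : Function.Bijective fun i : Fin (p - 1) => c.u ^ (i : ℕ) := by
  rw [Fintype.bijective_iff_injective_and_card]
  refine ⟨c.u_pow_injective, ?_⟩
  rw [ZMod.card_units_eq_totient, Nat.totient_prime Fact.out, Fintype.card_fin]

/-- The powers of `u` list the nonzero residues, so sums over the normal basis are character sums
without the term at 0. -/
theorem sum_zmod {M : Type*} [AddCommMonoid M] (F : ZMod p → M) :
    ∑ x, F x = F 0 + ∑ i : Fin (p - 1), F ((c.u ^ (i : ℕ) : (ZMod p)ˣ) : ZMod p) := by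
  rw [c.u_pow_bijective.sum_comp fun x : (ZMod p)ˣ => F x, ← Fintype.sum_equiv
    unitsEquivNeZero.symm (fun x : {a : ZMod p // a ≠ 0} => F x) (fun x : (ZMod p)ˣ => F x)
    fun x => rfl, ← Finset.sum_subtype (univ.erase (0 : ZMod p)) (by simp) F,
    Finset.add_sum_erase _ _ (mem_univ _)]

theorem v_injective : Function.Injective fun i : Fin (p - 1) => c.v i := by
  intro i j h
  refine c.normalBasis.injective ?_
  simpa [normalBasis_apply] using h

theorem sum_χ_mul (y : ZMod p) : ∑ x, c.χ (x * y) = if y = 0 then (p : K) else 0 := by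
  have := AddChar.sum_mulShift (R := ZMod p) (R' := K) y
    (AddChar.zmodChar_primitive_of_primitive_root p c.isPrimitiveRoot)
  simpa [χ] using this

theorem sum_v : ∑ i : Fin (p - 1), c.v i = -1 := by
  have h := c.sum_χ_mul 1
  rw [c.sum_zmod, if_neg one_ne_zero] at h
  simp only [mul_one, AddChar.map_zero_eq_one] at h
  simp only [v_eq]
  exact eq_neg_of_add_eq_zero_right h

theorem natCast_p_ne_zero : (p : K) ≠ 0 := by
  have : CharZero K := algebraRat.charZero K
  exact Nat.cast_ne_zero.2 (Fact.out : p.Prime).ne_zero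

theorem inv_v (i : ℕ) : (c.v i)⁻¹ = c.χ (-((c.u ^ i : (ZMod p)ˣ) : ZMod p)) := by
  rw [v_eq, AddChar.map_neg_eq_inv]

/-- Orthogonality of the normal basis and the vectors `(1 / v - 1) / p`. -/
theorem sum_dual (j l : Fin (p - 1)) :
    ∑ i : Fin (p - 1), (p : K)⁻¹ * ((c.v (i + j))⁻¹ - 1) * c.v (i + l)
      = if j = l then 1 else 0 := by
  have h1 : ∀ i : Fin (p - 1), (p : K)⁻¹ * ((c.v (i + j))⁻¹ - 1) * c.v (i + l)
      = (p : K)⁻¹ * (c.χ (((c.u ^ (i : ℕ) : (ZMod p)ˣ) : ZMod p) *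
          (((c.u ^ (l : ℕ) : (ZMod p)ˣ) : ZMod p) - ((c.u ^ (j : ℕ) : (ZMod p)ˣ) : ZMod p)))
        - c.χ (((c.u ^ (i : ℕ) : (ZMod p)ˣ) : ZMod p) *
          ((c.u ^ (l : ℕ) : (ZMod p)ˣ) : ZMod p))) := by
    intro i
    rw [mul_assoc, sub_mul, one_mul, inv_v, v_eq, ← AddChar.map_add_eq_mul, pow_add, pow_add,
      Units.val_mul, Units.val_mul]
    congr 3
    ring_nf
  have h2 := c.sum_χ_mul (((c.u ^ (l : ℕ) : (ZMod p)ˣ) : ZMod p)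
    - ((c.u ^ (j : ℕ) : (ZMod p)ˣ) : ZMod p))
  have h3 := c.sum_χ_mul ((c.u ^ (l : ℕ) : (ZMod p)ˣ) : ZMod p)
  rw [c.sum_zmod, zero_mul] at h2 h3
  rw [if_neg (Units.ne_zero _)] at h3
  simp only [h1]
  -- Adding the missing term `χ 0` to both sums completes them to sums over `ℤ/p`: the first is `p`
  -- or `0`, the second vanishes because `u ^ l ≠ 0`.
  rw [← mul_sum, sum_sub_distrib, ← add_sub_add_left_eq_sub _ _ (c.χ 0), h2, h3, sub_zero]
  by_cases hjl : j = l
  · subst hjl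
    simp [natCast_p_ne_zero]
  · rw [if_neg hjl, if_neg, mul_zero]
    rw [sub_eq_zero]
    intro h
    exact hjl (c.u_pow_injective (Units.ext h)).symm

theorem sum_repr (z : K) : ∑ k, algebraMap ℚ K (c.normalBasis.repr z k) * c.v k = z := by
  conv_rhs => rw [← c.normalBasis.sum_repr z]
  simp only [normalBasis_apply, Algebra.smul_def]

theorem repr_sum (x : Fin (p - 1) → ℚ) (k : Fin (p - 1)) :
    c.normalBasis.repr (∑ k, algebraMap ℚ K (x k) * c.v k) k = x k := by
  have := c.normalBasis.repr_sum_self x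
  simp only [normalBasis_apply, Algebra.smul_def] at this
  rw [this]

theorem σ_pow_v (i l : ℕ) : (c.σ ^ i) (c.v l) = c.v (i + l) := by
  induction i with
  | zero => simp
  | succ i ih =>
    rw [pow_succ', AlgEquiv.mul_apply, ih, v, map_pow, sigma_beta, ← pow_mul, v, ← pow_succ',
      add_right_comm]

theorem σ_pow_card : c.σ ^ (p - 1) = 1 := by
  rw [σ, ← map_pow, ← c.orderOf_u, pow_orderOf_eq_one, map_one]

theorem eval_v (f : Skew p K) (l : ℕ) : c.eval f (c.v l) = ∑ i, f i * c.v (i + l) := by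
  simp only [eval, σ_pow_v]

theorem eval_v_zero_pow (f : Skew p K) (i : ℕ) :
    c.eval f (c.v 0 ^ i) = ∑ e : Fin (p - 1), c.v e ^ i * f e := by
  simp only [eval, map_pow, σ_pow_v, add_zero, mul_comm]

theorem eval_sum {ι : Type*} (f : Skew p K) (s : Finset ι) (x : ι → ℚ) (b : ι → K) :
    c.eval f (∑ i ∈ s, algebraMap ℚ K (x i) * b i)
      = ∑ i ∈ s, algebraMap ℚ K (x i) * c.eval f (b i) := by
  simp only [eval, map_sum, map_mul, AlgEquiv.commutes, mul_sum]
  rw [sum_comm]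
  exact sum_congr rfl fun _ _ => sum_congr rfl fun _ _ => by ring

/-- Reducing exponents modulo `p - 1` is harmless since `σ ^ (p - 1) = 1`. -/
theorem eval_mul (f g : Skew p K) (b : K) : c.eval (c.mul g f) b = c.eval g (c.eval f b) := by
  simp only [eval, mul, sum_mul, map_sum, mul_sum, map_mul]
  rw [sum_comm]
  refine sum_congr rfl fun i _ => ?_
  rw [sum_comm]
  refine sum_congr rfl fun j _ => ?_
  have hpos : 0 < p - 1 := i.pos
  rw [sum_eq_single_of_mem (⟨(i + j) % (p - 1), Nat.mod_lt _ hpos⟩ : Fin (p - 1)) (mem_univ _)]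
  · rw [if_pos rfl]
    dsimp only
    rw [← pow_eq_pow_mod _ c.σ_pow_card, pow_add, AlgEquiv.mul_apply, mul_assoc]
  · intro l _ hl
    rw [if_neg fun h => hl (Fin.ext h.symm), zero_mul]

theorem sum_phi (f : Skew p K) (i : Fin (p - 1)) :
    ∑ k, algebraMap ℚ K (c.phi f i k) * c.v k = c.eval f (c.v i) :=
  c.sum_repr _

theorem phi_phiInv (A : Matrix (Fin (p - 1)) (Fin (p - 1)) ℚ) : c.phi (c.phiInv A) = A := by
  ext l k
  have h : c.eval (c.phiInv A) (c.v l) = ∑ k, algebraMap ℚ K (A l k) * c.v k := by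
    rw [eval_v]
    simp only [phiInv, mul_sum, sum_mul]
    rw [sum_comm]
    calc _ = ∑ j : Fin (p - 1),
          (∑ i : Fin (p - 1), (p : K)⁻¹ * ((c.v (i + j))⁻¹ - 1) * c.v (i + l)) *
          ∑ k, algebraMap ℚ K (A j k) * c.v k := by
            refine sum_congr rfl fun j _ => ?_
            rw [sum_mul]
            refine sum_congr rfl fun i _ => ?_
            simp only [mul_sum]
            exact sum_congr rfl fun k _ => by ring
      _ = _ := by simp only [sum_dual]; simp
  simp only [phi, Matrix.of_apply]
  rw [h, repr_sum]

/-- The kernels depend only on the sum of the indices and are thus symmetric, so `sum_dual` inverts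
on this side too. In this form it also recovers an interpolant from its values on the normal basis.
-/
theorem phiInv_eq (f : Skew p K) (e : Fin (p - 1)) :
    f e = ∑ j : Fin (p - 1), ((p : K)⁻¹ * ((c.v (e + j))⁻¹ - 1)) * c.eval f (c.v j) := by
  simp only [eval_v, mul_sum]
  rw [sum_comm]
  calc f e = ∑ i, f i * if e = i then 1 else 0 := by simp
    _ = _ := by
      refine sum_congr rfl fun i _ => ?_
      rw [← c.sum_dual, mul_sum]
      refine sum_congr rfl fun j _ => ?_
      rw [add_comm (j : ℕ) e, add_comm (j : ℕ) i]
      ring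

theorem phiInv_phi (f : Skew p K) : c.phiInv (c.phi f) = f := by
  ext e
  rw [c.phiInv_eq f e]
  simp only [phiInv, sum_phi, mul_sum, mul_assoc]

theorem phi_mul (f g : Skew p K) : c.phi (c.mul g f) = c.phi f * c.phi g := by
  ext i k
  have h : c.eval (c.mul g f) (c.v i)
      = ∑ k, algebraMap ℚ K ((c.phi f * c.phi g) i k) * c.v k := by
    rw [eval_mul, ← c.sum_phi f, eval_sum]
    simp only [← c.sum_phi g, mul_sum, Matrix.mul_apply, map_sum, sum_mul, map_mul]
    rw [sum_comm]
    exact sum_congr rfl fun _ _ => sum_congr rfl fun _ _ => by ring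
  simp only [phi, Matrix.of_apply]
  rw [h, repr_sum]
  rfl

theorem mul_apply_eq_zero (f g : Skew p K) {e : Fin (p - 1)} (he : e ∉ sumset f g) :
    c.mul g f e = 0 := by
  classical
  refine sum_eq_zero fun i _ => sum_eq_zero fun j _ => ?_
  split_ifs with h
  · by_cases hg : g i = 0
    · rw [hg, zero_mul]
    by_cases hf : f j = 0
    · rw [hf, map_zero, mul_zero]
    refine absurd ?_ he
    simp only [sumset, supp, mem_filter, mem_univ, true_and]
    exact ⟨j, by simpa using hf, i, by simpa using hg, by rwa [add_comm]⟩
  · rfl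

theorem interpolates_mul (f g : Skew p K) : c.Interpolates (sumset f g)
    (fun i => c.eval (c.mul g f) (c.v 0 ^ i.val)) (c.mul g f) := by
  refine ⟨fun e he => c.mul_apply_eq_zero f g he, fun i => ?_⟩
  beta_reduce
  rw [eval_v_zero_pow]
  refine sum_subset (subset_univ _) fun e _ he => ?_
  rw [c.mul_apply_eq_zero f g he, mul_zero]

theorem node_injective (S : Finset (Fin (p - 1))) :
    Function.Injective fun j : Fin S.card => c.v (S.equivFin.symm j : Fin (p - 1)) := by
  intro i j h
  exact S.equivFin.symm.injective (Subtype.ext (c.v_injective h))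

theorem sum_subset_fin {n : ℕ} {M : Type*} [AddCommMonoid M] (S : Finset (Fin n)) (F : Fin n → M) :
    ∑ e ∈ S, F e = ∑ j : Fin S.card, F (S.equivFin.symm j) := by
  rw [← Finset.sum_coe_sort S, ← S.equivFin.symm.sum_comp]

/-- Distinct nodes make the Vandermonde system regular. This is what makes the result independent of
how the system is solved. -/
theorem Interpolates.unique {c : Choice p K} {S : Finset (Fin (p - 1))} {z : Fin S.card → K}
    {h h' : Skew p K} (hh : c.Interpolates S z h) (hh' : c.Interpolates S z h') : h = h' := by
  have key := Matrix.eq_zero_of_forall_pow_sum_mul_pow_eq_zero (c.node_injective S)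
    (v := fun j => h (S.equivFin.symm j) - h' (S.equivFin.symm j)) fun i => by
      have h1 := (hh.2 i).trans (hh'.2 i).symm
      rw [sum_subset_fin S fun e => _ * h e, sum_subset_fin S fun e => _ * h' e, ← sub_eq_zero,
        ← sum_sub_distrib] at h1
      rw [← h1]
      exact sum_congr rfl fun j _ => by ring
  ext e
  by_cases he : e ∈ S
  · have := congrFun key (S.equivFin ⟨e, he⟩)
    simpa [sub_eq_zero] using this
  · rw [hh.1 e he, hh'.1 e he]

theorem exists_interpolates (S : Finset (Fin (p - 1))) (z : Fin S.card → K) :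
    ∃ h, c.Interpolates S z h := by
  have hdet := Matrix.det_vandermonde_ne_zero_iff.2 (c.node_injective S)
  set V := (Matrix.vandermonde fun j : Fin S.card => c.v (S.equivFin.symm j : Fin (p - 1)))
  have hu : IsUnit V.transpose.det := by rw [Matrix.det_transpose]; exact hdet.isUnit
  let y := V.transpose⁻¹.mulVec z
  have hy : V.transpose.mulVec y = z := by
    rw [Matrix.mulVec_mulVec, Matrix.mul_nonsing_inv _ hu, Matrix.one_mulVec]
  refine ⟨fun e => if he : e ∈ S then y (S.equivFin ⟨e, he⟩) else 0, fun e he => dif_neg he,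
    fun i => ?_⟩
  rw [sum_subset_fin S, ← congrFun hy i]
  simp [Matrix.mulVec, dotProduct, V, Matrix.vandermonde_apply]

end Choice

theorem nonempty_choice (p : ℕ) [Fact p.Prime] (K : Type*) [Field K] [Algebra ℚ K]
    [IsCyclotomicExtension {p} ℚ K] : Nonempty (Choice p K) := by
  obtain ⟨u, hu⟩ := IsCyclic.exists_generator (α := (ZMod p)ˣ)
  exact ⟨⟨_, IsCyclotomicExtension.zeta_spec p ℚ K, u, hu⟩⟩

/-! ### Correctness of every implementation -/

section Correctness

variable {p : ℕ} [Fact p.Prime] {K : Type*} [Field K] [Algebra ℚ K]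
  [IsCyclotomicExtension {p} ℚ K] {c : Choice p K}

theorem StoresMatrix.mono {k n : ℕ} {m m' : List ℚ} (h : m <+: m') {a : Addr k n}
    {A : Matrix (Fin k) (Fin n) ℚ} (hA : StoresMatrix m a A) : StoresMatrix m' a A :=
  fun i j => getElem?_of_prefix h (hA i j)

theorem Choice.Stores.mono {k : ℕ} {m m' : List ℚ} (h : m <+: m') {a : Addr k (p - 1)}
    {z : Fin k → K} (hz : c.Stores m a z) : c.Stores m' a z :=
  fun i j => getElem?_of_prefix h (hz i j)

/-- Every implementation multiplies matrices; its cost is at most the sum of the costs of its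
steps. -/
theorem Implementation.prog_yields (I : Implementation c) {n1 n2 n3 n4 n5 n6 : ℕ}
    {A B : Matrix (Fin (p - 1)) (Fin (p - 1)) ℚ} {Q : Prop}
    (h1 : Q → ∀ m a, StoresMatrix m a A → (I.toSkew a).Yields m fun _ _ k => k ≤ n1)
    (h2 : Q → ∀ m a, StoresMatrix m a B → (I.toSkew a).Yields m fun _ _ k => k ≤ n2)
    (h3 : Q → ∀ m a b, c.Stores m a (c.phiInv A) → c.Stores m b (c.phiInv B) →
      (I.findSumset a b).Yields m fun _ _ k => k ≤ n3)
    (h4 : Q → ∀ m a b, c.Stores m a (c.phiInv A) → c.Stores m b (c.phiInv B) →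
      (I.evaluate a b (sumset (c.phiInv A) (c.phiInv B)).card).Yields m fun _ _ k => k ≤ n4)
    (h5 : Q → ∀ S z m a, c.Stores m a z → (I.interpolate S a).Yields m fun _ _ k => k ≤ n5)
    (h6 : Q → ∀ f m a, c.Stores m a f → (I.toMatrix a).Yields m fun _ _ k => k ≤ n6)
    {m : List ℚ} {a b : Addr (p - 1) (p - 1)} (ha : StoresMatrix m a A) (hb : StoresMatrix m b B) :
    (I.prog a b).Yields m fun out m' k =>
      StoresMatrix m' out (A * B) ∧ (Q → k ≤ n1 + n2 + n3 + n4 + n5 + n6) := by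
  -- The proposition `Q` switches the cost bounds on: with `False` the result covers arbitrary
  -- implementations, with `True` it also adds up the costs.
  have imp : ∀ {α : Type} {P : Prog α} {m : List ℚ} {Q' : α → List ℚ → ℕ → Prop} {n : ℕ},
      P.Yields m Q' → (Q → P.Yields m fun _ _ k => k ≤ n) →
      P.Yields m fun a m' k => m <+: m' ∧ Q' a m' k ∧ (Q → k ≤ n) := by
    intro α P m Q' n h h'
    by_cases hQ : Q
    · exact (h.and (h' hQ)).prefix.mono fun a m' k hk => ⟨hk.1, hk.2.1, fun _ => hk.2.2⟩
    · exact h.prefix.mono fun a m' k hk => ⟨hk.1, hk.2, fun hq => absurd hq hQ⟩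
  refine Prog.Yields.bind ((imp (I.toSkew_spec A m a ha) fun q => h1 q m a ha).mono ?_)
  rintro f m1 k1 ⟨hm1, hf, hk1⟩
  have hb := hb.mono hm1
  refine Prog.Yields.bind ((imp (I.toSkew_spec B m1 b hb) fun q => h2 q m1 b hb).mono ?_)
  rintro g m2 k2 ⟨hm2, hg, hk2⟩
  have hf := hf.mono hm2
  refine Prog.Yields.bind ((imp (I.findSumset_spec _ _ m2 f g hf hg)
    fun q => h3 q m2 f g hf hg).mono ?_)
  rintro S m3 k3 ⟨hm3, rfl, hk3⟩
  have hf := hf.mono hm3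
  have hg := hg.mono hm3
  refine Prog.Yields.bind ((imp (I.evaluate_spec _ _ m3 f g _ hf hg)
    fun q => h4 q m3 f g hf hg).mono ?_)
  rintro z m4 k4 ⟨hm4, hz, hk4⟩
  refine Prog.Yields.bind ((imp (I.interpolate_spec _ _ m4 z hz)
    fun q => h5 q _ _ m4 z hz).mono ?_)
  rintro h m5 k5 ⟨hm5, ⟨h', hh, hint⟩, hk5⟩
  obtain rfl := hint.unique (c.interpolates_mul _ _)
  refine (imp (I.toMatrix_spec _ m5 h hh) fun q => h6 q _ m5 h hh).mono ?_
  rintro out m6 k6 ⟨hm6, hout, hk6⟩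
  rw [c.phi_mul, c.phi_phiInv, c.phi_phiInv] at hout
  refine ⟨hout, fun q => ?_⟩
  have := hk1 q
  have := hk2 q
  have := hk3 q
  have := hk4 q
  have := hk5 q
  have := hk6 q
  omega

theorem Implementation.correct (I : Implementation c)
    {A B : Matrix (Fin (p - 1)) (Fin (p - 1)) ℚ} {m : List ℚ} {a b : Addr (p - 1) (p - 1)}
    (ha : StoresMatrix m a A) (hb : StoresMatrix m b B) :
    (I.prog a b).Yields m fun out m' _ => StoresMatrix m' out (A * B) :=
  (I.prog_yields (Q := False) (n1 := 0) (n2 := 0) (n3 := 0) (n4 := 0) (n5 := 0) (n6 := 0)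
    False.elim False.elim False.elim False.elim False.elim False.elim ha hb).mono
    fun _ _ _ h => h.1

end Correctness

/-! ## Computations with elements of the cyclotomic field -/

section Embedding

variable {R : Type} [CommRing R] [Algebra ℚ R]

theorem exists_anti {m : ℕ} (hm : 0 < m) (x : ℕ → R) :
    ∃ a ∈ Anti R m, ∀ i < m, a (i : ℕ) = x i := by
  have hm' : (m : ℤ) ≠ 0 := by exact_mod_cast hm.ne'
  refine ⟨fun i => ((i / m).negOnePow : ℤ) • x (i % m).toNat, fun i => ?_, fun i hi => ?_⟩
  · have h1 : (i + m) / m = i / m + 1 := by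
      rw [Int.add_ediv_of_dvd_right dvd_rfl, Int.ediv_self hm']
    simp only [h1, Int.negOnePow_succ, Int.add_emod_right, Units.val_neg, neg_smul]
  · have h1 : (i : ℤ) / m = 0 := by exact_mod_cast Nat.div_eq_of_lt hi
    have h2 : (i : ℤ) % m = i := by exact_mod_cast Nat.mod_eq_of_lt hi
    simp only [h1, h2]
    simp

/-- A block of length `p` moved by `k ≤ m - p` does not wrap around, so the relation `y ^ m = -1` is
never felt and `y` may be replaced by `β`. -/
theorem sum_range_translate {m p k : ℕ} (hk : k + p ≤ m) {a : ℤ → ℚ}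
    (ha : ∀ i : ℤ, a (i + m) = -a i) (h0 : ∀ i < m, p ≤ i → a (i : ℕ) = 0)
    {K : Type*} [Field K] [Algebra ℚ K] (β : K) :
    ∑ i ∈ Finset.range m, algebraMap ℚ K (a (i - k)) * β ^ i
      = β ^ k * ∑ i ∈ Finset.range p, algebraMap ℚ K (a (i : ℕ)) * β ^ i := by
  have hsub : Finset.Ico k (k + p) ⊆ Finset.range m := fun i hi => by
    rw [Finset.mem_Ico] at hi
    exact Finset.mem_range.2 (by omega)
  rw [← Finset.sum_subset hsub, Finset.sum_Ico_eq_sum_range, Nat.add_sub_cancel_left,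
    Finset.mul_sum]
  · refine Finset.sum_congr rfl fun i _ => ?_
    push_cast
    rw [add_sub_cancel_left, pow_add]
    ring
  · intro i hi hi'
    rw [Finset.mem_range] at hi
    rw [Finset.mem_Ico] at hi'
    have : a (i - k) = 0 := by
      by_cases hik : k ≤ i
      · have := h0 (i - k) (by omega) (by omega)
        rwa [Nat.cast_sub hik] at this
      · have h1 := h0 (i + m - k) (by omega) (by omega)
        have h2 := ha (i - k)
        rw [Nat.cast_sub (by omega), Nat.cast_add, show (i + m - k : ℤ) = i - k + m by ring, h2,
          neg_eq_zero] at h1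
        exact h1
    rw [this, map_zero, zero_mul]

end Embedding

namespace Choice

variable {p : ℕ} [Fact p.Prime] {K : Type*} [Field K] [Algebra ℚ K]
  [IsCyclotomicExtension {p} ℚ K] (c : Choice p K) {X : Type}

open Finset Polynomial

/-- The coordinates in the normal basis of a function with values in `ℚ(β)`. -/
def coords (Z : X → K) : Set (X → ℚ) :=
  Set.range fun (k : Fin (p - 1)) ξ => c.normalBasis.repr (Z ξ) k

theorem sum_range_eq_sum_zmod {M : Type*} [AddCommMonoid M] (F : ℕ → M) :
    ∑ i ∈ range p, F i = ∑ x : ZMod p, F x.val := by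
  symm
  refine sum_nbij ZMod.val (fun x _ => mem_range.2 (ZMod.val_lt x))
    (fun x _ y _ h => ZMod.val_injective p h) (fun i hi => ?_) fun _ _ => rfl
  exact ⟨i, mem_coe.2 (mem_univ _), ZMod.val_cast_of_lt (mem_range.1 hi)⟩

theorem β_pow_val (x : ZMod p) : c.β ^ x.val = c.χ x := by
  rw [← c.χ_natCast, ZMod.natCast_zmod_val]

/-- The normal basis consists of `β, …, β ^ (p - 1)` in another order. Placing the coordinate of `v
k` at the residue of `u ^ k` therefore writes an element as a polynomial in `β` without constant
term, at no cost. -/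
theorem exists_embedding {m : ℕ} (hm : p ≤ m) (Z : X → K) :
    ∃ a ∈ Anti (X → ℚ) m, Set.range a ⊆ scalings (c.coords Z) ∧
      (∀ i < m, p ≤ i → a (i : ℕ) = 0) ∧
      ∀ ξ, ∑ i ∈ range p, algebraMap ℚ K (a (i : ℕ) ξ) * c.β ^ i = Z ξ := by
  have hp : 0 < p := (Fact.out : p.Prime).pos
  let x : ℕ → X → ℚ := fun n => ∑ k : Fin (p - 1),
    if ((c.u ^ (k : ℕ) : (ZMod p)ˣ) : ZMod p).val = n then
      fun ξ => c.normalBasis.repr (Z ξ) k else 0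
  have hx : ∀ k : Fin (p - 1), x ((c.u ^ (k : ℕ) : (ZMod p)ˣ) : ZMod p).val
      = fun ξ => c.normalBasis.repr (Z ξ) k := by
    intro k
    simp only [x]
    rw [sum_eq_single_of_mem k (mem_univ _), if_pos rfl]
    intro l _ hl
    rw [if_neg]
    exact fun h => hl (c.u_pow_injective (Units.ext (ZMod.val_injective p h)))
  have hx0 : ∀ n, (∀ k : Fin (p - 1), ((c.u ^ (k : ℕ) : (ZMod p)ˣ) : ZMod p).val ≠ n) → x n = 0 :=
    fun n hn => sum_eq_zero fun k _ => if_neg (hn k)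
  obtain ⟨a, ha, hax⟩ := exists_anti (show 0 < m by omega) x
  refine ⟨a, ha, ?_, fun i hi hpi => ?_, fun ξ => ?_⟩
  · refine (range_anti_subset (by omega) ha).trans (scalings_subset ?_)
    intro y hy
    simp only [Set.mem_iUnion, Set.mem_singleton_iff, mem_range] at hy
    obtain ⟨i, hi, rfl⟩ := hy
    rw [hax i hi]
    by_cases h : ∃ k : Fin (p - 1), ((c.u ^ (k : ℕ) : (ZMod p)ˣ) : ZMod p).val = i
    · obtain ⟨k, rfl⟩ := h
      rw [hx]
      exact subset_scalings _ ⟨k, rfl⟩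
    · rw [hx0 i (not_exists.1 h)]
      exact zero_mem_scalings _
  · rw [hax i hi, hx0]
    intro k hk
    have := ZMod.val_lt ((c.u ^ (k : ℕ) : (ZMod p)ˣ) : ZMod p)
    omega
  · have h1 : ∀ i ∈ range p, algebraMap ℚ K (a (i : ℕ) ξ) * c.β ^ i
        = algebraMap ℚ K (x i ξ) * c.β ^ i := fun i hi => by
      rw [hax i (by rw [mem_range] at hi; omega)]
    rw [sum_congr rfl h1, sum_range_eq_sum_zmod, c.sum_zmod, hx0, ← c.sum_repr (Z ξ)]
    · simp only [Pi.zero_apply, map_zero, zero_mul, zero_add]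
      exact sum_congr rfl fun k _ => by rw [hx, c.β_pow_val, c.v_eq]
    · intro k
      rw [ZMod.val_zero, Ne, ZMod.val_eq_zero]
      exact Units.ne_zero _

theorem exists_aeval_eq (κ : K) : ∃ P : ℚ[X], P.natDegree < p ∧ aeval c.β P = κ := by
  refine ⟨∑ k : Fin (p - 1), monomial ((c.u ^ (k : ℕ) : (ZMod p)ˣ) : ZMod p).val
    (c.normalBasis.repr κ k), ?_, ?_⟩
  · refine (natDegree_sum_le_of_forall_le (n := p - 1) _ _ fun k _ => ?_).trans_lt
      (Nat.sub_lt (Fact.out : p.Prime).pos one_pos)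
    exact (natDegree_monomial_le _).trans (Nat.le_sub_one_of_lt (ZMod.val_lt _))
  · rw [map_sum, ← c.sum_repr κ]
    refine sum_congr rfl fun k _ => ?_
    rw [aeval_monomial, c.β_pow_val, c.v_eq, c.sum_repr]

/-- Two polynomials of degree below `p` multiply without wrapping modulo `y ^ m + 1`, so the product
can be read off at `β`. -/
theorem sum_aeval_sh {m : ℕ} (hm : 2 * p ≤ m) {a : ℤ → X → ℚ} (ha : a ∈ Anti (X → ℚ) m)
    (h0 : ∀ i < m, p ≤ i → a (i : ℕ) = 0) {P : ℚ[X]} (hP : P.natDegree < p) (ξ : X) :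
    ∑ i ∈ range m, algebraMap ℚ K
        (aeval (sh 1 : Module.End ℚ (ℤ → X → ℚ)) P a (i : ℕ) ξ) * c.β ^ i
      = aeval c.β P * ∑ i ∈ range p, algebraMap ℚ K (a (i : ℕ) ξ) * c.β ^ i := by
  have h1 : aeval (sh 1 : Module.End ℚ (ℤ → X → ℚ)) P
      = ∑ k ∈ range p, P.coeff k • (sh k : Module.End ℚ (ℤ → X → ℚ)) := by
    conv_lhs => rw [P.as_sum_range' p hP]
    rw [map_sum]
    refine sum_congr rfl fun k _ => ?_
    rw [← C_mul_X_pow_eq_monomial, map_mul, aeval_C, aeval_sh_X_pow, ← Algebra.smul_def]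
  have h2 : aeval c.β P = ∑ k ∈ range p, algebraMap ℚ K (P.coeff k) * c.β ^ k := by
    conv_lhs => rw [P.as_sum_range' p hP]
    rw [map_sum]
    exact sum_congr rfl fun k _ => aeval_monomial _
  rw [h1, h2, sum_mul]
  simp only [LinearMap.sum_apply, LinearMap.smul_apply, Finset.sum_apply, Pi.smul_apply, map_sum,
    smul_eq_mul, map_mul, sum_mul, sh_apply]
  rw [sum_comm]
  refine sum_congr rfl fun k hk => ?_
  rw [mem_range] at hk
  rw [mul_assoc, ← sum_range_translate (m := m) (a := fun i => a i ξ) (by omega)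
    (fun i => congrFun (ha i) ξ) (fun i hi hpi => congrFun (h0 i hi hpi) ξ), mul_sum]
  exact sum_congr rfl fun i _ => mul_assoc _ _ _

/-- Collect exponents modulo `p`, using `β ^ p = 1`, and then remove the constant term by `1 = -∑
v_k`: it is subtracted from every coordinate. -/
theorem computes_coords {m : ℕ} {b : ℤ → X → ℚ} {Z : X → K}
    (h : ∀ ξ, Z ξ = ∑ i ∈ range m, algebraMap ℚ K (b (i : ℕ) ξ) * c.β ^ i) :
    Computes (Set.range b) (m + p) (c.coords Z) := by
  classical
  let W : ZMod p → X → ℚ := fun x => ∑ i ∈ range m with ((i : ℕ) : ZMod p) = x, b (i : ℕ)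
  have h1 : Computes (Set.range b) m (Set.range W) := by
    have := Computes.biUnion (F := Set.range b) univ
      (fun x : ZMod p => #{i ∈ range m | ((i : ℕ) : ZMod p) = x}) (fun x => {W x}) fun x _ =>
        Computes.sum _ (fun i : ℕ => b i) fun i _ => subset_scalings _ ⟨_, rfl⟩
    rw [← card_eq_sum_card_fiberwise (fun _ _ => mem_coe.2 (mem_univ _)), card_range] at this
    refine this.mono_right ?_
    rintro _ ⟨x, rfl⟩
    simp
  have hrepr : ∀ ξ k, c.normalBasis.repr (Z ξ) k
      = W ((c.u ^ (k : ℕ) : (ZMod p)ˣ) : ZMod p) ξ - W 0 ξ := by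
    intro ξ k
    have h2 : Z ξ = ∑ x, algebraMap ℚ K (W x ξ) * c.χ x := by
      rw [h, ← sum_fiberwise (range m) fun i : ℕ => ((i : ℕ) : ZMod p)]
      refine sum_congr rfl fun x _ => ?_
      simp only [W, Finset.sum_apply, map_sum, sum_mul]
      refine sum_congr rfl fun i hi => ?_
      rw [← (mem_filter.1 hi).2, χ_natCast]
    have h3 : Z ξ = ∑ k : Fin (p - 1), algebraMap ℚ K
        (W ((c.u ^ (k : ℕ) : (ZMod p)ˣ) : ZMod p) ξ - W 0 ξ) * c.v k := by
      have hv := c.sum_v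
      simp only [v_eq] at hv
      rw [h2, c.sum_zmod]
      simp only [map_sub, sub_mul, sum_sub_distrib, ← mul_sum, v_eq, AddChar.map_zero_eq_one, hv]
      ring
    rw [h3, repr_sum]
  have h4 : Computes (Set.range W) p (c.coords Z) := by
    have := Computes.biUnion_const (F := Set.range W) (univ : Finset (Fin (p - 1))) 1
      (fun k => {W ((c.u ^ (k : ℕ) : (ZMod p)ˣ) : ZMod p) + -W 0}) fun k _ =>
        Computes.add (subset_scalings _ ⟨_, rfl⟩)
          (neg_mem_scalings (subset_scalings _ ⟨_, rfl⟩))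
    rw [card_univ, Fintype.card_fin, mul_one] at this
    refine (this.mono_cost (Nat.sub_le p 1)).mono_right ?_
    rintro _ ⟨k, rfl⟩
    simp only [mem_univ, Set.iUnion_true, Set.iUnion_singleton_eq_range, Set.mem_range]
    refine ⟨k, ?_⟩
    ext ξ
    rw [hrepr, sub_eq_add_neg]
    rfl
  exact h1.trans h4

/-- A bound for the number of operations of a convolution over `ℚ(β)`. -/
def convCost (p : ℕ) : ℕ := 3840 * p ^ 2 * (Nat.clog 2 (4 * p) + 1) ^ 2

/-- Multiplication by a fixed polynomial over `ℚ(β)`. -/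
theorem computes_conv (κ : ℕ → K) (z : ℕ → X → K) {n' n L : ℕ} (hn : n' + n ≤ 8 * p)
    (hL : L ≤ 8 * p) : Computes (⋃ i ∈ range n, c.coords (z i)) (convCost p)
      (⋃ l ∈ range L, c.coords fun ξ =>
        ∑ k ∈ range n', ∑ i ∈ range n, if k + i = l then κ k * z i ξ else 0) := by
  have hp : 2 ≤ p := (Fact.out : p.Prime).two_le
  -- From `4 * p ≤ m` there is room for products of degree below `2 * p` in `β`, and the outer
  -- lengths, at most `8 * p`, fit into a transform of length `2 * m`; `m ≤ 8 * p` controls the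
  -- cost.
  set s := Nat.clog 2 (4 * p) with hs
  set m := 2 ^ s with hm
  have hm1 : 4 * p ≤ m := Nat.le_pow_clog (by norm_num) _
  have hm2 : m ≤ 8 * p := by
    have h1 : s ≠ 0 := by
      intro h
      rw [hm, h] at hm1
      omega
    have h2 : 2 ^ (s - 1) < 4 * p := Nat.pow_pred_clog_lt_self (by norm_num) (by omega)
    have h3 : m = 2 * 2 ^ (s - 1) := by rw [hm, ← pow_succ']; congr 1; omega
    omega
  choose P hPd hP using fun k => c.exists_aeval_eq (κ k)
  choose a ha ha1 ha2 ha3 using fun i => c.exists_embedding (show p ≤ m by omega) (z i)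
  -- The transform of length `2 * m` uses `y` itself as its root of unity.
  have h1 := computes_polyMul (m := m) (by omega) (computes_aeval s) (j := s + 1) (k := 1)
    (by rw [pow_succ, hm]; ring) (n' := n') (n := n) (by rw [pow_succ, ← hm]; omega) P ha
  set q := polyMul n' P n a with hq
  have h2 : Computes (entries (2 ^ (s + 1)) q) (L * (m + p))
      (⋃ l ∈ range L, c.coords fun ξ =>
        ∑ k ∈ range n', ∑ i ∈ range n, if k + i = l then κ k * z i ξ else 0) := by
    have := Computes.biUnion_const (F := entries (2 ^ (s + 1)) q) (range L) (m + p) (fun l =>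
      c.coords fun ξ => ∑ k ∈ range n', ∑ i ∈ range n, if k + i = l then κ k * z i ξ else 0)
    rw [card_range] at this
    refine this fun l hl => ?_
    rw [mem_range] at hl
    refine (c.computes_coords (b := q l) fun ξ => ?_).mono_left
      (range_subset_entries (by rw [pow_succ, ← hm]; omega) q)
    simp only [hq, polyMul, Finset.sum_apply, map_sum, sum_mul]
    symm
    rw [sum_comm]
    refine sum_congr rfl fun k _ => ?_
    rw [sum_comm]
    refine sum_congr rfl fun i _ => ?_
    split_ifs with hkl
    · rw [c.sum_aeval_sh (by omega) (ha i) (ha2 i) (hPd k), hP, ha3]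
    · simp
  refine (h1.trans h2).mono ?_ ?_ (subset_scalings _)
  · refine entries_subset fun i hi => (ha1 i).trans (scalings_mono ?_)
    exact Set.subset_biUnion_of_mem (u := fun i => c.coords (z i))
      (Finset.mem_coe.2 (mem_range.2 hi))
  · have e1 : 2 ^ (s + 1) = 2 * m := pow_succ' _ _
    rw [e1, ← hm, convCost, ← hs]
    have e2 : L * (m + p) ≤ 2 * m * (2 * m) := Nat.mul_le_mul (by omega) (by omega)
    have e3 : m ^ 2 ≤ (8 * p) ^ 2 := Nat.pow_le_pow_left hm2 2
    have e4 : 2 * ((s + 1) * (2 * m) * m) + 2 * m * (26 * m * (s + 1) ^ 2) + 2 * m * (2 * m)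
        = m ^ 2 * (4 * (s + 1) + 52 * (s + 1) ^ 2 + 4) := by ring
    have e5 : 4 * (s + 1) + 52 * (s + 1) ^ 2 + 4 ≤ 60 * (s + 1) ^ 2 := by nlinarith
    calc _ ≤ m ^ 2 * (4 * (s + 1) + 52 * (s + 1) ^ 2 + 4) := by rw [← e4]; omega
      _ ≤ (8 * p) ^ 2 * (60 * (s + 1) ^ 2) := Nat.mul_le_mul e3 e5
      _ = _ := by ring

/-- Multiplication by a fixed Hankel matrix over `ℚ(β)`. -/
theorem computes_hankel (κ : ℕ → K) (z : Fin (p - 1) → X → K) :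
    Computes (⋃ j, c.coords (z j)) (convCost p)
      (⋃ i : Fin (p - 1), c.coords fun ξ => ∑ j : Fin (p - 1), κ (i + j) * z j ξ) := by
  -- Reversing the input turns the sum over `κ (i + j)` into a convolution; row `i` is found at the
  -- index `p - 2 + i`.
  let z' : ℕ → X → K := fun i => if hi : i < p - 1 then z (Fin.rev ⟨i, hi⟩) else 0
  refine (c.computes_conv κ z' (n' := 2 * (p - 1)) (n := p - 1) (L := 2 * (p - 1)) (by omega)
    (by omega)).mono ?_ le_rfl ?_
  · refine subset_trans ?_ (subset_scalings _)
    refine Set.iUnion₂_subset fun i hi => ?_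
    rw [mem_range] at hi
    simp only [z', hi, dif_pos]
    exact Set.subset_iUnion (fun j => c.coords (z j)) _
  · refine subset_trans ?_ (subset_scalings _)
    refine Set.iUnion_subset fun i => ?_
    refine subset_trans (subset_of_eq ?_) (Set.subset_biUnion_of_mem
      (u := fun l => c.coords fun ξ => ∑ k ∈ range (2 * (p - 1)), ∑ i ∈ range (p - 1),
        if k + i = l then κ k * z' i ξ else 0)
      (Finset.mem_coe.2 (mem_range.2 (show p - 1 - 1 + i < 2 * (p - 1) by omega))))
    congr 1
    ext ξ
    rw [sum_comm, sum_range, ← Equiv.sum_comp Fin.revPerm]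
    refine sum_congr rfl fun j _ => ?_
    rw [sum_eq_single_of_mem (i + (Fin.rev j : ℕ)) (mem_range.2 (by omega)), if_pos]
    · simp only [z', j.isLt, dif_pos, Fin.revPerm_apply]
    · rw [Fin.val_rev]; omega
    · intro k _ hk
      rw [if_neg]
      rw [Fin.val_rev] at hk
      omega

end Choice

/-! ### Programs for the steps of the algorithm -/

namespace Choice

variable {p : ℕ} [Fact p.Prime] {K : Type*} [Field K] [Algebra ℚ K]
  [IsCyclotomicExtension {p} ℚ K] (c : Choice p K) {X : Type}

open Finset

/-- The element of `ℚ(β)` in the `i`-th row of a table of coordinates. -/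
noncomputable def ofCoords {n : ℕ} (i : Fin n) (ξ : Fin n → Fin (p - 1) → ℚ) : K :=
  ∑ k : Fin (p - 1), algebraMap ℚ K (ξ i k) * c.v k

theorem repr_ofCoords {n : ℕ} (i : Fin n) (ξ : Fin n → Fin (p - 1) → ℚ) (k : Fin (p - 1)) :
    c.normalBasis.repr (c.ofCoords i ξ) k = ξ i k :=
  c.repr_sum _ _

theorem ofCoords_repr {n : ℕ} (i : Fin n) (z : Fin n → K) :
    c.ofCoords i (fun i k => c.normalBasis.repr (z i) k) = z i :=
  c.sum_repr _

/-- Compilation of a map between families of elements of `ℚ(β)`. -/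
theorem exists_prog {n n' N : ℕ} (T : (Fin n → K) → Fin n' → K)
    (h : Computes (⋃ i : Fin n, c.coords (c.ofCoords i)) N
      (⋃ j : Fin n', c.coords fun ξ => T (fun i => c.ofCoords i ξ) j)) :
    ∃ P : Addr n (p - 1) → Prog (Addr n' (p - 1)), ∀ z m a, c.Stores m a z →
      (P a).Yields m fun out m' k => c.Stores m' out (T z) ∧ k ≤ 5 * (N + n' * (p - 1)) := by
  have h' : Computes
      (Set.range fun (x : Fin n × Fin (p - 1)) (ξ : Fin n → Fin (p - 1) → ℚ) => ξ x.1 x.2) N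
      (Set.range fun (x : Fin n' × Fin (p - 1)) (ξ : Fin n → Fin (p - 1) → ℚ) =>
        c.normalBasis.repr (T (fun i => c.ofCoords i ξ) x.1) x.2) := by
    refine (h.mono_left ?_).mono_right ?_
    · refine Set.iUnion_subset fun i => ?_
      rintro _ ⟨k, rfl⟩
      exact ⟨(i, k), funext fun ξ => (c.repr_ofCoords i ξ k).symm⟩
    · rintro _ ⟨x, rfl⟩
      exact Set.mem_iUnion.2 ⟨x.1, x.2, rfl⟩
  obtain ⟨P, hP⟩ := h'.compile
  refine ⟨fun a => (P fun x => a x.1 x.2).bind fun out => .ret fun i k => out (i, k),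
    fun z m a hz => ?_⟩
  refine Prog.Yields.bind (((hP _).2 m (fun i k => c.normalBasis.repr (z i) k)
    fun x => hz x.1 x.2).mono ?_)
  rintro out m' k ⟨hout, hk⟩
  refine ⟨_, m', 0, rfl, fun i j => ?_, ?_⟩
  · have := hout (i, j)
    simpa only [ofCoords_repr] using this
  · simpa using hk

theorem stores_iff_storesMatrix {m : List ℚ} {a : Addr (p - 1) (p - 1)}
    {A : Matrix (Fin (p - 1)) (Fin (p - 1)) ℚ} :
    c.Stores m a (fun j => ∑ k : Fin (p - 1), algebraMap ℚ K (A j k) * c.v k)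
      ↔ StoresMatrix m a A := by
  simp only [Stores, StoresMatrix, repr_sum]

theorem exists_toSkew : ∃ P : Addr (p - 1) (p - 1) → Prog (Addr (p - 1) (p - 1)),
    ∀ A m a, StoresMatrix m a A → (P a).Yields m fun out m' k =>
      c.Stores m' out (c.phiInv A) ∧ k ≤ 5 * (convCost p + (p - 1) * (p - 1)) := by
  obtain ⟨P, hP⟩ := c.exists_prog
    (fun z i => ∑ j : Fin (p - 1), (p : K)⁻¹ * ((c.v (i + j))⁻¹ - 1) * z j)
    (c.computes_hankel (fun l => (p : K)⁻¹ * ((c.v l)⁻¹ - 1)) c.ofCoords)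
  refine ⟨P, fun A m a hA => (hP _ m a (c.stores_iff_storesMatrix.2 hA)).mono ?_⟩
  rintro out m' k ⟨hout, hk⟩
  refine ⟨?_, hk⟩
  convert hout using 2
  rw [phiInv, mul_sum]
  exact sum_congr rfl fun _ _ => (mul_assoc _ _ _).symm

/-- Since `σ ^ j (v_i) = v_(j+i)`, evaluation on the normal basis is the Hankel matrix with entries
`v_(i+j)`. -/
theorem computes_phi (z : Fin (p - 1) → X → K) :
    Computes (⋃ j, c.coords (z j)) (convCost p)
      (⋃ i : Fin (p - 1), c.coords fun ξ => c.eval (fun j => z j ξ) (c.v i)) := by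
  refine (c.computes_hankel c.v z).mono_right (Set.iUnion_mono fun i => subset_of_eq ?_)
  congr 1
  ext ξ
  rw [eval_v]
  exact sum_congr rfl fun j _ => by rw [add_comm, mul_comm]

theorem exists_toMatrix : ∃ P : Addr (p - 1) (p - 1) → Prog (Addr (p - 1) (p - 1)),
    ∀ f m a, c.Stores m a f → (P a).Yields m fun out m' k =>
      StoresMatrix m' out (c.phi f) ∧ k ≤ 5 * (convCost p + (p - 1) * (p - 1)) :=
  c.exists_prog (fun f i => c.eval f (c.v i)) (c.computes_phi c.ofCoords)

/-! ### Generating functions for interpolation -/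

section PowerSeries

open PowerSeries

theorem coeff_mul_eq_sum_range {F : Type*} [CommRing F] {A B : F⟦X⟧} {a b l : ℕ} (hl : l < a)
    (hB : ∀ i, b ≤ i → i ≤ l → coeff i B = 0) :
    coeff l (A * B) = ∑ k ∈ range a, ∑ i ∈ range b,
      if k + i = l then coeff k A * coeff i B else 0 := by
  rw [coeff_mul, Finset.Nat.sum_antidiagonal_eq_sum_range_succ fun k i => coeff k A * coeff i B,
    ← sum_subset (range_mono (show l.succ ≤ a by omega))]
  · refine sum_congr rfl fun k hk => ?_
    rw [mem_range] at hk
    by_cases hkb : l - k < b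
    · rw [sum_eq_single_of_mem (l - k) (mem_range.2 hkb), if_pos (by omega)]
      intro i _ hi
      rw [if_neg (by omega)]
    · rw [hB (l - k) (by omega) (by omega), mul_zero, sum_eq_zero]
      intro i hi
      rw [mem_range] at hi
      rw [if_neg (by omega)]
  · intro k _ hk
    rw [mem_range] at hk
    exact sum_eq_zero fun i _ => if_neg (by omega)

theorem one_sub_mul_mk_pow {F : Type*} [CommRing F] (x : F) :
    ((1 - Polynomial.C x * Polynomial.X : Polynomial F) : F⟦X⟧) *
      PowerSeries.mk (fun i => x ^ i) = 1 := by
  ext n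
  simp only [Polynomial.coe_sub, Polynomial.coe_one, Polynomial.coe_mul, Polynomial.coe_C,
    Polynomial.coe_X, sub_mul, one_mul, map_sub, coeff_mk, mul_assoc, coeff_C_mul]
  cases n with
  | zero => simp
  | succ n => simp [coeff_succ_X_mul, pow_succ', coeff_one]

/-- The denominator of the generating function of the values at powers of `β`. -/
noncomputable def locator (S : Finset (Fin (p - 1))) : Polynomial K :=
  ∏ e ∈ S, (1 - Polynomial.C (c.v e) * Polynomial.X)

theorem natDegree_locator_le (S : Finset (Fin (p - 1))) : (c.locator S).natDegree ≤ S.card := by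
  refine (Polynomial.natDegree_prod_le _ _).trans ?_
  refine (sum_le_card_nsmul _ _ 1 fun e _ => ?_).trans_eq (by simp)
  compute_degree

/-- The series is `∑ h_e / (1 - v_e T)`, and each denominator divides the locator; what remains is a
polynomial of degree below the size of `S`. -/
theorem coeff_locator_mul {S : Finset (Fin (p - 1))} {n : ℕ} (hn : S.card ≤ n) (h : Skew p K) :
    coeff n ((c.locator S : K⟦X⟧) * PowerSeries.mk fun i => ∑ e ∈ S, c.v e ^ i * h e) = 0 := by
  have h1 : (PowerSeries.mk fun i => ∑ e ∈ S, c.v e ^ i * h e)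
      = ∑ e ∈ S, (PowerSeries.mk fun i => c.v e ^ i) * C (h e) := by
    ext i
    simp [coeff_mul_C]
  rw [h1, mul_sum, map_sum]
  refine sum_eq_zero fun e he => ?_
  have h2 : c.locator S = c.locator (S.erase e) * (1 - Polynomial.C (c.v e) * Polynomial.X) :=
    (prod_erase_mul S _ he).symm
  rw [h2, Polynomial.coe_mul, ← mul_assoc, mul_assoc ((c.locator (S.erase e) : K⟦X⟧)),
    one_sub_mul_mk_pow, mul_one, coeff_mul_C, Polynomial.coeff_coe,
    Polynomial.coeff_eq_zero_of_natDegree_lt, zero_mul]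
  have h3 := c.natDegree_locator_le (S.erase e)
  have h4 := card_erase_of_mem he
  have h5 := card_pos.2 ⟨e, he⟩
  omega

theorem constantCoeff_locator (S : Finset (Fin (p - 1))) :
    constantCoeff (c.locator S : K⟦X⟧) ≠ 0 := by
  simp [locator, ← coeff_zero_eq_constantCoeff_apply, Polynomial.coeff_zero_eq_eval_zero,
    Polynomial.eval_prod]

end PowerSeries

/-- The Vandermonde matrix is not inverted directly. The given values determine the numerator of the
generating function, the numerator determines the values at all `β ^ i` with `i < p`, and these
include all `h(v_j)`, from which `φ⁻¹` yields the coefficients. Each passage is a convolution with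
constants depending only on `S` and the choice. -/
theorem computes_interpolation (S : Finset (Fin (p - 1))) (z : Fin S.card → X → K)
    (h : X → Skew p K) (hh : ∀ ξ, c.Interpolates S (fun i => z i ξ) (h ξ)) :
    Computes (⋃ i, c.coords (z i)) (3 * convCost p)
      (⋃ e : Fin (p - 1), c.coords fun ξ => h ξ e) := by
  have hp : 2 ≤ p := (Fact.out : p.Prime).two_le
  have hS : S.card ≤ p - 1 := by simpa using card_le_univ S
  set D : PowerSeries K := (c.locator S : PowerSeries K) with hD
  let Z : X → PowerSeries K := fun ξ => PowerSeries.mk fun i => ∑ e ∈ S, c.v e ^ i * h ξ e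
  let z1 : ℕ → X → K := fun i ξ => PowerSeries.coeff i (Z ξ)
  let z2 : ℕ → X → K := fun i ξ => PowerSeries.coeff i (D * Z ξ)
  have hz1 : ∀ i : Fin S.card, z1 i = z i := by
    intro i
    ext ξ
    simp only [z1, Z, PowerSeries.coeff_mk]
    exact (hh ξ).2 i
  have h1 : Computes (⋃ i, c.coords (z i)) (convCost p) (⋃ l ∈ range S.card, c.coords (z2 l)) := by
    refine (c.computes_conv (fun k => PowerSeries.coeff k D) z1 (n' := S.card) (n := S.card)
      (L := S.card)      (by omega) (by omega)).mono ?_ le_rfl (subset_trans ?_ (subset_scalings _))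
    · refine subset_trans (Set.iUnion₂_subset fun i hi => ?_) (subset_scalings _)
      rw [mem_range] at hi
      rw [hz1 ⟨i, hi⟩]
      exact Set.subset_iUnion (fun i => c.coords (z i)) _
    · refine Set.iUnion₂_mono fun l hl => subset_of_eq ?_
      rw [mem_range] at hl
      congr 1
      ext ξ
      exact coeff_mul_eq_sum_range hl fun i hi hil => by omega
  -- The numerator has no coefficients beyond those already found, so dividing by the locator
  -- extends the list of values.
  have h2 : Computes (⋃ l ∈ range S.card, c.coords (z2 l)) (convCost p)
      (⋃ l ∈ range p, c.coords (z1 l)) := by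
    refine (c.computes_conv (fun k => PowerSeries.coeff k D⁻¹) z2 (n' := p) (n := S.card) (L := p)
      (by omega) (by omega)).mono_right ?_
    refine Set.iUnion₂_mono fun l hl => subset_of_eq ?_
    rw [mem_range] at hl
    congr 1
    ext ξ
    have : Z ξ = D⁻¹ * (D * Z ξ) := by
      rw [← mul_assoc, PowerSeries.inv_mul_cancel _ (c.constantCoeff_locator S), one_mul]
    simp only [z1]
    rw [this]
    exact coeff_mul_eq_sum_range hl fun i hi _ => c.coeff_locator_mul hi _
  -- Here `v j` is the power of `β` whose exponent is the residue of `u ^ j`, which lies below `p`.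
  have hz3 : ∀ j : Fin (p - 1), z1 ((c.u ^ (j : ℕ) : (ZMod p)ˣ) : ZMod p).val
      = fun ξ => c.eval (h ξ) (c.v j) := by
    intro j
    ext ξ
    simp only [z1, Z, PowerSeries.coeff_mk]
    rw [v_eq, ← β_pow_val, ← v_zero, eval_v_zero_pow]
    exact sum_subset (subset_univ _) fun e _ he => by rw [(hh ξ).1 e he, mul_zero]
  have h3 := c.computes_hankel (fun l => (p : K)⁻¹ * ((c.v l)⁻¹ - 1))
    fun (j : Fin (p - 1)) ξ => c.eval (h ξ) (c.v j)
  simp only [← phiInv_eq] at h3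
  refine Computes.mono_cost (n := convCost p + convCost p + convCost p)
    ((h1.trans h2).trans (h3.mono_left ?_)) (by omega)
  refine Set.iUnion_subset fun j => ?_
  rw [← hz3]
  exact Set.subset_biUnion_of_mem (u := fun l => c.coords (z1 l))
    (mem_coe.2 (mem_range.2 (ZMod.val_lt _)))

theorem exists_interpolate (S : Finset (Fin (p - 1))) :
    ∃ P : Addr S.card (p - 1) → Prog (Addr (p - 1) (p - 1)),
    ∀ z m a, c.Stores m a z → (P a).Yields m fun out m' k =>
      (∃ h, c.Stores m' out h ∧ c.Interpolates S z h) ∧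
        k ≤ 5 * (3 * convCost p + (p - 1) * (p - 1)) := by
  choose h hh using fun z => c.exists_interpolates S z
  obtain ⟨P, hP⟩ := c.exists_prog h
    (c.computes_interpolation S c.ofCoords (fun ξ => h fun i => c.ofCoords i ξ) fun ξ => hh _)
  exact ⟨P, fun z m a hz => (hP z m a hz).mono fun out m' k hk => ⟨⟨h z, hk.1, hh z⟩, hk.2⟩⟩

/-! ### Supports -/

/-- Tests which of the given registers vanish. -/
def zeroTests {α : Type} : List (α × ℕ) → Prog (List (α × Bool))
  | [] => .ret []
  | x :: l => .isZero x.2 fun b => (zeroTests l).bind fun r => .ret ((x.1, b) :: r)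

theorem zeroTests_yields {α : Type} (x : α → ℚ) (m : List ℚ) (l : List (α × ℕ))
    (h : ∀ y ∈ l, m[y.2]? = some (x y.1)) :
    (zeroTests l).Yields m fun r m' k =>
      m' = m ∧ r = l.map (fun y => (y.1, decide (x y.1 = 0))) ∧ k = l.length := by
  induction l with
  | nil => exact ⟨_, _, _, rfl, rfl, rfl, rfl⟩
  | cons y l ih =>
    obtain ⟨r, m', k, h1, rfl, rfl, rfl⟩ := ih fun y hy => h y (List.mem_cons_of_mem _ hy)
    refine ⟨_, m', l.length + 1, ?_, rfl, rfl, rfl⟩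
    simp [zeroTests, Prog.run, h y List.mem_cons_self, Prog.run_bind, h1]

open Classical in
/-- The set of rows with a nonzero entry. -/
noncomputable def suppProg {n k : ℕ} (a : Addr n k) : Prog (Finset (Fin n)) :=
  (zeroTests ((univ : Finset (Fin n × Fin k)).toList.map fun x => (x, a x.1 x.2))).bind fun r =>
    .ret (univ.filter fun i => ∃ j, ((i, j), false) ∈ r)

theorem suppProg_yields (f : Skew p K) {m : List ℚ} {a : Addr (p - 1) (p - 1)}
    (hf : c.Stores m a f) : (suppProg a).Yields m fun S m' k =>
      m' = m ∧ S = supp f ∧ k = (p - 1) * (p - 1) := by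
  classical
  refine Prog.Yields.bind ((zeroTests_yields (fun x : Fin (p - 1) × Fin (p - 1) =>
    c.normalBasis.repr (f x.1) x.2) m _ ?_).mono ?_)
  · intro y hy
    obtain ⟨x, -, rfl⟩ := List.mem_map.1 hy
    exact hf x.1 x.2
  · rintro r m' k ⟨rfl, rfl, rfl⟩
    refine ⟨_, m', 0, rfl, rfl, ?_, by simp⟩
    ext i
    simp only [mem_filter, mem_univ, true_and, supp, List.map_map, List.mem_map,
      Finset.mem_toList, Function.comp_apply, Prod.mk.injEq, decide_eq_false_iff_not]
    constructor
    · rintro ⟨j, ⟨i', j'⟩, ⟨rfl, rfl⟩, h⟩ h0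
      exact h (by simp [h0])
    · intro h
      by_contra hcon
      refine h (c.normalBasis.repr.injective (Finsupp.ext fun j => ?_))
      rw [map_zero, Finsupp.zero_apply]
      by_contra h0
      exact hcon ⟨j, (i, j), rfl, h0⟩

theorem exists_findSumset :
    ∃ P : Addr (p - 1) (p - 1) → Addr (p - 1) (p - 1) → Prog (Finset (Fin (p - 1))),
    ∀ f g m a b, c.Stores m a f → c.Stores m b g → (P a b).Yields m fun S _ k =>
      S = sumset f g ∧ k ≤ 2 * ((p - 1) * (p - 1)) := by
  classical
  refine ⟨fun a b => (suppProg a).bind fun S => (suppProg b).bind fun T =>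
    .ret (univ.filter fun l : Fin (p - 1) => ∃ i ∈ S, ∃ j ∈ T, (i.val + j.val) % (p - 1) = l.val),
    fun f g m a b hf hg => ?_⟩
  refine Prog.Yields.bind ((c.suppProg_yields f hf).mono ?_)
  rintro S m1 k1 ⟨rfl, rfl, rfl⟩
  refine Prog.Yields.bind ((c.suppProg_yields g hg).mono ?_)
  rintro T m2 k2 ⟨rfl, rfl, rfl⟩
  refine ⟨_, m2, 0, rfl, ?_, by omega⟩
  ext l
  simp [sumset]

end Choice

/-! ## Matrix multiplication -/

open Finset

section Entries

variable {ι κ : Type} {R : Type}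

/-- The entries of a matrix. -/
def entrySet (A : Matrix ι κ R) : Set R := Set.range fun x : ι × κ => A x.1 x.2

theorem mem_entrySet (A : Matrix ι κ R) (i : ι) (j : κ) : A i j ∈ entrySet A := ⟨(i, j), rfl⟩

theorem entrySet_subset {A : Matrix ι κ R} {F : Set R} (h : ∀ i j, A i j ∈ F) : entrySet A ⊆ F := by
  rintro _ ⟨x, rfl⟩
  exact h _ _

variable [CommRing R] [Algebra ℚ R]

theorem computes_entrySet [Fintype ι] [Fintype κ] {A : Matrix ι κ R} {F : Set R} {n : ℕ}
    (h : ∀ i j, Computes F n {A i j}) :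
    Computes F (Fintype.card ι * Fintype.card κ * n) (entrySet A) := by
  have := Computes.biUnion_const univ n (fun x : ι × κ => {A x.1 x.2}) fun x _ => h _ _
  rw [card_univ, Fintype.card_prod] at this
  refine this.mono_right ?_
  rintro _ ⟨x, rfl⟩
  simp only [mem_univ, Set.iUnion_true, Set.iUnion_singleton_eq_range, Set.mem_range]
  exact ⟨x, rfl⟩

end Entries

/-- `L` operations suffice to multiply two matrices with index set `ι`. -/
def MulComputes (ι : Type) [Fintype ι] (L : ℕ) : Prop :=
  ∀ (R : Type) [CommRing R] [Algebra ℚ R] (A B : Matrix ι ι R),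
    Computes (entrySet A ∪ entrySet B) L (entrySet (A * B))

theorem MulComputes.naive (ι : Type) [Fintype ι] :
    MulComputes ι (2 * Fintype.card ι ^ 3) := by
  intro R _ _ A B
  have h : ∀ i j, Computes (entrySet A ∪ entrySet B) (Fintype.card ι + Fintype.card ι)
      {(A * B) i j} := by
    intro i j
    have h1 := Computes.biUnion_const univ 1 (F := entrySet A ∪ entrySet B)
      (fun k => {A i k * B k j}) fun k _ =>
        Computes.mul (subset_scalings _ (Or.inl (mem_entrySet A i k)))
          (subset_scalings _ (Or.inr (mem_entrySet B k j)))
    have h2 := Computes.sum (F := ⋃ k ∈ (univ : Finset ι), {A i k * B k j}) univ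
      (fun k => A i k * B k j) fun k _ => subset_scalings _ (by simp)
    rw [card_univ, mul_one] at h1
    rw [card_univ] at h2
    exact h1.trans h2
  exact (computes_entrySet h).mono_cost (le_of_eq (by ring))

/-- Pad the matrices with zeros, which are free. -/
theorem MulComputes.of_injective {ι κ : Type} [Fintype ι] [Fintype κ] {L : ℕ}
    (h : MulComputes κ L) {f : ι → κ} (hf : Function.Injective f) : MulComputes ι L := by
  classical
  intro R _ _ A B
  let ext (M : Matrix ι ι R) : Matrix κ κ R := Matrix.of fun x y =>
    if hxy : (∃ i, f i = x) ∧ ∃ j, f j = y then M hxy.1.choose hxy.2.choose else 0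
  have h1 : ∀ M i j, ext M (f i) (f j) = M i j := by
    intro M i j
    have hx : ∃ i', f i' = f i := ⟨i, rfl⟩
    have hy : ∃ j', f j' = f j := ⟨j, rfl⟩
    simp only [ext, Matrix.of_apply]
    rw [dif_pos ⟨hx, hy⟩]
    congr 1
    · exact hf hx.choose_spec
    · exact hf hy.choose_spec
  have h2 : ∀ M x y, (¬∃ i, f i = x) → ext M x y = 0 := fun M x y hx =>
    dif_neg fun h => hx h.1
  have h3 : ∀ M, entrySet (ext M) ⊆ scalings (entrySet M) := by
    refine fun M => entrySet_subset fun x y => ?_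
    simp only [ext, Matrix.of_apply]
    split_ifs
    · exact subset_scalings _ (mem_entrySet _ _ _)
    · exact zero_mem_scalings _
  refine (h R (ext A) (ext B)).mono (Set.union_subset
    ((h3 A).trans (scalings_mono Set.subset_union_left))
    ((h3 B).trans (scalings_mono Set.subset_union_right))) le_rfl
    (subset_trans (entrySet_subset fun i j => ?_) (subset_scalings _))
  have h4 : (A * B) i j = (ext A * ext B) (f i) (f j) := by
    rw [Matrix.mul_apply, Matrix.mul_apply]
    refine sum_of_injOn f hf.injOn (by simp) (fun x _ hx => ?_) fun k _ => by rw [h1, h1]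
    rw [h2 B x _ (by simpa using hx), mul_zero]
  rw [h4]
  exact mem_entrySet _ _ _

/-! ### Blocks -/

section Rectangular

variable {R : Type} [CommRing R] [Algebra ℚ R]

theorem sum_range_mul {M : Type*} [AddCommMonoid M] (q t : ℕ) (f : ℕ → M) :
    ∑ j ∈ range (q * t), f j = ∑ J ∈ range q, ∑ j ∈ range t, f (J * t + j) := by
  induction q with
  | zero => simp
  | succ q ih => rw [Nat.succ_mul, sum_range_add, ih, sum_range_succ]

/-- Multiplication of a `t × n` and an `n × n` matrix by means of `t × t` blocks. -/
theorem MulComputes.rectangular {t n L : ℕ} (ht : 0 < t) (h : MulComputes (Fin t) L)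
    (A : Matrix (Fin t) (Fin n) R) (B : Matrix (Fin n) (Fin n) R) :
    Computes (entrySet A ∪ entrySet B) ((n / t + 1) ^ 2 * L + t * n * (n / t + 1))
      (entrySet (A * B)) := by
  -- One more block than the integer quotient always covers `n`, whether or not `t` divides it; the
  -- excess is filled with zeros.
  set q := n / t + 1 with hq
  have hqt : n ≤ q * t := by
    have := Nat.div_add_mod n t
    have := Nat.mod_lt n ht
    rw [hq, add_mul, mul_comm]
    omega
  let A' : Fin t → ℕ → R := fun i j => if hj : j < n then A i ⟨j, hj⟩ else 0
  let B' : ℕ → ℕ → R := fun j k => if h : j < n ∧ k < n then B ⟨j, h.1⟩ ⟨k, h.2⟩ else 0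
  let AJ : ℕ → Matrix (Fin t) (Fin t) R := fun J => Matrix.of fun i j => A' i (J * t + j)
  let BJ : ℕ → ℕ → Matrix (Fin t) (Fin t) R := fun J K =>
    Matrix.of fun j k => B' (J * t + j) (K * t + k)
  have hA : ∀ J, entrySet (AJ J) ⊆ scalings (entrySet A ∪ entrySet B) := by
    refine fun J => entrySet_subset fun i j => ?_
    simp only [AJ, A', Matrix.of_apply]
    split_ifs
    · exact subset_scalings _ (Or.inl (mem_entrySet _ _ _))
    · exact zero_mem_scalings _
  have hB : ∀ J K, entrySet (BJ J K) ⊆ scalings (entrySet A ∪ entrySet B) := by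
    refine fun J K => entrySet_subset fun i j => ?_
    simp only [BJ, B', Matrix.of_apply]
    split_ifs
    · exact subset_scalings _ (Or.inr (mem_entrySet _ _ _))
    · exact zero_mem_scalings _
  have h1 := Computes.biUnion_const (range q ×ˢ range q) L (F := entrySet A ∪ entrySet B)
    (fun x => entrySet (AJ x.1 * BJ x.1 x.2)) fun x _ =>
      (h R (AJ x.1) (BJ x.1 x.2)).mono (Set.union_subset (hA _) (hB _ _)) le_rfl (subset_scalings _)
  rw [card_product, card_range, ← sq] at h1
  have h2 : ∀ i k, Computes (⋃ x ∈ range q ×ˢ range q, entrySet (AJ x.1 * BJ x.1 x.2)) q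
      {(A * B) i k} := by
    intro i k
    have hk : (k : ℕ) / t < q := by
      rw [hq]
      exact Nat.lt_succ_of_le (Nat.div_le_div_right k.isLt.le)
    have h3 : (A * B) i k = ∑ J ∈ range q,
        (AJ J * BJ J (k / t)) i ⟨k % t, Nat.mod_lt _ ht⟩ := by
      have h4 : ∀ J, (AJ J * BJ J (k / t)) i ⟨k % t, Nat.mod_lt _ ht⟩
          = ∑ j ∈ range t, A' i (J * t + j) * B' (J * t + j) k := by
        intro J
        rw [Matrix.mul_apply, sum_range]
        simp only [AJ, BJ, Matrix.of_apply, Nat.div_add_mod']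
      simp only [h4]
      rw [← sum_range_mul q t fun j => A' i j * B' j k, Matrix.mul_apply,
        ← sum_subset (range_mono hqt), sum_range]
      · exact sum_congr rfl fun j _ => by simp [A', B']
      · intro j _ hj
        simp [A', mt mem_range.2 hj]
    rw [h3]
    have := Computes.sum (F := ⋃ x ∈ range q ×ˢ range q, entrySet (AJ x.1 * BJ x.1 x.2)) (range q)
      (fun J => (AJ J * BJ J (k / t)) i ⟨k % t, Nat.mod_lt _ ht⟩) fun J hJ => subset_scalings _ ?_
    · rwa [card_range] at this
    · simp only [Set.mem_iUnion]
      exact ⟨(J, k / t), mem_product.2 ⟨hJ, mem_range.2 hk⟩, mem_entrySet _ _ _⟩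
  have h5 := h1.trans (computes_entrySet h2)
  simpa using h5

end Rectangular

/-! ### Bilinear algorithms -/

/-- A bilinear algorithm with `r` products for `n × n` matrices. -/
def IsBilinearAlgorithm {n r : ℕ} (α γ W : Fin r → Fin n × Fin n → ℚ) : Prop :=
  ∀ x y z : Fin n × Fin n, ∑ s, W s z * (α s x * γ s y)
    = if z.1 = x.1 ∧ x.2 = y.1 ∧ y.2 = z.2 then 1 else 0

/-- A bilinear algorithm never commutes factors from the two sides, so its variables may be replaced
by matrix blocks. The `r` block products cost `L` each; the linear combinations of left blocks, of
right blocks and of products account for the factor 3. -/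
theorem IsBilinearAlgorithm.mulComputes {n r : ℕ} {α γ W : Fin r → Fin n × Fin n → ℚ}
    (hW : IsBilinearAlgorithm α γ W) {ι : Type} [Fintype ι] {L : ℕ} (h : MulComputes ι L) :
    MulComputes (Fin n × ι) (r * L + 3 * (r * n ^ 2) * Fintype.card ι ^ 2) := by
  classical
  intro R _ _ A B
  let blk (M : Matrix (Fin n × ι) (Fin n × ι) R) (x : Fin n × Fin n) : Matrix ι ι R :=
    Matrix.of fun i j => M (x.1, i) (x.2, j)
  let comb (α : Fin r → Fin n × Fin n → ℚ) (M : Matrix (Fin n × ι) (Fin n × ι) R) (s : Fin r) :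
    Matrix ι ι R := ∑ x, α s x • blk M x
  have hcomb : ∀ α M, Computes (entrySet M) (r * (Fintype.card ι * Fintype.card ι * (n * n)))
      (⋃ s ∈ (univ : Finset (Fin r)), entrySet (comb α M s)) := by
    intro α M
    have := Computes.biUnion_const (univ : Finset (Fin r)) _ (F := entrySet M)
      (fun s => entrySet (comb α M s)) fun s _ => computes_entrySet fun i j => by
        have := Computes.sum (F := entrySet M) univ
          (fun x : Fin n × Fin n => α s x • M (x.1, i) (x.2, j)) fun x _ =>
            smul_mem_scalings _ (subset_scalings _ (mem_entrySet _ _ _))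
        rw [card_univ, Fintype.card_prod, Fintype.card_fin] at this
        have e : comb α M s i j = ∑ x, α s x • M (x.1, i) (x.2, j) := by
          simp only [comb, Matrix.sum_apply, Matrix.smul_apply, blk, Matrix.of_apply]
        rwa [e]
    rwa [card_univ, Fintype.card_fin] at this
  have h1 := ((hcomb α A).mono_left (F' := entrySet A ∪ entrySet B) Set.subset_union_left).union
    ((hcomb γ B).mono_left (F' := entrySet A ∪ entrySet B) Set.subset_union_right)
  have h2 := Computes.biUnion_const (univ : Finset (Fin r)) L
    (F := (⋃ s ∈ (univ : Finset (Fin r)), entrySet (comb α A s)) ∪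
      (⋃ s ∈ (univ : Finset (Fin r)), entrySet (comb γ B s)))
    (fun s => entrySet (comb α A s * comb γ B s)) fun s _ =>
      (h R (comb α A s) (comb γ B s)).mono_left (Set.union_subset_union
        (Set.subset_biUnion_of_mem (u := fun s => entrySet (comb α A s)) (mem_coe.2 (mem_univ s)))
        (Set.subset_biUnion_of_mem (u := fun s => entrySet (comb γ B s)) (mem_coe.2 (mem_univ s))))
  rw [card_univ, Fintype.card_fin] at h2
  have h3 : ∀ z, blk (A * B) z = ∑ s, W s z • (comb α A s * comb γ B s) := by
    intro z
    calc blk (A * B) z = ∑ l, blk A (z.1, l) * blk B (l, z.2) := by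
          ext i j
          simp only [blk, Matrix.sum_apply, Matrix.mul_apply, Matrix.of_apply,
            Fintype.sum_prod_type]
      _ = ∑ x : Fin n × Fin n, ∑ y : Fin n × Fin n,
          (if z.1 = x.1 ∧ x.2 = y.1 ∧ y.2 = z.2 then (1 : ℚ) else 0) • (blk A x * blk B y) := by
          simp only [Fintype.sum_prod_type, ite_smul, one_smul, zero_smul, ite_and, sum_ite_eq,
            sum_ite_eq', sum_const_zero, mem_univ, if_true, sum_ite_irrel]
      _ = _ := by
          simp only [← hW _ _ z, sum_smul]
          refine ((sum_congr rfl fun x _ => sum_comm).trans sum_comm).trans ?_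
          refine sum_congr rfl fun s _ => ?_
          simp only [comb, sum_mul_sum, smul_sum, smul_mul_smul_comm, smul_smul]
  have h4 : Computes (⋃ s ∈ (univ : Finset (Fin r)), entrySet (comb α A s * comb γ B s))
      (Fintype.card (Fin n × ι) * Fintype.card (Fin n × ι) * r) (entrySet (A * B)) := by
    refine computes_entrySet fun i j => ?_
    have e : (A * B) i j
        = ∑ s, W s (i.1, j.1) • (comb α A s * comb γ B s) i.2 j.2 := by
      have := congrFun (congrFun (h3 (i.1, j.1)) i.2) j.2
      simpa [Matrix.sum_apply, blk] using this
    rw [e]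
    have := Computes.sum (F := ⋃ s ∈ (univ : Finset (Fin r)), entrySet (comb α A s * comb γ B s))
      univ (fun s => W s (i.1, j.1) • (comb α A s * comb γ B s) i.2 j.2) fun s _ =>
        smul_mem_scalings _ (subset_scalings _ (Set.mem_biUnion (mem_coe.2 (mem_univ s))
          (mem_entrySet _ _ _)))
    rwa [card_univ, Fintype.card_fin] at this
  refine ((h1.trans h2).trans h4).mono_cost (le_of_eq ?_)
  rw [Fintype.card_prod, Fintype.card_fin]
  ring

/-- Recursive application of a bilinear algorithm. -/
theorem IsBilinearAlgorithm.exists_mulComputes {n r Q : ℕ} {α γ W : Fin r → Fin n × Fin n → ℚ}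
    (hW : IsBilinearAlgorithm α γ W) (hr : r ≤ Q) (hn : n ^ 2 + 1 ≤ Q) (k : ℕ) :
    ∃ (ι : Type) (_ : Fintype ι) (T : ℕ), Fintype.card ι = n ^ k ∧ MulComputes ι T ∧
      T + 3 * (r * n ^ 2) * (n ^ k) ^ 2 ≤ (1 + 3 * (r * n ^ 2)) * Q ^ k := by
  induction k with
  | zero =>
    refine ⟨Unit, inferInstance, 1, by simp, fun R _ _ A B => ?_, by simp⟩
    have := computes_entrySet (A := A * B) (F := entrySet A ∪ entrySet B) fun i j => by
      have := Computes.mul (F := entrySet A ∪ entrySet B)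
        (subset_scalings _ (Or.inl (mem_entrySet A i j)))
        (subset_scalings _ (Or.inr (mem_entrySet B i j)))
      have e : (A * B) i j = A i j * B i j := by simp [Matrix.mul_apply]
      rwa [← e] at this
    simpa using this
  | succ k ih =>
    obtain ⟨ι, _, T, hι, hT, hTk⟩ := ih
    refine ⟨Fin n × ι, inferInstance, _, ?_, hW.mulComputes hT, ?_⟩
    · rw [Fintype.card_prod, Fintype.card_fin, hι, pow_succ']
    · rw [hι]
      set d := 3 * (r * n ^ 2)
      -- The extra term `d * n ^ (2 * k)` in the induction hypothesis pays for the additions: after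
      -- one step it appears `n ^ 2 + 1 ≤ Q` times.
      calc r * T + d * (n ^ k) ^ 2 + d * (n ^ (k + 1)) ^ 2
          = r * T + (n ^ 2 + 1) * (d * (n ^ k) ^ 2) := by ring
        _ ≤ Q * T + Q * (d * (n ^ k) ^ 2) := by gcongr
        _ = Q * (T + d * (n ^ k) ^ 2) := by ring
        _ ≤ Q * ((1 + d) * Q ^ k) := by gcongr
        _ = _ := by ring

/-! ### Straight-line programs as computations with indeterminates -/

/-- Without tests and divisions the run at one point `x0` already fixes the instructions executed at
all points, so they can be carried out once in `R`. -/
theorem Prog.IsStraightLine.exists_symbolic {α : Type} {R Ω : Type} [CommRing R] [Algebra ℚ R]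
    (e : Ω → R →ₐ[ℚ] ℚ) (x0 : Ω) {P : Prog α} (hP : P.IsStraightLine) (M : List R) {a : α}
    {m' : List ℚ} {n : ℕ} (h : P.run (M.map (e x0)) = some (a, m', n)) :
    ∃ M' : List R, (∀ x, P.run (M.map (e x)) = some (a, M'.map (e x), n)) ∧
      Computes {z | z ∈ M} n {z | z ∈ M'} := by
  have snoc : ∀ (M : List R) (z : R) (M' : List R) (n : ℕ),
      Computes {z | z ∈ M} 1 {z} → Computes {y | y ∈ M ++ [z]} n {y | y ∈ M'} →
      Computes {z | z ∈ M} (n + 1) {y | y ∈ M'} := by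
    intro M z M' n h1 h2
    refine (h1.trans' (h2.mono_left ?_)).mono_cost (by omega)
    intro y hy
    simpa [or_comm] using hy
  induction P generalizing M n with
  | ret b =>
    simp only [run, Option.some_inj, Prod.mk.injEq] at h
    obtain ⟨rfl, -, rfl⟩ := h
    exact ⟨M, fun x => rfl, Computes.of_subset (subset_scalings _)⟩
  | const c k ih =>
    simp only [run, Option.map_eq_some_iff] at h
    obtain ⟨⟨a1, m1, n1⟩, h1, h2⟩ := h
    simp only [Prod.mk.injEq] at h2
    obtain ⟨rfl, rfl, rfl⟩ := h2
    have hM : ∀ x, M.map (e x) ++ [c] = (M ++ [algebraMap ℚ R c]).map (e x) := fun x => by simp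
    rw [hM] at h1
    obtain ⟨M', h3, h4⟩ := ih _ (hP _) (M ++ [algebraMap ℚ R c]) h1
    refine ⟨M', fun x => ?_, snoc M _ M' n1 ?_ h4⟩
    · simp only [List.length_map] at h3
      simp only [run, List.length_map, hM, h3, Option.map_some]
    · exact (Computes.of_subset (Set.singleton_subset_iff.2 (algebraMap_mem_scalings _ c))
        ).mono_cost (Nat.zero_le 1)
  | arith o i j k ih =>
    simp only [run, Option.map_eq_some_iff, Option.bind_eq_some_iff, List.getElem?_map] at h
    obtain ⟨_, ⟨u, hu, rfl⟩, _, ⟨v, hv, rfl⟩, z, hz, ⟨a1, m1, n1⟩, h1, h2⟩ := h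
    simp only [Prod.mk.injEq] at h2
    obtain ⟨rfl, rfl, rfl⟩ := h2
    have hu' := subset_scalings {z | z ∈ M} (List.mem_of_getElem? hu)
    have hv' := subset_scalings {z | z ∈ M} (List.mem_of_getElem? hv)
    obtain ⟨w, hw, hwM⟩ : ∃ w : R, (∀ x, o.eval (e x u) (e x v) = some (e x w)) ∧
        Computes {z | z ∈ M} 1 {w} := by
      cases o with
      | add => exact ⟨u + v, fun x => by simp [ArithOp.eval], .add hu' hv'⟩
      | sub =>
        refine ⟨u + -v, fun x => ?_, .add hu' (neg_mem_scalings hv')⟩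
        simp [ArithOp.eval, sub_eq_add_neg]
      | mul => exact ⟨u * v, fun x => by simp [ArithOp.eval], .mul hu' hv'⟩
      | div => exact absurd rfl hP.1
    have hM : ∀ x, M.map (e x) ++ [e x w] = (M ++ [w]).map (e x) := fun x => by simp
    rw [hw, Option.some_inj] at hz
    subst hz
    rw [hM] at h1
    obtain ⟨M', h3, h4⟩ := ih _ (hP.2 _) (M ++ [w]) h1
    refine ⟨M', fun x => ?_, snoc M _ M' n1 hwM h4⟩
    simp only [List.length_map] at h3
    simp only [run, List.length_map, List.getElem?_map, hu, hv, hw, hM, h3, Option.map_some,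
      Option.bind_some]
  | isZero i k ih => exact hP.elim

theorem Prog.run_length_le {α : Type} {P : Prog α} {m m' : List ℚ} {a : α} {n : ℕ}
    (h : P.run m = some (a, m', n)) : m'.length ≤ m.length + n := by
  induction P generalizing m n with
  | ret b =>
    simp only [run, Option.some_inj, Prod.mk.injEq] at h
    rw [h.2.1]
    omega
  | const c k ih =>
    simp only [run, Option.map_eq_some_iff] at h
    obtain ⟨⟨_, _, _⟩, h1, h2⟩ := h
    simp only [Prod.mk.injEq] at h2
    obtain ⟨rfl, rfl, rfl⟩ := h2
    have := ih _ h1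
    rw [List.length_append, List.length_singleton] at this
    omega
  | arith o i j k ih =>
    simp only [run, Option.map_eq_some_iff, Option.bind_eq_some_iff] at h
    obtain ⟨_, _, _, _, _, _, ⟨_, _, _⟩, h1, h2⟩ := h
    simp only [Prod.mk.injEq] at h2
    obtain ⟨rfl, rfl, rfl⟩ := h2
    have := ih _ h1
    rw [List.length_append, List.length_singleton] at this
    omega
  | isZero i k ih =>
    simp only [run, Option.map_eq_some_iff, Option.bind_eq_some_iff] at h
    obtain ⟨_, _, ⟨_, _, _⟩, h1, h2⟩ := h
    simp only [Prod.mk.injEq] at h2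
    obtain ⟨rfl, rfl, rfl⟩ := h2
    have := ih _ h1
    omega

/-- The pairs of a matrix and a place in it. -/
abbrev Var (n : ℕ) : Type := (Fin n × Fin n) ⊕ (Fin n × Fin n)

/-- A list with the values of a function on the indeterminates. -/
noncomputable def varList {n : ℕ} {S : Type*} (f : Var n → S) : List S :=
  List.ofFn (f ∘ (Fintype.equivFin (Var n)).symm)

/-- The place of an indeterminate in such a list. -/
noncomputable def varAddr {n : ℕ} (x : Var n) : ℕ := Fintype.equivFin (Var n) x

theorem getElem?_varAddr {n : ℕ} {S : Type*} (f : Var n → S) (x : Var n) :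
    (varList f)[varAddr x]? = some (f x) := by
  rw [varList, varAddr, List.getElem?_ofFn, dif_pos (Fin.isLt _)]
  simp

theorem mem_varList {n : ℕ} {S : Type*} {f : Var n → S} {y : S} :
    y ∈ varList f ↔ ∃ x, f x = y := by
  simp only [varList, List.mem_ofFn, Function.comp_apply]
  exact ((Fintype.equivFin (Var n)).symm.surjective.exists (p := fun x => f x = y)).symm

theorem map_varList {n : ℕ} {S T : Type*} (f : Var n → S) (g : S → T) :
    (varList f).map g = varList (g ∘ f) := by
  simp [varList, Function.comp_def]

/-- `P` multiplies matrices with at most `L` operations, wherever they are stored. -/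
def MultipliesWithin {n : ℕ} (P : Addr n n → Addr n n → Prog (Addr n n)) (L : ℕ) : Prop :=
  ∀ (A B : Matrix (Fin n) (Fin n) ℚ) (m : List ℚ) (a b : Addr n n),
    StoresMatrix m a A → StoresMatrix m b B →
      (P a b).Yields m fun out m' cost => StoresMatrix m' out (A * B) ∧ cost ≤ L

theorem MultipliesWithin.yields {n L : ℕ} {P : Addr n n → Addr n n → Prog (Addr n n)}
    (h : MultipliesWithin P L) (x : Var n → ℚ) :
    (P (fun i j => varAddr (.inl (i, j))) fun i j => varAddr (.inr (i, j))).Yields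
      (varList x) fun out m' cost => StoresMatrix m' out
        ((Matrix.of fun i j => x (.inl (i, j))) * Matrix.of fun i j => x (.inr (i, j))) ∧
        cost ≤ L :=
  h _ _ _ _ _ (fun _ _ => getElem?_varAddr x _) (fun _ _ => getElem?_varAddr x _)

-- Run the program on generic matrices. Polynomials over `ℚ` with the same values everywhere are
-- equal, so its outputs are the entries of the generic product, which then specialise to any `R`.
open MvPolynomial in
theorem MultipliesWithin.mulComputes {n L : ℕ} {P : Addr n n → Addr n n → Prog (Addr n n)}
    (hP : ∀ a b, (P a b).IsStraightLine) (h : MultipliesWithin P L) :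
    MulComputes (Fin n) L := by
  intro R _ _ A B
  let e : (Var n → ℚ) → MvPolynomial (Var n) ℚ →ₐ[ℚ] ℚ := fun x => aeval x
  let M : List (MvPolynomial (Var n) ℚ) := varList X
  have hM : ∀ x, M.map (e x) = varList x := by
    intro x
    rw [map_varList]
    congr 1
    ext y
    simp [e]
  obtain ⟨out, m', N, h1, h2, h3⟩ := h.yields 0
  rw [← hM] at h1
  obtain ⟨M', h4, h5⟩ := (hP _ _).exists_symbolic e 0 M h1
  let A' : Matrix (Fin n) (Fin n) (MvPolynomial (Var n) ℚ) := Matrix.of fun i j => X (.inl (i, j))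
  let B' : Matrix (Fin n) (Fin n) (MvPolynomial (Var n) ℚ) := Matrix.of fun i j => X (.inr (i, j))
  have h6 : entrySet (A' * B') ⊆ {z | z ∈ M'} := by
    refine entrySet_subset fun i j => ?_
    have key : ∀ x, (M'.map (e x))[out i j]? = some (e x ((A' * B') i j)) := by
      intro x
      obtain ⟨out', m'', N', h7, h8, -⟩ := h.yields x
      rw [← hM, h4, Option.some_inj, Prod.mk.injEq, Prod.mk.injEq] at h7
      obtain ⟨rfl, rfl, -⟩ := h7
      rw [h8 i j]
      simp [Matrix.mul_apply, A', B', e]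
    have h0 := key 0
    rw [List.getElem?_map, Option.map_eq_some_iff] at h0
    obtain ⟨q, hq, -⟩ := h0
    have : q = (A' * B') i j := by
      refine MvPolynomial.funext fun x => ?_
      have := key x
      rw [List.getElem?_map, hq, Option.map_some, Option.some_inj] at this
      rwa [← coe_aeval_eq_eval]
    rw [← this]
    exact List.mem_of_getElem? hq
  let φ : MvPolynomial (Var n) ℚ →ₐ[ℚ] R := aeval (Sum.elim (fun x => A x.1 x.2) fun x => B x.1 x.2)
  refine ((h5.map φ).mono_cost h3).mono ?_ le_rfl (subset_trans ?_ (subset_scalings _))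
  · refine subset_trans ?_ (subset_scalings _)
    rintro _ ⟨y, hy, rfl⟩
    obtain ⟨x, rfl⟩ := mem_varList.1 hy
    rcases x with x | x
    · exact Or.inl ⟨x, by simp [φ]⟩
    · exact Or.inr ⟨x, by simp [φ]⟩
  · refine entrySet_subset fun i j => ⟨_, h6 (mem_entrySet _ i j), ?_⟩
    simp [Matrix.mul_apply, A', B', φ]

/-- Applied to the schoolbook method, this shows that the infimum `matMulCost` is attained and at
most cubic. -/
theorem MulComputes.exists_multipliesWithin {n L : ℕ} (h : MulComputes (Fin n) L) :
    ∃ P : Addr n n → Addr n n → Prog (Addr n n), (∀ a b, (P a b).IsStraightLine) ∧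
      MultipliesWithin P (5 * (L + n * n)) := by
  let A' : Matrix (Fin n) (Fin n) ((Var n → ℚ) → ℚ) := Matrix.of fun i j ξ => ξ (.inl (i, j))
  let B' : Matrix (Fin n) (Fin n) ((Var n → ℚ) → ℚ) := Matrix.of fun i j ξ => ξ (.inr (i, j))
  have h1 : Computes (Set.range fun (x : Var n) (ξ : Var n → ℚ) => ξ x) L
      (Set.range fun x : Fin n × Fin n => (A' * B') x.1 x.2) := by
    refine (h _ A' B').mono_left (Set.union_subset ?_ ?_)
    · exact entrySet_subset fun i j => ⟨.inl (i, j), rfl⟩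
    · exact entrySet_subset fun i j => ⟨.inr (i, j), rfl⟩
  obtain ⟨P, hP⟩ := h1.compile
  refine ⟨fun a b => (P (Sum.elim (fun x => a x.1 x.2) fun x => b x.1 x.2)).bind fun out =>
    .ret fun i j => out (i, j), fun a b => (hP _).1.bind fun _ => trivial,
    fun A B m a b ha hb => ?_⟩
  refine Prog.Yields.bind (((hP _).2 m (Sum.elim (fun x => A x.1 x.2) fun x => B x.1 x.2) ?_).mono
    ?_)
  · rintro (x | x)
    · exact ha _ _
    · exact hb _ _
  · rintro out m' k ⟨hout, hk⟩
    refine ⟨_, m', 0, rfl, fun i j => ?_, by simpa using hk⟩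
    rw [hout (i, j)]
    simp [Matrix.mul_apply, A', B', Finset.sum_apply]

theorem MultipliesWithin.sq_le {n L : ℕ} {P : Addr n n → Addr n n → Prog (Addr n n)}
    (h : MultipliesWithin P L) : n * n ≤ L := by
  classical
  -- The matrices are `-1` and one with distinct entries at least 2. The product has `n ^ 2`
  -- distinct entries, all at most `-2` and hence absent from the input, so each occupies a new
  -- register.
  let x : Var n → ℚ := Sum.elim (fun y => if y.1 = y.2 then -1 else 0)
    fun y => (finProdFinEquiv y : ℕ) + 2
  obtain ⟨out, m', N, h1, h2, h3⟩ := h.yields x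
  have hAB : ∀ i j, m'[out i j]? = some (-((finProdFinEquiv (i, j) : ℕ) + 2 : ℚ)) := by
    intro i j
    rw [h2 i j]
    have : (Matrix.of fun i j => x (.inl (i, j))) = -(1 : Matrix (Fin n) (Fin n) ℚ) := by
      ext i j
      simp only [x, Sum.elim_inl, Matrix.of_apply, Matrix.neg_apply, Matrix.one_apply]
      split_ifs <;> simp
    rw [this, neg_mul, one_mul]
    rfl
  have hlen := Prog.run_length_le h1
  have hpre := Prog.run_prefix h1
  have hmem : ∀ y : Fin n × Fin n,
      out y.1 y.2 ∈ Ico (varList x).length m'.length := by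
    intro y
    have h4 := hAB y.1 y.2
    refine mem_Ico.2 ⟨?_, (List.getElem?_eq_some_iff.1 h4).1⟩
    by_contra! hlt
    have h5 := getElem?_of_prefix hpre (List.getElem?_eq_getElem hlt)
    rw [h4, Option.some_inj] at h5
    have h6 : (varList x)[out y.1 y.2] ∈ varList x := List.getElem_mem _
    rw [← h5, mem_varList] at h6
    obtain ⟨z, hz⟩ := h6
    have h7 : (0 : ℚ) ≤ (finProdFinEquiv (y.1, y.2) : ℕ) := Nat.cast_nonneg _
    rcases z with z | z
    · simp only [x, Sum.elim_inl] at hz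
      split_ifs at hz <;> linarith
    · have h8 : (0 : ℚ) ≤ (finProdFinEquiv z : ℕ) := Nat.cast_nonneg _
      simp only [x, Sum.elim_inr] at hz
      linarith
  have hinj : Set.InjOn (fun y : Fin n × Fin n => out y.1 y.2) (univ : Finset (Fin n × Fin n)) := by
    intro y _ z _ hyz
    have h4 := hAB y.1 y.2
    have h5 := hAB z.1 z.2
    simp only at hyz
    rw [hyz, h5, Option.some_inj] at h4
    have h6 : ((finProdFinEquiv z : ℕ) : ℚ) = (finProdFinEquiv y : ℕ) := by linarith
    exact (finProdFinEquiv.injective (Fin.ext (by exact_mod_cast h6))).symm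
  have := card_le_card_of_injOn _ (fun y _ => mem_coe.2 (hmem y)) hinj
  rw [card_univ, Fintype.card_prod, Fintype.card_fin, Nat.card_Ico] at this
  omega

theorem exists_matMulCost (n : ℕ) : ∃ P : Addr n n → Addr n n → Prog (Addr n n),
    (∀ a b, (P a b).IsStraightLine) ∧ MultipliesWithin P (matMulCost n) := by
  obtain ⟨P, hP, hL⟩ := (MulComputes.naive (Fin n)).exists_multipliesWithin
  exact Nat.sInf_mem (s := {L : ℕ | ∃ P : Addr n n → Addr n n → Prog (Addr n n),
    (∀ a b, (P a b).IsStraightLine) ∧ MultipliesWithin P L}) ⟨_, P, hP, hL⟩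

theorem mulComputes_matMulCost (n : ℕ) : MulComputes (Fin n) (matMulCost n) := by
  obtain ⟨P, hP, hL⟩ := exists_matMulCost n
  exact hL.mulComputes hP

theorem sq_le_matMulCost (n : ℕ) : n * n ≤ matMulCost n := by
  obtain ⟨P, hP, hL⟩ := exists_matMulCost n
  exact hL.sq_le

theorem matMulCost_le (n : ℕ) : matMulCost n ≤ 5 * (2 * n ^ 3 + n * n) := by
  obtain ⟨P, hP, hL⟩ := (MulComputes.naive (Fin n)).exists_multipliesWithin
  rw [Fintype.card_fin] at hL
  exact Nat.sInf_le ⟨P, hP, hL⟩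

/-! ### From straight-line programs to bilinear algorithms -/

section Bilinear

open MvPolynomial

variable {n : ℕ}

/-- The coefficients of the products of an entry of the first and one of the second matrix. -/
noncomputable def bilinearPart (q : MvPolynomial (Var n) ℚ) :
    (Fin n × Fin n) × (Fin n × Fin n) → ℚ :=
  fun x => constantCoeff (pderiv (.inl x.1) (pderiv (.inr x.2) q))

/-- The linear part, as a function of the entries of the first or the second matrix. -/
noncomputable def linearPart (q : MvPolynomial (Var n) ℚ) (x : Var n) : ℚ :=
  constantCoeff (pderiv x q)

/-- The product of two linear forms, one in each matrix. -/
def outer (q : (Fin n × Fin n → ℚ) × (Fin n × Fin n → ℚ)) :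
    (Fin n × Fin n) × (Fin n × Fin n) → ℚ := fun x => q.1 x.1 * q.2 x.2

theorem bilinearPart_add (f g : MvPolynomial (Var n) ℚ) :
    bilinearPart (f + g) = bilinearPart f + bilinearPart g := by
  ext x; simp [bilinearPart]

theorem bilinearPart_smul (s : ℚ) (f : MvPolynomial (Var n) ℚ) :
    bilinearPart (s • f) = s • bilinearPart f := by
  ext x; simp [bilinearPart, smul_eq_C_mul]

/-- Leibniz at the origin: the constant terms only rescale old bilinear parts, and the linear parts
contribute two new products. -/
theorem bilinearPart_mul (f g : MvPolynomial (Var n) ℚ) :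
    bilinearPart (f * g) = constantCoeff f • bilinearPart g + constantCoeff g • bilinearPart f
      + outer (fun x => linearPart f (.inl x), fun x => linearPart g (.inr x))
      + outer (fun x => linearPart g (.inl x), fun x => linearPart f (.inr x)) := by
  ext x
  simp only [bilinearPart, linearPart, outer, Derivation.leibniz, map_add, smul_eq_mul, map_mul,
    Pi.add_apply, Pi.smul_apply]
  ring

theorem bilinearPart_mem_of_scalings {H : Set (MvPolynomial (Var n) ℚ)}
    {V : Submodule ℚ ((Fin n × Fin n) × (Fin n × Fin n) → ℚ)} (hV : ∀ q ∈ H, bilinearPart q ∈ V)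
    {q : MvPolynomial (Var n) ℚ} (hq : q ∈ scalings H) : bilinearPart q ∈ V := by
  obtain ⟨s, x, hx | rfl, rfl⟩ := hq
  · rw [bilinearPart_smul]
    exact V.smul_mem _ (hV x hx)
  · have : bilinearPart (s • (1 : MvPolynomial (Var n) ℚ)) = 0 := by
      ext x; simp [bilinearPart]
    rw [this]
    exact V.zero_mem

theorem Steps.exists_bilinear {F H : Set (MvPolynomial (Var n) ℚ)} {k : ℕ} (h : Steps F k H)
    (hF : ∀ q ∈ F, bilinearPart q = 0) :
    ∃ l : List ((Fin n × Fin n → ℚ) × (Fin n × Fin n → ℚ)), l.length = 2 * k ∧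
      ∀ q ∈ H, bilinearPart q ∈ Submodule.span ℚ (Set.range fun s => outer (l.get s)) := by
  have hget : ∀ l : List ((Fin n × Fin n → ℚ) × (Fin n × Fin n → ℚ)),
      (Set.range fun s => outer (l.get s)) = outer '' {q | q ∈ l} := by
    intro l
    rw [← Set.range_list_get, ← Set.range_comp]
    rfl
  simp only [hget]
  induction h with
  | nil => exact ⟨[], rfl, fun q hq => by rw [hF q hq]; exact zero_mem _⟩
  | @add k H f g _ hf hg ih =>
    obtain ⟨l, hl, hH⟩ := ih
    -- A sum needs no new product; the zero pairs only keep the length at exactly twice the number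
    -- of steps.
    refine ⟨(0, 0) :: (0, 0) :: l, by simp [hl]; ring, fun q hq => ?_⟩
    refine Submodule.span_mono (Set.image_mono
      (show {q | q ∈ l} ⊆ _ from fun q hq => List.mem_cons_of_mem _ (List.mem_cons_of_mem _ hq))) ?_
    rcases hq with rfl | hq
    · rw [bilinearPart_add]
      exact add_mem (bilinearPart_mem_of_scalings hH hf) (bilinearPart_mem_of_scalings hH hg)
    · exact hH q hq
  | @mul k H f g _ hf hg ih =>
    obtain ⟨l, hl, hH⟩ := ih
    refine ⟨(fun x => linearPart f (.inl x), fun x => linearPart g (.inr x)) ::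
      (fun x => linearPart g (.inl x), fun x => linearPart f (.inr x)) :: l,
      by simp [hl]; ring, fun q hq => ?_⟩
    set l' := (fun x => linearPart f (.inl x), fun x => linearPart g (.inr x)) ::
      (fun x => linearPart g (.inl x), fun x => linearPart f (.inr x)) :: l with hl'
    have hsub : Submodule.span ℚ (outer '' {q | q ∈ l})
        ≤ Submodule.span ℚ (outer '' {q | q ∈ l'}) := Submodule.span_mono (Set.image_mono
      fun q hq => List.mem_cons_of_mem _ (List.mem_cons_of_mem _ hq))
    rcases hq with rfl | hq
    · rw [bilinearPart_mul]
      refine add_mem (add_mem (add_mem ?_ ?_) ?_) ?_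
      · exact Submodule.smul_mem _ _ (hsub (bilinearPart_mem_of_scalings hH hg))
      · exact Submodule.smul_mem _ _ (hsub (bilinearPart_mem_of_scalings hH hf))
      · exact Submodule.subset_span ⟨_, List.mem_cons_self, rfl⟩
      · exact Submodule.subset_span ⟨_, List.mem_cons_of_mem _ List.mem_cons_self, rfl⟩
    · exact hsub (hH q hq)

/-- Strassen's theorem on avoiding products which are not bilinear. -/
theorem MulComputes.exists_isBilinearAlgorithm {L : ℕ} (h : MulComputes (Fin n) L) :
    ∃ r ≤ 2 * L, ∃ α γ W : Fin r → Fin n × Fin n → ℚ, IsBilinearAlgorithm α γ W := by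
  let A : Matrix (Fin n) (Fin n) (MvPolynomial (Var n) ℚ) := Matrix.of fun i j => X (.inl (i, j))
  let B : Matrix (Fin n) (Fin n) (MvPolynomial (Var n) ℚ) := Matrix.of fun i j => X (.inr (i, j))
  obtain ⟨k, H, hk, hH, hAB⟩ := h _ A B
  have hX : ∀ y, bilinearPart (X y : MvPolynomial (Var n) ℚ) = 0 := by
    intro y
    ext x
    simp only [bilinearPart, pderiv_X]
    by_cases hy : (Sum.inr x.2 : Var n) = y
    · subst hy; simp
    · simp [hy]
  obtain ⟨l, hl, hspan⟩ := hH.exists_bilinear fun q hq => by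
    rcases hq with ⟨y, rfl⟩ | ⟨y, rfl⟩
    · exact hX _
    · exact hX _
  have hz : ∀ z : Fin n × Fin n, ∃ w : Fin l.length → ℚ,
      ∑ s, w s • outer (l.get s) = bilinearPart ((A * B) z.1 z.2) := fun z =>
    (Submodule.mem_span_range_iff_exists_fun ℚ).1
      (bilinearPart_mem_of_scalings hspan (hAB (mem_entrySet _ _ _)))
  choose w hw using hz
  refine ⟨l.length, by omega, fun s => (l.get s).1, fun s => (l.get s).2, fun s z => w z s,
    fun x y z => ?_⟩
  have h1 := congrFun (hw z) (x, y)
  rw [Finset.sum_apply] at h1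
  simp only [Pi.smul_apply, outer, smul_eq_mul] at h1
  rw [h1]
  simp only [bilinearPart, Matrix.mul_apply, A, B, Matrix.of_apply, map_sum, Derivation.leibniz,
    pderiv_X, smul_eq_mul, map_add, map_mul, Pi.single_apply]
  simp only [constantCoeff_X, zero_mul, zero_add, reduceCtorEq, if_false, map_zero, add_zero,
    mul_zero, Sum.inr.injEq, Sum.inl.injEq, apply_ite (constantCoeff (σ := Var n) (R := ℚ)),
    map_one]
  rw [sum_eq_single_of_mem y.1 (mem_univ _)]
  · simp only [Prod.ext_iff]
    grind
  · intro k _ hk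
    rw [if_neg fun h => hk (congrArg Prod.fst h), zero_mul]

end Bilinear

/-! ### The exponent of matrix multiplication -/

theorem two_le_logb_matMulCost {n : ℕ} (hn : 2 ≤ n) : 2 ≤ Real.logb n (matMulCost n) := by
  have h1 : (1 : ℝ) < n := by exact_mod_cast hn
  have h2 : ((n * n : ℕ) : ℝ) ≤ matMulCost n := by exact_mod_cast sq_le_matMulCost n
  have h3 : (0 : ℝ) < matMulCost n := lt_of_lt_of_le (by positivity) h2
  rw [Real.le_logb_iff_rpow_le h1 h3, Real.rpow_two, sq]
  exact_mod_cast h2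

/-- A crude upper bound, needed only for the limes inferior of real numbers to behave as one. -/
theorem logb_matMulCost_le {n : ℕ} (hn : 2 ≤ n) : Real.logb n (matMulCost n) ≤ 8 := by
  have h1 : (1 : ℝ) < n := by exact_mod_cast hn
  have h2 : 0 < matMulCost n := lt_of_lt_of_le (by positivity) (sq_le_matMulCost n)
  rw [Real.logb_le_iff_le_rpow h1 (by exact_mod_cast h2)]
  have h3 : matMulCost n ≤ n ^ 8 := by
    refine (matMulCost_le n).trans ?_
    have h4 : n * n ≤ n ^ 3 := by nlinarith [sq_nonneg n]
    have h5 : 2 ^ 5 ≤ n ^ 5 := Nat.pow_le_pow_left hn 5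
    calc 5 * (2 * n ^ 3 + n * n) ≤ 2 ^ 5 * n ^ 3 := by omega
      _ ≤ n ^ 5 * n ^ 3 := Nat.mul_le_mul_right _ h5
      _ = n ^ 8 := by ring
  exact_mod_cast h3

/-- Matrix multiplication with `O(n ^ w)` operations, up to logarithmic factors. -/
def FastMul (w : ℝ) : Prop :=
  ∃ (C : ℝ) (k : ℕ) (L : ℕ → ℕ), 0 ≤ C ∧ ∀ n, MulComputes (Fin n) (L n) ∧
    (1 ≤ n → (L n : ℝ) ≤ C * (n : ℝ) ^ w * (1 + Real.log n) ^ k)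

/-- Round the size `N` up to a power `n ^ k ≤ n * N` and recurse; rounding costs the constant factor
`n ^ w`. -/
theorem fastMul_of_isBilinearAlgorithm {n r : ℕ} (hn : 2 ≤ n) {α γ W : Fin r → Fin n × Fin n → ℚ}
    (hW : IsBilinearAlgorithm α γ W) {w : ℝ} (hw : 0 ≤ w) (hr : (r : ℝ) ≤ (n : ℝ) ^ w)
    (hn2 : (n : ℝ) ^ 2 + 1 ≤ (n : ℝ) ^ w) : FastMul w := by
  set d := 3 * (r * n ^ 2)
  have key : ∀ N : ℕ, ∃ L, MulComputes (Fin N) L ∧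
      (1 ≤ N → (L : ℝ) ≤ ((1 + d) * (n : ℝ) ^ w) * (N : ℝ) ^ w * (1 + Real.log N) ^ 0) := by
    intro N
    rcases Nat.eq_zero_or_pos N with rfl | hN
    · exact ⟨_, MulComputes.naive _, by omega⟩
    set k := Nat.clog n N with hk
    have hk1 : N ≤ n ^ k := Nat.le_pow_clog (by omega) _
    have hk2 : n ^ k ≤ n * N := by
      rcases Nat.eq_zero_or_pos k with h0 | h0
      · rw [h0, pow_zero]
        nlinarith
      · have h1 : 1 < N := by
          by_contra! h
          have : N = 1 := by omega
          rw [hk, this, Nat.clog_one_right] at h0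
          omega
        have h2 := (Nat.pow_pred_clog_lt_self (b := n) (by omega) h1).le
        calc n ^ k = n * n ^ (k - 1) := by rw [← pow_succ']; congr 1; omega
          _ ≤ n * N := Nat.mul_le_mul_left _ h2
    obtain ⟨ι, _, T, hι, hT, hTk⟩ := hW.exists_mulComputes (le_max_left r (n ^ 2 + 1))
      (le_max_right r (n ^ 2 + 1)) k
    set Q := max r (n ^ 2 + 1)
    have hQ : (Q : ℝ) ≤ (n : ℝ) ^ w := by
      rw [Nat.cast_max, max_le_iff]
      exact ⟨hr, by exact_mod_cast hn2⟩
    have hcard : Fintype.card (Fin N) ≤ Fintype.card ι := by rw [hι, Fintype.card_fin]; exact hk1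
    obtain ⟨f⟩ := Function.Embedding.nonempty_of_card_le hcard
    refine ⟨T, hT.of_injective f.injective, fun _ => ?_⟩
    have h1 : (T : ℝ) ≤ (1 + d : ℕ) * (Q : ℝ) ^ k := by
      exact_mod_cast (Nat.le_add_right _ _).trans hTk
    rw [pow_zero, mul_one]
    calc (T : ℝ) ≤ (1 + d : ℕ) * (Q : ℝ) ^ k := h1
      _ ≤ (1 + d : ℕ) * ((n : ℝ) ^ w) ^ k := by gcongr
      _ = (1 + d : ℕ) * ((n ^ k : ℕ) : ℝ) ^ w := by
        rw [← Real.rpow_natCast, ← Real.rpow_mul (Nat.cast_nonneg _), mul_comm w,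
          Real.rpow_mul (Nat.cast_nonneg _), Real.rpow_natCast, Nat.cast_pow]
      _ ≤ (1 + d : ℕ) * ((n * N : ℕ) : ℝ) ^ w := by gcongr
      _ = _ := by
        rw [Nat.cast_mul, Real.mul_rpow (Nat.cast_nonneg _) (Nat.cast_nonneg _)]
        push_cast
        ring
  choose L hL using key
  exact ⟨_, 0, L, by positivity, hL⟩

/-- Choose `w'` strictly between. There are arbitrarily large `n` with `M_n < n ^ w'`, and for large
`n` the gap `n ^ (w - w') ≥ 2` swallows the factor 2 lost in passing to a bilinear algorithm. -/
theorem fastMul_of_omega_lt {w : ℝ} (hw : omega < w) : 2 ≤ w ∧ FastMul w := by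
  obtain ⟨w', hw1, hw2⟩ := exists_between hw
  have hbdd : Filter.IsCoboundedUnder (· ≥ ·) Filter.atTop
      fun n : ℕ => Real.logb (n : ℝ) (matMulCost n : ℝ) :=
    Filter.IsBoundedUnder.isCoboundedUnder_ge ⟨8, Filter.eventually_map.2
      ((Filter.eventually_ge_atTop 2).mono fun n hn => logb_matMulCost_le hn)⟩
  have hfreq := Filter.frequently_lt_of_liminf_lt hbdd hw1
  have hw'2 : 2 < w' := by
    obtain ⟨n, h1, h2⟩ := (hfreq.and_eventually (Filter.eventually_ge_atTop 2)).exists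
    exact (two_le_logb_matMulCost h2).trans_lt h1
  have hlarge : ∀ s : ℝ, 0 < s → ∀ᶠ n : ℕ in Filter.atTop, (2 : ℝ) ≤ (n : ℝ) ^ s := fun s hs =>
    ((tendsto_rpow_atTop hs).comp tendsto_natCast_atTop_atTop).eventually_ge_atTop 2
  obtain ⟨n, ⟨hlt, hn⟩, hn1, hn2⟩ := ((hfreq.and_eventually
    (Filter.eventually_ge_atTop 2)).and_eventually
      ((hlarge (w - w') (by linarith)).and (hlarge (w - 2) (by linarith)))).exists
  have h1 : (1 : ℝ) < n := by exact_mod_cast hn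
  have h0 : (0 : ℝ) < n := by linarith
  have hM : (0 : ℝ) < matMulCost n := by
    exact_mod_cast lt_of_lt_of_le (show 0 < n * n by positivity) (sq_le_matMulCost n)
  rw [Real.logb_lt_iff_lt_rpow h1 hM] at hlt
  obtain ⟨r, hr, α, γ, W, hW⟩ := (mulComputes_matMulCost n).exists_isBilinearAlgorithm
  refine ⟨by linarith, fastMul_of_isBilinearAlgorithm hn hW (by linarith) ?_ ?_⟩
  · calc (r : ℝ) ≤ 2 * matMulCost n := by exact_mod_cast hr
      _ ≤ (n : ℝ) ^ (w - w') * (n : ℝ) ^ w' := by gcongr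
      _ = (n : ℝ) ^ w := by rw [← Real.rpow_add h0]; congr 1; ring
  · calc (n : ℝ) ^ 2 + 1 ≤ 2 * (n : ℝ) ^ 2 := by nlinarith
      _ ≤ (n : ℝ) ^ (w - 2) * (n : ℝ) ^ 2 := by gcongr
      _ = (n : ℝ) ^ w := by
        rw [← Real.rpow_natCast (n : ℝ) 2, ← Real.rpow_add h0]
        congr 1
        push_cast
        ring

/-- Otherwise `n ^ 2 ≤ M_n` would force a power of the logarithm to dominate `n ^ (2 - w)`. -/
theorem two_le_of_matMulSoftO {w : ℝ} (hw : MatMulSoftO w) : 2 ≤ w := by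
  obtain ⟨C, k, hC⟩ := hw
  by_contra! hlt
  have hs : 0 < 2 - w := by linarith
  have h1 : (fun x : ℝ => (1 + Real.log x) ^ k) =o[Filter.atTop] fun x => x ^ (2 - w) := by
    have h2 : (fun x : ℝ => (1 + Real.log x) ^ k) =O[Filter.atTop]
        fun x => Real.log x ^ (k : ℝ) := by
      refine Asymptotics.IsBigO.of_bound (2 ^ k) ?_
      filter_upwards [Filter.eventually_ge_atTop (Real.exp 1)] with x hx
      have h3 : 1 ≤ Real.log x := by
        rw [← Real.log_exp 1]
        exact Real.log_le_log (Real.exp_pos 1) hx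
      rw [Real.rpow_natCast, norm_pow, norm_pow, ← mul_pow, Real.norm_of_nonneg (by linarith),
        Real.norm_of_nonneg (by linarith)]
      exact pow_le_pow_left₀ (by linarith) (by linarith) _
    exact h2.trans_isLittleO (isLittleO_log_rpow_rpow_atTop _ hs)
  have h2 := (h1.comp_tendsto tendsto_natCast_atTop_atTop).bound
    (show (0 : ℝ) < (2 * (|C| + 1))⁻¹ by positivity)
  obtain ⟨n, hn, hn1⟩ := (h2.and (Filter.eventually_ge_atTop 1)).exists
  have h0 : (0 : ℝ) < n := by exact_mod_cast hn1
  have hlog : 0 ≤ Real.log n := Real.log_natCast_nonneg n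
  simp only [Function.comp_apply] at hn
  rw [Real.norm_of_nonneg (by positivity), Real.norm_of_nonneg (by positivity)] at hn
  have h3 := hC n hn1
  have h4 : ((n : ℝ)) ^ (2 : ℝ) ≤ matMulCost n := by
    rw [Real.rpow_two, sq]
    exact_mod_cast sq_le_matMulCost n
  have h5 : (n : ℝ) ^ (2 : ℝ) = (n : ℝ) ^ w * (n : ℝ) ^ (2 - w) := by
    rw [← Real.rpow_add h0]; congr 1; ring
  have h6 : (0 : ℝ) < (n : ℝ) ^ w := by positivity
  have h7 : (n : ℝ) ^ w * (n : ℝ) ^ (2 - w)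
      ≤ (n : ℝ) ^ w * (|C| * ((2 * (|C| + 1))⁻¹ * (n : ℝ) ^ (2 - w))) := by
    calc (n : ℝ) ^ w * (n : ℝ) ^ (2 - w) ≤ C * (n : ℝ) ^ w * (1 + Real.log n) ^ k := by linarith
      _ ≤ |C| * (n : ℝ) ^ w * (1 + Real.log n) ^ k := by gcongr; exact le_abs_self C
      _ ≤ |C| * (n : ℝ) ^ w * ((2 * (|C| + 1))⁻¹ * (n : ℝ) ^ (2 - w)) := by gcongr
      _ = _ := by ring
  have h8 := le_of_mul_le_mul_left h7 h6
  have h9 : (0 : ℝ) < (n : ℝ) ^ (2 - w) := by positivity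
  have h10 : |C| * (2 * (|C| + 1))⁻¹ < 1 := by
    rw [← div_eq_mul_inv, div_lt_one (by positivity)]
    have := abs_nonneg C
    linarith
  nlinarith

theorem fastMul_of_matMulSoftO {w : ℝ} (hw : MatMulSoftO w) : FastMul w := by
  obtain ⟨C, k, hC⟩ := hw
  refine ⟨|C|, k, matMulCost, abs_nonneg C, fun n => ⟨mulComputes_matMulCost n, fun hn => ?_⟩⟩
  have hlog : 0 ≤ Real.log n := Real.log_natCast_nonneg n
  refine (hC n hn).trans ?_
  gcongr
  exact le_abs_self C

/-! ### Evaluation at powers of `β` -/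

namespace Choice

variable {p : ℕ} [Fact p.Prime] {K : Type*} [Field K] [Algebra ℚ K]
  [IsCyclotomicExtension {p} ℚ K] (c : Choice p K) {X : Type}

/-- The number of steps for the evaluation at `t` powers of `β`. -/
def evalCost (p t L : ℕ) : ℕ :=
  2 * convCost p + (p - 1) * (p - 1)
    + (((p - 1) / t + 1) ^ 2 * L + t * (p - 1) * ((p - 1) / t + 1))

theorem repr_eval (g : Skew p K) (b : K) (k : Fin (p - 1)) :
    c.normalBasis.repr (c.eval g b) k
      = ∑ j, c.normalBasis.repr b j * c.normalBasis.repr (c.eval g (c.v j)) k := by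
  conv_lhs => rw [← c.sum_repr b, eval_sum]
  simp only [← Algebra.smul_def, map_sum, map_smul, Finsupp.coe_finsetSum, Finset.sum_apply,
    Finsupp.smul_apply, smul_eq_mul]

theorem eval_one (f : Skew p K) (b : K) (k : Fin (p - 1)) (hb : b = 1) :
    c.normalBasis.repr (c.eval f b) k
      = -∑ l : Fin (p - 1), c.normalBasis.repr (c.eval f (c.v l)) k := by
  have h : b = ∑ l : Fin (p - 1), algebraMap ℚ K (-1) * c.v l := by
    rw [← mul_sum, sum_v, hb]
    simp
  rw [h, eval_sum]
  simp only [← Algebra.smul_def, map_sum, map_smul, Finsupp.coe_finsetSum, Finset.sum_apply,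
    Finsupp.smul_apply, smul_eq_mul, neg_mul, one_mul, sum_neg_distrib]

/-- The coordinates of `g(f(β ^ i))` are those of `f(β ^ i)` times the matrix `φ(g)`. Hence the
product of `g` and `f` is never formed: two applications of `φ` and one rectangular matrix product
suffice. -/
theorem computes_evaluation {t L : ℕ} (ht : 0 < t) (hL : MulComputes (Fin t) L)
    (f g : Fin (p - 1) → X → K) :
    Computes ((⋃ j, c.coords (f j)) ∪ ⋃ j, c.coords (g j)) (evalCost p t L)
      (⋃ i : Fin t, c.coords fun ξ =>
        c.eval (c.mul (fun j => g j ξ) fun j => f j ξ) (c.v 0 ^ (i : ℕ))) := by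
  let F : Matrix (Fin (p - 1)) (Fin (p - 1)) (X → ℚ) := Matrix.of fun i k ξ =>
    c.normalBasis.repr (c.eval (fun j => f j ξ) (c.v i)) k
  let G : Matrix (Fin (p - 1)) (Fin (p - 1)) (X → ℚ) := Matrix.of fun i k ξ =>
    c.normalBasis.repr (c.eval (fun j => g j ξ) (c.v i)) k
  let E : Matrix (Fin t) (Fin (p - 1)) (X → ℚ) := Matrix.of fun i k ξ =>
    c.normalBasis.repr (c.eval (fun j => f j ξ) (c.v 0 ^ (i : ℕ))) k
  have hF : Computes (⋃ j, c.coords (f j)) (convCost p) (entrySet F) :=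
    (c.computes_phi f).mono_right (entrySet_subset fun i k => Set.mem_iUnion.2 ⟨i, k, rfl⟩)
  have hG : Computes (⋃ j, c.coords (g j)) (convCost p) (entrySet G) :=
    (c.computes_phi g).mono_right (entrySet_subset fun i k => Set.mem_iUnion.2 ⟨i, k, rfl⟩)
  have hE : Computes (entrySet F ∪ entrySet G) ((p - 1) * (p - 1)) (entrySet E) := by
    have h1 := Computes.biUnion_const (F := entrySet F ∪ entrySet G) (univ : Finset (Fin (p - 1)))
      (p - 1) (fun k => {∑ l, F l k}) fun k _ => by
        have := Computes.sum (F := entrySet F ∪ entrySet G) univ (fun l => F l k) fun l _ =>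
          subset_scalings _ (Or.inl (mem_entrySet F l k))
        rwa [card_univ, Fintype.card_fin] at this
    rw [card_univ, Fintype.card_fin] at h1
    have h2 := (Computes.of_subset (F := entrySet F ∪ entrySet G)
      (subset_scalings _)).union h1
    refine (h2.mono_cost (by omega)).mono (subset_scalings _) le_rfl ?_
    refine entrySet_subset fun i k => ?_
    -- The number `t` is arbitrary here, so `i` may exceed `p`; `β ^ i` is `1` or a basis vector
    -- according to its residue. The column sums of `F` computed above serve the first case.
    by_cases hi : ((i : ℕ) : ZMod p) = 0
    · have h3 : E i k = -∑ l, F l k := by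
        ext ξ
        simp only [E, F, Matrix.of_apply, Pi.neg_apply, Finset.sum_apply]
        refine c.eval_one _ _ k ?_
        rw [v_zero, ← χ_natCast, hi, AddChar.map_zero_eq_one]
      rw [h3]
      exact neg_mem_scalings (subset_scalings _ (Or.inr (by simp)))
    · obtain ⟨l, hl⟩ := c.u_pow_bijective.surjective (Units.mk0 _ hi)
      have h3 : E i k = F l k := by
        ext ξ
        simp only [E, F, Matrix.of_apply]
        congr 3
        rw [v_zero, ← χ_natCast, v_eq]
        congr 1
        exact (congrArg Units.val hl).symm
      rw [h3]
      exact subset_scalings _ (Or.inl (Or.inl (mem_entrySet F l k)))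
  have hEG := hL.rectangular ht E G
  have h1 := (hF.mono_left Set.subset_union_left).union
    (hG.mono_left (F' := (⋃ j, c.coords (f j)) ∪ ⋃ j, c.coords (g j)) Set.subset_union_right)
  have h2 := (hE.trans_union (hEG.mono_left (Set.union_subset Set.subset_union_right
    (Set.subset_union_right.trans Set.subset_union_left)))).mono_right Set.subset_union_right
  refine ((h1.trans h2).mono_cost (le_of_eq ?_)).mono_right ?_
  · rw [evalCost]; ring
  · refine Set.iUnion_subset fun i => ?_
    rintro _ ⟨k, rfl⟩
    convert mem_entrySet (E * G) i k using 1
    ext ξ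
    beta_reduce
    rw [eval_mul, repr_eval]
    simp [Matrix.mul_apply, E, G, Finset.sum_apply]

theorem exists_evaluate {t L : ℕ} (hL : MulComputes (Fin t) L) :
    ∃ P : Addr (p - 1) (p - 1) → Addr (p - 1) (p - 1) → Prog (Addr t (p - 1)),
    ∀ f g m a b, c.Stores m a f → c.Stores m b g → (P a b).Yields m fun out m' k =>
      c.Stores m' out (fun i => c.eval (c.mul g f) (c.v 0 ^ i.val)) ∧
        k ≤ 5 * (evalCost p t L + t * (p - 1)) := by
  rcases Nat.eq_zero_or_pos t with rfl | ht
  · exact ⟨fun _ _ => .ret fun i => i.elim0, fun f g m a b _ _ =>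
      ⟨_, m, 0, rfl, fun i => i.elim0, Nat.zero_le _⟩⟩
  let X := (Fin (p - 1) → Fin (p - 1) → ℚ) × (Fin (p - 1) → Fin (p - 1) → ℚ)
  have h := c.computes_evaluation ht hL (X := X) (fun j ξ => c.ofCoords j ξ.1)
    fun j ξ => c.ofCoords j ξ.2
  have h' : Computes
      (Set.range fun (x : Var (p - 1)) (ξ : X) =>
        Sum.elim (fun x => ξ.1 x.1 x.2) (fun x => ξ.2 x.1 x.2) x) (evalCost p t L)
      (Set.range fun (x : Fin t × Fin (p - 1)) (ξ : X) => c.normalBasis.repr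
        (c.eval (c.mul (fun j => c.ofCoords j ξ.2) fun j => c.ofCoords j ξ.1)
          (c.v 0 ^ (x.1 : ℕ))) x.2) := by
    refine (h.mono_left (Set.union_subset ?_ ?_)).mono_right ?_
    · refine Set.iUnion_subset fun i => ?_
      rintro _ ⟨k, rfl⟩
      exact ⟨.inl (i, k), funext fun ξ => (c.repr_ofCoords i ξ.1 k).symm⟩
    · refine Set.iUnion_subset fun i => ?_
      rintro _ ⟨k, rfl⟩
      exact ⟨.inr (i, k), funext fun ξ => (c.repr_ofCoords i ξ.2 k).symm⟩
    · rintro _ ⟨x, rfl⟩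
      exact Set.mem_iUnion.2 ⟨x.1, x.2, rfl⟩
  obtain ⟨P, hP⟩ := h'.compile
  refine ⟨fun a b => (P (Sum.elim (fun x => a x.1 x.2) fun x => b x.1 x.2)).bind fun out =>
    .ret fun i k => out (i, k), fun f g m a b hf hg => ?_⟩
  refine Prog.Yields.bind (((hP _).2 m (fun i k => c.normalBasis.repr (f i) k,
    fun i k => c.normalBasis.repr (g i) k) ?_).mono ?_)
  · rintro (x | x)
    · exact hf _ _
    · exact hg _ _
  · rintro out m' k ⟨hout, hk⟩
    refine ⟨_, m', 0, rfl, fun i j => ?_, ?_⟩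
    · have := hout (i, j)
      simpa only [ofCoords_repr] using this
    · simpa using hk

end Choice

/-! ## The total cost -/

section Cost

variable {p : ℕ} [Fact p.Prime]

theorem one_add_log_ge_one (p : ℕ) : 1 ≤ 1 + Real.log p := by
  have := Real.log_natCast_nonneg p
  linarith

theorem convCost_le (p : ℕ) [Fact p.Prime] :
    (Choice.convCost p : ℝ) ≤ 61440 * (p : ℝ) ^ 2 * (1 + Real.log p) ^ 2 := by
  have hp : 2 ≤ p := (Fact.out : p.Prime).two_le
  set s := Nat.clog 2 (4 * p) with hs
  have h1 : 2 ^ (s - 1) < 4 * p := Nat.pow_pred_clog_lt_self (by norm_num) (by omega)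
  have h2 : ((s - 1 : ℕ) : ℝ) * Real.log 2 ≤ 2 * Real.log 2 + Real.log p := by
    have h3 : ((2 : ℝ) ^ (s - 1)) ≤ 2 ^ 2 * p := by
      have : (2 ^ (s - 1) : ℕ) ≤ 2 ^ 2 * p := by omega
      exact_mod_cast this
    have h4 := Real.log_le_log (by positivity) h3
    rw [Real.log_pow, Real.log_mul (by norm_num) (by positivity), Real.log_pow] at h4
    exact_mod_cast h4
  have h3 : (s : ℝ) ≤ ((s - 1 : ℕ) : ℝ) + 1 := by
    have : s ≤ (s - 1) + 1 := by omega
    exact_mod_cast this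
  have hl2 := Real.log_two_gt_d9
  have hlp := Real.log_natCast_nonneg p
  have h5 : (s : ℝ) + 1 ≤ 4 * (1 + Real.log p) := by nlinarith
  have h6 : ((s : ℝ) + 1) ^ 2 ≤ (4 * (1 + Real.log p)) ^ 2 :=
    pow_le_pow_left₀ (by positivity) h5 2
  rw [Choice.convCost, ← hs]
  push_cast
  nlinarith [mul_le_mul_of_nonneg_left h6 (show (0 : ℝ) ≤ 3840 * (p : ℝ) ^ 2 by positivity)]

/-- The total number of operations in terms of the size `t` of the sumset. -/
def totalCost (p t L : ℕ) : ℕ :=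
  5 * (Choice.convCost p + (p - 1) * (p - 1)) + 5 * (Choice.convCost p + (p - 1) * (p - 1))
    + 2 * ((p - 1) * (p - 1)) + 5 * (Choice.evalCost p t L + t * (p - 1))
    + 5 * (3 * Choice.convCost p + (p - 1) * (p - 1))
    + 5 * (Choice.convCost p + (p - 1) * (p - 1))

theorem totalCost_le (p : ℕ) [Fact p.Prime] {t L : ℕ} (ht : t ≤ p - 1) {w C : ℝ} {k : ℕ}
    (hw : 2 ≤ w) (hC : 0 ≤ C) (h0 : t = 0 → L = 0)
    (hL : 1 ≤ t → (L : ℝ) ≤ C * (t : ℝ) ^ w * (1 + Real.log t) ^ k) :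
    (totalCost p t L : ℝ) ≤ (2500000 + 20 * C) * ((max t 1 : ℕ) : ℝ) ^ (w - 2) * (p : ℝ) ^ 2
      * (1 + Real.log p) ^ (k + 2) := by
  have hp : 2 ≤ p := (Fact.out : p.Prime).two_le
  set N := p - 1 with hN
  set ℓ := 1 + Real.log p with hℓ
  have hℓ1 : 1 ≤ ℓ := one_add_log_ge_one p
  set D := ((max t 1 : ℕ) : ℝ) ^ (w - 2) with hD
  have hD1 : 1 ≤ D := Real.one_le_rpow (by exact_mod_cast le_max_right t 1) (by linarith)
  have hconv := convCost_le p
  have hNp : (N : ℝ) ≤ p := by exact_mod_cast Nat.sub_le p 1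
  have hNp2 : (N : ℝ) * N ≤ (p : ℝ) ^ 2 := by rw [sq]; gcongr
  have htN : (t : ℝ) ≤ N := by exact_mod_cast ht
  have hpp : (0 : ℝ) < (p : ℝ) ^ 2 := by positivity
  have hℓk : 1 ≤ ℓ ^ k := one_le_pow₀ hℓ1
  have hmain : (((N / t + 1) ^ 2 * L : ℕ) : ℝ) ≤ 4 * C * (D * (p : ℝ) ^ 2 * ℓ ^ k) := by
    rcases Nat.eq_zero_or_pos t with ht0 | ht0
    · rw [h0 ht0, mul_zero, Nat.cast_zero]
      positivity
    have ht0' : (0 : ℝ) < t := by exact_mod_cast ht0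
    -- As `t ≤ N`, the additional block at most doubles the quotient.
    have h1 : ((N / t + 1 : ℕ) : ℝ) ≤ 2 * N / t := by
      have : ((N / t : ℕ) : ℝ) ≤ N / t := Nat.cast_div_le
      have h2 : (1 : ℝ) ≤ N / t := by rwa [le_div_iff₀ ht0', one_mul]
      push_cast
      rw [mul_div_assoc]
      linarith
    have h2 : D = (t : ℝ) ^ w / (t : ℝ) ^ 2 := by
      rw [hD, max_eq_left (by omega), Real.rpow_sub ht0', Real.rpow_two]
    have h3 : 1 + Real.log t ≤ ℓ := by
      have := Real.log_le_log ht0' (htN.trans hNp)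
      linarith
    have h4 : 0 ≤ Real.log t := Real.log_natCast_nonneg t
    calc (((N / t + 1) ^ 2 * L : ℕ) : ℝ) = ((N / t + 1 : ℕ) : ℝ) ^ 2 * L := by push_cast; ring
      _ ≤ (2 * N / t) ^ 2 * (C * (t : ℝ) ^ w * (1 + Real.log t) ^ k) := by
        gcongr
        exact hL ht0
      _ ≤ (2 * p / t) ^ 2 * (C * (t : ℝ) ^ w * ℓ ^ k) := by gcongr
      _ = 4 * C * (D * (p : ℝ) ^ 2 * ℓ ^ k) := by
        rw [h2]; field_simp; ring
  have hmid : ((t * N * (N / t + 1) : ℕ) : ℝ) ≤ 2 * (p : ℝ) ^ 2 := by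
    have h1 : t * N * (N / t + 1) ≤ N * N + N * N := by
      have := Nat.mul_div_le N t
      calc t * N * (N / t + 1) = (t * (N / t)) * N + t * N := by ring
        _ ≤ N * N + N * N := by gcongr
    have h2 : ((t * N * (N / t + 1) : ℕ) : ℝ) ≤ (N * N + N * N : ℕ) := by exact_mod_cast h1
    push_cast at h2 ⊢
    linarith
  have hlast : (t : ℝ) * N ≤ (p : ℝ) ^ 2 := le_trans (by gcongr) hNp2
  have hunit : (p : ℝ) ^ 2 ≤ D * (p : ℝ) ^ 2 * ℓ ^ (k + 2) := by
    have h1 : 1 ≤ ℓ ^ (k + 2) := one_le_pow₀ hℓ1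
    nlinarith [one_le_mul_of_one_le_of_one_le hD1 h1]
  have hconv2 : (p : ℝ) ^ 2 * ℓ ^ 2 ≤ D * (p : ℝ) ^ 2 * ℓ ^ (k + 2) := by
    rw [pow_add]
    have h1 := one_le_mul_of_one_le_of_one_le hD1 hℓk
    have h2 : 0 ≤ (p : ℝ) ^ 2 * ℓ ^ 2 := by positivity
    nlinarith
  have hmain2 : D * (p : ℝ) ^ 2 * ℓ ^ k ≤ D * (p : ℝ) ^ 2 * ℓ ^ (k + 2) := by
    gcongr
    omega
  have hmain3 := mul_le_mul_of_nonneg_left hmain2 (show 0 ≤ 4 * C by linarith)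
  have hsum : (totalCost p t L : ℝ) = 40 * (Choice.convCost p : ℝ) + 27 * ((N : ℝ) * N)
      + 5 * (((N / t + 1) ^ 2 * L : ℕ) : ℝ) + 5 * ((t * N * (N / t + 1) : ℕ) : ℝ)
      + 5 * ((t : ℝ) * N) := by
    simp only [totalCost, Choice.evalCost, ← hN]
    push_cast
    ring
  rw [hsum]
  set Y := D * (p : ℝ) ^ 2 * ℓ ^ (k + 2) with hY
  have hgoal : (2500000 + 20 * C) * D * (p : ℝ) ^ 2 * ℓ ^ (k + 2)
      = 2500000 * Y + 5 * (4 * C * Y) := by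
    rw [hY]; ring
  rw [hgoal]
  linarith

end Cost

theorem exists_implementation {w : ℝ} (hw : omega < w ∨ MatMulSoftO w) :
    ∃ (C : ℝ) (k : ℕ), ∀ (p : ℕ) [Fact p.Prime] (K : Type*) [Field K] [Algebra ℚ K]
      [IsCyclotomicExtension {p} ℚ K] (c : Choice p K), ∃ I : Implementation c,
        ∀ (A B : Matrix (Fin (p - 1)) (Fin (p - 1)) ℚ) (m : List ℚ)
          (a b : Addr (p - 1) (p - 1)), StoresMatrix m a A → StoresMatrix m b B →
            (I.prog a b).Yields m fun out m' cost => StoresMatrix m' out (A * B) ∧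
              (cost : ℝ) ≤ C * ((max (sumset (c.phiInv A) (c.phiInv B)).card 1 : ℕ) : ℝ) ^ (w - 2)
                * (p : ℝ) ^ 2 * (1 + Real.log p) ^ k := by
  obtain ⟨hw2, C, k, L, hC, hL⟩ : 2 ≤ w ∧ FastMul w := hw.elim fastMul_of_omega_lt fun h =>
    ⟨two_le_of_matMulSoftO h, fastMul_of_matMulSoftO h⟩
  -- The bound on `L` says nothing at `t = 0`, which occurs when `A` or `B` vanishes; there nothing
  -- has to be multiplied.
  let L' : ℕ → ℕ := fun t => if t = 0 then 0 else L t
  have hL' : ∀ t, MulComputes (Fin t) (L' t) := by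
    intro t
    by_cases ht : t = 0
    · subst ht
      exact MulComputes.naive (Fin 0)
    · simpa only [L', if_neg ht] using (hL t).1
  refine ⟨2500000 + 20 * C, k + 2, fun p _ K _ _ _ c => ?_⟩
  obtain ⟨P1, h1⟩ := c.exists_toSkew
  obtain ⟨P2, h2⟩ := c.exists_findSumset
  choose P3 h3 using fun t => c.exists_evaluate (hL' t)
  choose P4 h4 using c.exists_interpolate
  obtain ⟨P5, h5⟩ := c.exists_toMatrix
  let I : Implementation c :=
    { toSkew := P1
      toSkew_spec := fun A m a h => (h1 A m a h).mono fun _ _ _ h => h.1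
      findSumset := P2
      findSumset_spec := fun f g m a b hf hg => (h2 f g m a b hf hg).mono fun _ _ _ h => h.1
      evaluate := fun a b t => P3 t a b
      evaluate_spec := fun f g m a b t hf hg => (h3 t f g m a b hf hg).mono fun _ _ _ h => h.1
      interpolate := P4
      interpolate_spec := fun S z m a h => (h4 S z m a h).mono fun _ _ _ h => h.1
      toMatrix := P5
      toMatrix_spec := fun f m a h => (h5 f m a h).mono fun _ _ _ h => h.1 }
  refine ⟨I, fun A B m a b ha hb => ?_⟩
  set t := (sumset (c.phiInv A) (c.phiInv B)).card with ht
  have htp : t ≤ p - 1 := by simpa using card_le_univ (sumset (c.phiInv A) (c.phiInv B))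
  refine (I.prog_yields (Q := True) (fun _ m a h => (h1 A m a h).mono fun _ _ _ h => h.2)
    (fun _ m a h => (h1 B m a h).mono fun _ _ _ h => h.2)
    (fun _ m a b hf hg => (h2 _ _ m a b hf hg).mono fun _ _ _ h => h.2)
    (fun _ m a b hf hg => (h3 t _ _ m a b hf hg).mono fun _ _ _ h => h.2)
    (fun _ S z m a h => (h4 S z m a h).mono fun _ _ _ h => h.2)
    (fun _ f m a h => (h5 f m a h).mono fun _ _ _ h => h.2) ha hb).mono ?_
  rintro out m' n ⟨hout, hn⟩
  refine ⟨hout, le_trans (Nat.cast_le.2 (hn trivial)) (totalCost_le p htp hw2 hC ?_ ?_)⟩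
  · intro h0
    simp [L', h0]
  · intro h1
    simp only [L', show t ≠ 0 by omega, if_false]
    exact (hL t).2 h1

end SkewMM

theorem mainTheorem3 :
    -- `β` and `r` exist, `φ` is bijective with the given inverse, and the algorithm computes `A * B`
    (∀ (p : ℕ) [Fact p.Prime] (K : Type*) [Field K] [Algebra ℚ K]
        [IsCyclotomicExtension {p} ℚ K],
      Nonempty (SkewMM.Choice p K) ∧
      ∀ c : SkewMM.Choice p K,
        (∀ A, c.phi (c.phiInv A) = A) ∧ (∀ f, c.phiInv (c.phi f) = f) ∧
        ∀ (I : SkewMM.Implementation c) (A B : Matrix (Fin (p - 1)) (Fin (p - 1)) ℚ)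
          (m : List ℚ) (a b : SkewMM.Addr (p - 1) (p - 1)),
          SkewMM.StoresMatrix m a A → SkewMM.StoresMatrix m b B →
            (I.prog a b).Yields m fun out m' _ => SkewMM.StoresMatrix m' out (A * B)) ∧
    -- the steps can be implemented so that the total cost is as claimed
    (∀ w : ℝ, (SkewMM.omega < w ∨ SkewMM.MatMulSoftO w) →
      ∃ (C : ℝ) (k : ℕ), ∀ (p : ℕ) [Fact p.Prime] (K : Type*) [Field K] [Algebra ℚ K]
        [IsCyclotomicExtension {p} ℚ K]
        (c : SkewMM.Choice p K),
        ∃ I : SkewMM.Implementation c,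
          ∀ (A B : Matrix (Fin (p - 1)) (Fin (p - 1)) ℚ)
            (m : List ℚ) (a b : SkewMM.Addr (p - 1) (p - 1)),
            SkewMM.StoresMatrix m a A → SkewMM.StoresMatrix m b B →
              (I.prog a b).Yields m fun out m' cost =>
                SkewMM.StoresMatrix m' out (A * B) ∧
                (cost : ℝ) ≤
                  C * ((max (SkewMM.sumset (c.phiInv A) (c.phiInv B)).card 1 : ℕ) : ℝ) ^ (w - 2)
                    * (p : ℝ) ^ 2 * (1 + Real.log p) ^ k) :=
  ⟨fun p _ K _ _ _ => ⟨SkewMM.nonempty_choice p K, fun c => ⟨c.phi_phiInv, c.phiInv_phi,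
    fun I _ _ _ _ _ ha hb => I.correct ha hb⟩⟩, fun _ hw => SkewMM.exists_implementation hw⟩
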